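/- **Setting.** Let $m,k,r,h_0$ be fixed integers and let $p=p_n$, $q=q_n$, $T=T_n$ tend jointly to infinity. For each $n$ one observes $\mathbf Y_t\in\mathbb R^{p\times q}$ and $\mathbf X_t\in\mathbb R^{m\times q}$, $1\le t\le T$, from the model $$\mathbf Y_t=\mathbf A\mathbf X_t+\mathbf R\mathbf F_t\mathbf C'+\mathbf E_t ,$$ with unknown $\mathbf A\in\mathbb R^{p\times m}$, $\mathbf R\in\mathbb R^{p\times k}$, $\mathbf C\in\mathbb R^{q\times r}$ and latent $\mathbf F_t\in\mathbb R^{k\times r}$, $E\,\mathbf F_t=\mathbf 0$. The errors form a white noise, $\mathrm{vec}(\mathbf E_t)\sim \mathrm{WN}(\mathbf 0,\boldsymbol\Sigma_e)$; $\mathbf E_t$ is uncorrelated with $\mathbf X_t$ and with every $\mathbf F_s$; and $\mathrm{Cov}(\mathrm{vec}\,\mathbf X_t,\mathrm{vec}\,\mathbf F_t)=\mathbf 0$. Write $\mathbf W_t=\mathbf R\mathbf F_t\mathbf C'+\mathbf E_t$ with columns $\mathbf w_{t,i}$, and put $$\boldsymbol\Omega_{ij}(h)=\frac1{T-h}\sum_{t=1}^{T-h}\mathrm{Cov}(\mathbf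 w_{t,i},\mathbf w_{t+h,j}),\qquad \mathbf M_1=\sum_{h=1}^{h_0}\sum_{i,j=1}^q\boldsymbol\Omega_{ij}(h)\boldsymbol\Omega_{ij}(h)'.$$ Let $\mathbf M_2\in\mathbb R^{q\times q}$ be constructed in the same way from $\mathbf W_t'$. Let $$\widehat{\mathbf A}=\Big(\frac1T\sum_{t=1}^T\mathbf Y_t\mathbf X_t'\Big)\Big(\frac1T\sum_{t=1}^T\mathbf X_t\mathbf X_t'\Big)^{-1},\qquad \widehat{\mathbf W}_t=\mathbf Y_t-\widehat{\mathbf A}\mathbf X_t ,$$ and let $\widehat{\mathbf M}_1,\widehat{\mathbf M}_2$ be built like $\mathbf M_1,\mathbf M_2$, with $\boldsymbol\Omega_{ij}(h)$ replaced by $\frac1{T-h}\sum_{t=1}^{T-h}\widehat{\mathbf w}_{t,i}\widehat{\mathbf w}_{t+h,j}'$, where $\widehat{\mathbf w}_{t,i}$ is the $i$-th column of $\widehat{\mathbf W}_t$ (respectively of $\widehat{\mathbf W}_t'$). Let $\mathbf Q_1$ ($p\times k$) and $\mathbf Q_2$ ($q\times r$) have as columns orthonormal eigenvectors of $\mathbf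 M_1$, $\mathbf M_2$ for the $1$st, $2$nd, … largest eigenvalues, and let $\widehat{\mathbf Q}_1,\widehat{\mathbf Q}_2$ be formed likewise from $\widehat{\mathbf M}_1,\widehat{\mathbf M}_2$, the sign of each column of $\widehat{\mathbf Q}_i$ being chosen so that its inner product with the corresponding column of $\mathbf Q_i$ is nonnegative. **Conditions** (constants do not depend on $n$; $a\asymp b$ means that $a/b$ is eventually bounded and bounded away from $0$). 1. The process $\{(\mathrm{vec}\,\mathbf Y_t,\mathrm{vec}\,\mathbf X_t,\mathrm{vec}\,\mathbf F_t)\}_{t\in\mathbb Z}$ is $\alpha$-mixing with $\sum_{d\ge1}\alpha(d)^{1-2/\gamma}\le K$ for some $\gamma>2$ and $K<\infty$, where $\alpha(d)=\sup_i\sup\{|P(A)P(B)-P(A\cap B)|: A\in\mathcal F_{-\infty}^i,\,B\in\mathcal F_{i+d}^\infty\}$ and $\mathcal F_i^j$ is the $\sigma$-field generated by the process at times $i\le t\le j$. 2. The absolute moments of order $2\gamma$ of all entries of $\mathbf F_t,\mathbf X_t,\mathbf E_t$, $1\le t\le T$, are bounded by a constant. 3. Let $\boldsymbol\Sigma_f(h)=\frac1{T-h}\sum_{t=1}^{T-h}\mathrm{Cov}(\mathrm{vec}\,\mathbf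 F_t,\mathrm{vec}\,\mathbf F_{t+h})$ and $k^*=\max(k,r)$. For some $1\le h\le h_0$, eventually $\boldsymbol\Sigma_f(h)$ has rank $k^*$, $\|\boldsymbol\Sigma_f(h)\|_2\asymp1\asymp\sigma_{k^*}(\boldsymbol\Sigma_f(h))$, and $\frac1{T-h}\sum_{t=1}^{T-h}\mathrm{Cov}(F_{t,i\cdot},F_{t+h,i\cdot})\ne\mathbf 0$, $\frac1{T-h}\sum_{t=1}^{T-h}\mathrm{Cov}(F_{t,\cdot j},F_{t+h,\cdot j})\ne\mathbf 0$ for all $i\le k$, $j\le r$. 4. $\mathbf P_t=E(\mathbf X_t\mathbf X_t')$ is positive definite, and $\big\|\frac1T\sum_{t=1}^T\mathbf P_t-\mathbf P\big\|_2\to0$ for positive definite $m\times m$ matrices $\mathbf P=\mathbf P^{(n)}$ with $\lambda_{\min}(\mathbf P)\asymp q$. 5. The entries of $\boldsymbol\Sigma_e$ are bounded by a constant. 6. There are constants $\delta_1,\delta_2\in[0,1]$ with $\|\mathbf R\|_2^2\asymp p^{1-\delta_1}\asymp\|\mathbf R\|_{\min}^2$ and $\|\mathbf C\|_2^2\asymp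 q^{1-\delta_2}\asymp\|\mathbf C\|_{\min}^2$, where $\|\cdot\|_{\min}$ is the smallest singular value. 7. The $k$ largest eigenvalues of $\mathbf M_1$ and the $r$ largest eigenvalues of $\mathbf M_2$ are positive and distinct, uniformly in $n$: there is $c>0$ such that, eventually, each of these eigenvalues of $\mathbf M_i$ and each difference of two of them (larger minus smaller) is at least $c$ times the largest eigenvalue of $\mathbf M_i$, which is positive. **Theorem.** Under Conditions 1–7 and $p^{\delta_1}q^{\delta_2}T^{-1/2}=o(1)$, $$\|\widehat{\mathbf Q}_i-\mathbf Q_i\|_2=O_p\big(p^{\delta_1}q^{\delta_2}T^{-1/2}\big),\qquad i=1,2.$$ -/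

import Mathlib

open MeasureTheory ProbabilityTheory Filter Topology Asymptotics

noncomputable section

namespace MatrixFactor

/-! Linear algebra -/

/-- The `j`-th largest eigenvalue (counted from `j = 0`, with multiplicity) of a real symmetric
matrix; `0` if there is no such eigenvalue. -/
def eigVal {ι : Type*} [Fintype ι] [DecidableEq ι] (M : Matrix ι ι ℝ) (j : ℕ) : ℝ :=
  if h : M.IsHermitian ∧ j < Fintype.card ι then h.1.eigenvalues₀ ⟨j, h.2⟩ else 0

/-- The `j`-th largest singular value (counted from `j = 0`) of a real matrix. -/
def singVal {ι κ : Type*} [Fintype ι] [Fintype κ] [DecidableEq κ]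
    (A : Matrix ι κ ℝ) (j : ℕ) : ℝ :=
  Real.sqrt (eigVal (A.transpose * A) j)

open scoped Matrix.Norms.L2Operator in
/-- The spectral norm `‖A‖₂` of a (possibly rectangular) real matrix. -/
def specNorm {ι κ : Type*} [Fintype ι] [Fintype κ] [DecidableEq κ] (A : Matrix ι κ ℝ) : ℝ := ‖A‖

/-- `‖A‖_min`: the smallest singular value of a matrix with `d` columns (all the matrices it is
used for have full column rank, so that it is also the smallest nonzero singular value). -/
def minNorm {a d : ℕ} (A : Matrix (Fin a) (Fin d) ℝ) : ℝ := singVal A (d - 1)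

/-- The columns of `Q` are orthonormal, and the `j`-th column is an eigenvector of `M` for the
`j`-th largest eigenvalue of `M`. -/
def IsLeadingEigenvectors {a d : ℕ} (M : Matrix (Fin a) (Fin a) ℝ)
    (Q : Matrix (Fin a) (Fin d) ℝ) : Prop :=
  Q.transpose * Q = 1 ∧
    ∀ j : Fin d, M.mulVec (fun u => Q u j) = eigVal M j • (fun u => Q u j)

/-! Autocovariances and the matrices `M` built from them -/

/-- The cross-covariance matrix `Cov(U, V)` of two random vectors. -/
def crossCov {Ω ι κ : Type*} [MeasurableSpace Ω] (P : Measure Ω)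
    (U : Ω → ι → ℝ) (V : Ω → κ → ℝ) : Matrix ι κ ℝ :=
  Matrix.of fun a b => covariance (fun ω => U ω a) (fun ω => V ω b) P

/-- `(T - h)⁻¹ ∑_{t = 1}^{T - h} Cov(U_t, V_{t + h})`. -/
def avgLagCov {Ω ι κ : Type*} [MeasurableSpace Ω] (P : Measure Ω) (T h : ℕ)
    (U : ℤ → Ω → ι → ℝ) (V : ℤ → Ω → κ → ℝ) : Matrix ι κ ℝ :=
  (1 / ((T : ℝ) - h)) •
    ∑ t ∈ Finset.Icc (1 : ℤ) ((T : ℤ) - h), crossCov P (U t) (V (t + h))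

/-- `(T - h)⁻¹ ∑_{t = 1}^{T - h} u_t v_{t + h}'` for two observed series of vectors. -/
def sampleLagCov {ι κ : Type*} (T h : ℕ) (u : ℤ → ι → ℝ) (v : ℤ → κ → ℝ) : Matrix ι κ ℝ :=
  (1 / ((T : ℝ) - h)) •
    ∑ t ∈ Finset.Icc (1 : ℤ) ((T : ℤ) - h), Matrix.vecMulVec (u t) (v (t + h))

/-- `∑_{h = 1}^{h₀} ∑_i ∑_j Ω_{ij}(h) Ω_{ij}(h)'`, where `Ω_{ij}(h)` is the averaged lag-`h`
cross-covariance of the `i`-th and the `j`-th column of the matrix process `W`. -/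
def popM {Ω : Type*} [MeasurableSpace Ω] (P : Measure Ω) (T h₀ : ℕ) {a b : ℕ}
    (W : ℤ → Ω → Matrix (Fin a) (Fin b) ℝ) : Matrix (Fin a) (Fin a) ℝ :=
  ∑ h ∈ Finset.Icc 1 h₀, ∑ i : Fin b, ∑ j : Fin b,
    avgLagCov P T h (fun t ω u => W t ω u i) (fun t ω u => W t ω u j) *
      (avgLagCov P T h (fun t ω u => W t ω u i) (fun t ω u => W t ω u j)).transpose

/-- The sample version of `popM`, for an observed matrix series `w`. -/
def sampleM (T h₀ : ℕ) {a b : ℕ} (w : ℤ → Matrix (Fin a) (Fin b) ℝ) :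
    Matrix (Fin a) (Fin a) ℝ :=
  ∑ h ∈ Finset.Icc 1 h₀, ∑ i : Fin b, ∑ j : Fin b,
    sampleLagCov T h (fun t u => w t u i) (fun t u => w t u j) *
      (sampleLagCov T h (fun t u => w t u i) (fun t u => w t u j)).transpose

/-! The model -/

/-- The matrix regression with latent factors
`Y_t = A X_t + R F_t C' + E_t`, `1 ≤ t ≤ T`,
with `vec(E_t) ∼ WN(0, Σ_e)`, centred latent factors, `E_t` uncorrelated with `X_t` and with the
factor process (at all leads and lags), and `F_t` uncorrelated with `X_t`. The processes live on the time axis `ℤ`;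
moment assumptions are made on the observation window only. -/
structure Model (p q m k r T : ℕ) {Ω : Type*} [MeasurableSpace Ω] (P : Measure Ω) where
  /-- the observed response -/
  Y : ℤ → Ω → Matrix (Fin p) (Fin q) ℝ
  /-- the observed known factors -/
  X : ℤ → Ω → Matrix (Fin m) (Fin q) ℝ
  /-- the latent factors -/
  F : ℤ → Ω → Matrix (Fin k) (Fin r) ℝ
  /-- the errors -/
  E : ℤ → Ω → Matrix (Fin p) (Fin q) ℝ
  /-- the regression coefficients -/
  A : Matrix (Fin p) (Fin m) ℝ
  /-- the row loadings -/
  R : Matrix (Fin p) (Fin k) ℝ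
  /-- the column loadings -/
  C : Matrix (Fin q) (Fin r) ℝ
  /-- the covariance matrix of `vec(E_t)` -/
  covE : Matrix (Fin q × Fin p) (Fin q × Fin p) ℝ
  measurable_Y : ∀ t i j, Measurable fun ω => Y t ω i j
  measurable_X : ∀ t i j, Measurable fun ω => X t ω i j
  measurable_F : ∀ t i j, Measurable fun ω => F t ω i j
  model_eq : ∀ t ∈ Set.Icc (1 : ℤ) T, ∀ ω,
    Y t ω = A * X t ω + R * F t ω * C.transpose + E t ω
  memLp_X : ∀ t ∈ Set.Icc (1 : ℤ) T, ∀ i j, MemLp (fun ω => X t ω i j) 2 P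
  memLp_F : ∀ t ∈ Set.Icc (1 : ℤ) T, ∀ i j, MemLp (fun ω => F t ω i j) 2 P
  memLp_E : ∀ t ∈ Set.Icc (1 : ℤ) T, ∀ i j, MemLp (fun ω => E t ω i j) 2 P
  mean_F : ∀ t ∈ Set.Icc (1 : ℤ) T, ∀ i j, ∫ ω, F t ω i j ∂P = 0
  mean_E : ∀ t ∈ Set.Icc (1 : ℤ) T, ∀ i j, ∫ ω, E t ω i j ∂P = 0
  var_E : ∀ t ∈ Set.Icc (1 : ℤ) T,
    crossCov P (fun ω => (E t ω).vec) (fun ω => (E t ω).vec) = covE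
  white_E : ∀ s ∈ Set.Icc (1 : ℤ) T, ∀ t ∈ Set.Icc (1 : ℤ) T, s ≠ t →
    crossCov P (fun ω => (E s ω).vec) (fun ω => (E t ω).vec) = 0
  uncorr_E_X : ∀ t ∈ Set.Icc (1 : ℤ) T,
    crossCov P (fun ω => (E t ω).vec) (fun ω => (X t ω).vec) = 0
  uncorr_E_F : ∀ s ∈ Set.Icc (1 : ℤ) T, ∀ t ∈ Set.Icc (1 : ℤ) T,
    crossCov P (fun ω => (E s ω).vec) (fun ω => (F t ω).vec) = 0
  uncorr_X_F : ∀ t ∈ Set.Icc (1 : ℤ) T,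
    crossCov P (fun ω => (X t ω).vec) (fun ω => (F t ω).vec) = 0

namespace Model

variable {p q m k r T : ℕ} {Ω : Type*} [MeasurableSpace Ω] {P : Measure Ω}

/-- `W_t = R F_t C' + E_t`. -/
def W (S : Model p q m k r T P) (t : ℤ) (ω : Ω) : Matrix (Fin p) (Fin q) ℝ :=
  S.R * S.F t ω * S.C.transpose + S.E t ω

/-- `M₁`, from the columns of `W_t`. -/
def M₁ (S : Model p q m k r T P) (h₀ : ℕ) : Matrix (Fin p) (Fin p) ℝ :=
  popM P T h₀ S.W

/-- `M₂`, by the same procedure applied to the transpose of `W_t`. -/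
def M₂ (S : Model p q m k r T P) (h₀ : ℕ) : Matrix (Fin q) (Fin q) ℝ :=
  popM P T h₀ (fun t ω => (S.W t ω).transpose)

/-- The least squares estimator `Â = (T⁻¹ ∑ Y_t X_t') (T⁻¹ ∑ X_t X_t')⁻¹`. -/
def Ahat (S : Model p q m k r T P) (ω : Ω) : Matrix (Fin p) (Fin m) ℝ :=
  ((1 / (T : ℝ)) • ∑ t ∈ Finset.Icc (1 : ℤ) T, S.Y t ω * (S.X t ω).transpose) *
    ((1 / (T : ℝ)) • ∑ t ∈ Finset.Icc (1 : ℤ) T, S.X t ω * (S.X t ω).transpose)⁻¹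

/-- The residuals `Ŵ_t = Y_t - Â X_t`. -/
def What (S : Model p q m k r T P) (t : ℤ) (ω : Ω) : Matrix (Fin p) (Fin q) ℝ :=
  S.Y t ω - S.Ahat ω * S.X t ω

/-- `M̂₁`, from the columns of the residuals. -/
def Mhat₁ (S : Model p q m k r T P) (h₀ : ℕ) (ω : Ω) : Matrix (Fin p) (Fin p) ℝ :=
  sampleM T h₀ (fun t => S.What t ω)

/-- `M̂₂`, by the same procedure applied to the transposed residuals. -/
def Mhat₂ (S : Model p q m k r T P) (h₀ : ℕ) (ω : Ω) : Matrix (Fin q) (Fin q) ℝ :=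
  sampleM T h₀ (fun t => (S.What t ω).transpose)

/-- `Σ_f(h)`, the averaged lag-`h` autocovariance matrix of `vec(F_t)`. -/
def covF (S : Model p q m k r T P) (h : ℕ) : Matrix (Fin r × Fin k) (Fin r × Fin k) ℝ :=
  avgLagCov P T h (fun t ω => (S.F t ω).vec) (fun t ω => (S.F t ω).vec)

/-- `P_t = E(X_t X_t')`. -/
def secondMomentX (S : Model p q m k r T P) (t : ℤ) : Matrix (Fin m) (Fin m) ℝ :=
  Matrix.of fun a b => ∫ ω, (S.X t ω * (S.X t ω).transpose) a b ∂P

/-- The `σ`-field generated by `(vec(Y_t), vec(X_t), vec(F_t))`, `t ∈ I`. -/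
@[reducible] def sigmaField (S : Model p q m k r T P) (I : Set ℤ) : MeasurableSpace Ω :=
  ⨆ t ∈ I, MeasurableSpace.comap
    (fun ω => ((S.Y t ω).vec, (S.X t ω).vec, (S.F t ω).vec)) inferInstance

/-- The `α`-mixing coefficient
`α(d) = sup_i sup {|P(A) P(B) - P(A ∩ B)| : A ∈ 𝓕_{-∞}^i, B ∈ 𝓕_{i+d}^∞}`. -/
def mixing (S : Model p q m k r T P) (d : ℕ) : ℝ :=
  sSup {x : ℝ | ∃ (i : ℤ) (A B : Set Ω),
    MeasurableSet[S.sigmaField (Set.Iic i)] A ∧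
    MeasurableSet[S.sigmaField (Set.Ici (i + d))] B ∧
    x = |P.real A * P.real B - P.real (A ∩ B)|}

end Model

/-! Asymptotic conditions on a sequence of models -/

section Conditions

variable {Ω : ℕ → Type*} [∀ n, MeasurableSpace (Ω n)] {P : ∀ n, Measure (Ω n)}
  {m k r : ℕ} {p q T : ℕ → ℕ}

/-- Mixing: `∑_{d ≥ 1} α(d)^{1 - 2/γ}` converges, and is bounded along the sequence. -/
def MixingCondition (S : ∀ n, Model (p n) (q n) m k r (T n) (P n)) (γ : ℝ) : Prop :=
  ∃ K : ℝ, ∀ n, Summable (fun d : ℕ => (S n).mixing (d + 1) ^ (1 - 2 / γ)) ∧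
    ∑' d : ℕ, (S n).mixing (d + 1) ^ (1 - 2 / γ) ≤ K

/-- `E|f|^s` is finite and at most `K`. -/
def AbsMomentLE {Ω : Type*} [MeasurableSpace Ω] (P : Measure Ω) (f : Ω → ℝ) (s K : ℝ) : Prop :=
  Integrable (fun ω => |f ω| ^ s) P ∧ ∫ ω, |f ω| ^ s ∂P ≤ K

/-- Moments of order `2γ` of all entries of `F_t`, `X_t`, `E_t` are uniformly bounded. -/
def MomentCondition (S : ∀ n, Model (p n) (q n) m k r (T n) (P n)) (γ : ℝ) : Prop :=
  ∃ K : ℝ, ∀ n, ∀ t ∈ Set.Icc (1 : ℤ) (T n),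
    (∀ i j, AbsMomentLE (P n) (fun ω => (S n).F t ω i j) (2 * γ) K) ∧
    (∀ l g, AbsMomentLE (P n) (fun ω => (S n).X t ω l g) (2 * γ) K) ∧
    (∀ u g, AbsMomentLE (P n) (fun ω => (S n).E t ω u g) (2 * γ) K)

/-- Rank and strength of the factor autocovariance. -/
def FactorCondition (S : ∀ n, Model (p n) (q n) m k r (T n) (P n)) (h₀ : ℕ) : Prop :=
  ∃ h : ℕ, 1 ≤ h ∧ h ≤ h₀ ∧
    (∀ᶠ n in atTop, ((S n).covF h).rank = max k r) ∧
    (fun n => specNorm ((S n).covF h)) =Θ[atTop] (fun _ => (1 : ℝ)) ∧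
    (fun n => singVal ((S n).covF h) (max k r - 1)) =Θ[atTop] (fun _ => (1 : ℝ)) ∧
    (∀ᶠ n in atTop, ∀ i : Fin k, avgLagCov (P n) (T n) h
      (fun t ω j => (S n).F t ω i j) (fun t ω j => (S n).F t ω i j) ≠ 0) ∧
    (∀ᶠ n in atTop, ∀ j : Fin r, avgLagCov (P n) (T n) h
      (fun t ω i => (S n).F t ω i j) (fun t ω i => (S n).F t ω i j) ≠ 0)

/-- The second moments of the known factors: `P_t = E(X_t X_t')` is positive definite, and
`T⁻¹ ∑ P_t` approaches a positive definite `m × m` matrix (which varies with `q`) whose smallest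
eigenvalue is of exact order `q`. -/
def KnownFactorCondition (S : ∀ n, Model (p n) (q n) m k r (T n) (P n)) : Prop :=
  (∀ n, ∀ t ∈ Set.Icc (1 : ℤ) (T n), ((S n).secondMomentX t).PosDef) ∧
  ∃ L : ℕ → Matrix (Fin m) (Fin m) ℝ, (∀ n, (L n).PosDef) ∧
    Tendsto (fun n => specNorm (((1 / (T n : ℝ)) •
      ∑ t ∈ Finset.Icc (1 : ℤ) (T n), (S n).secondMomentX t) - L n)) atTop (𝓝 0) ∧
    (fun n => eigVal (L n) (m - 1)) =Θ[atTop] (fun n => (q n : ℝ))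

/-- The entries of `Σ_e` are bounded. -/
def NoiseCondition (S : ∀ n, Model (p n) (q n) m k r (T n) (P n)) : Prop :=
  ∃ K : ℝ, ∀ n a b, |(S n).covE a b| ≤ K

/-- The row and column loadings have strengths `δ₁` and `δ₂`. -/
def LoadingCondition (S : ∀ n, Model (p n) (q n) m k r (T n) (P n)) (δ₁ δ₂ : ℝ) : Prop :=
  δ₁ ∈ Set.Icc (0 : ℝ) 1 ∧ δ₂ ∈ Set.Icc (0 : ℝ) 1 ∧
  (fun n => specNorm (S n).R ^ 2) =Θ[atTop] (fun n => (p n : ℝ) ^ (1 - δ₁)) ∧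
  (fun n => minNorm (S n).R ^ 2) =Θ[atTop] (fun n => (p n : ℝ) ^ (1 - δ₁)) ∧
  (fun n => specNorm (S n).C ^ 2) =Θ[atTop] (fun n => (q n : ℝ) ^ (1 - δ₂)) ∧
  (fun n => minNorm (S n).C ^ 2) =Θ[atTop] (fun n => (q n : ℝ) ^ (1 - δ₂))

/-- The `d` largest eigenvalues of the matrices `M n` are positive and pairwise distinct, and
stay so in the limit: relative to the largest eigenvalue, neither an eigenvalue nor the
difference of two of them tends to `0`. No order of magnitude is imposed on the largest one. -/
def DistinctPositiveEigenvalues {a : ℕ → ℕ}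
    (M : ∀ n, Matrix (Fin (a n)) (Fin (a n)) ℝ) (d : ℕ) : Prop :=
  ∃ c : ℝ, 0 < c ∧ ∀ᶠ n in atTop,
    0 < eigVal (M n) 0 ∧
    (∀ j < d, c * eigVal (M n) 0 ≤ eigVal (M n) j) ∧
    (∀ i j, i < j → j < d → c * eigVal (M n) 0 ≤ eigVal (M n) i - eigVal (M n) j)

/-- `Z_n = O_p(a_n)`. -/
def IsBigOp (P : ∀ n, Measure (Ω n)) (Z : ∀ n, Ω n → ℝ) (a : ℕ → ℝ) : Prop :=
  ∀ ε : ℝ, 0 < ε → ∃ K : ℝ, 0 < K ∧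
    ∀ᶠ n in atTop, P n {ω | K * a n < |Z n ω|} ≤ ENNReal.ofReal ε

/-- The rate `p^{δ₁} q^{δ₂} T^{-1/2}`. -/
def rate (p q T : ℕ → ℕ) (δ₁ δ₂ : ℝ) (n : ℕ) : ℝ :=
  (p n : ℝ) ^ δ₁ * (q n : ℝ) ^ δ₂ * (T n : ℝ) ^ (-(1 / 2) : ℝ)

end Conditions

end MatrixFactor

end

open MatrixFactor

noncomputable section

namespace MatrixFactor

/-! ### Eigenvalues and eigenvectors of a perturbed symmetric operator. -/

section Perturbation

variable {E : Type*} [NormedAddCommGroup E] [InnerProductSpace ℝ E] {a : ℕ}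

open scoped RealInnerProductSpace

/-! Write Γ(h) for the averaged lag-h autocovariance matrix of vec W_t. M₁ is the sum of Ω Ω' over
the blocks Ω of all Γ(h), so its trace is ∑_h ‖Γ(h)‖_F². At lags h ≥ 1 the white errors drop out and
Γ(h) = (C ⊗ R) Σ_f(h) (C ⊗ R)' (`covW_eq`). Hence M₁ has rank at most k, and its trace is at most k
times its largest eigenvalue λ. Also, at one lag ‖Γ(h)‖_F is at least a constant times p^(1-δ₁)
q^(1-δ₂).

Everything is then measured in relative terms. If the estimates satisfy ∑‖Γ̂ - Γ‖_F² ≤ x² ∑‖Γ‖_F²,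
then ‖M̂₁ - M₁‖₂ ≤ (x² + 2x) ∑‖Γ‖_F² ≤ (x² + 2x) k λ. The eigenvalue gaps are at least cλ, so λ
cancels in the eigenvector perturbation bound and ‖Q̂₁ - Q₁‖₂ is bounded by a constant times x² + 2x
(`specNorm_leading_blockGram_le`). The order of λ never enters. M₂ arises from the same Γ(h) with
the two indices of each entry position swapped, so one estimate serves both matrices.

It remains to see that ∑‖Γ̂ - Γ‖_F² = O_p(p²q²/T); divided by the signal p^(2-2δ₁) q^(2-2δ₂) this is
the square of the rate. For the unobserved W_t, Davydov's inequality and summable mixing give each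
sample lagged product a mean square error of order 1/T, after the entries of W_t are rescaled by
weights whose squares add up to O(pq). For the residuals, Ŵ_t - W_t = -(Â - A) X_t. Here ‖Â - A‖_F²
= O_p(p/T), because T⁻¹ ∑ W_t X_t' has mean zero and T⁻¹ ∑ X_t X_t' is bounded below by a multiple
of q; by Cauchy-Schwarz the extra terms are again of order p²q²/T.

All randomness is packed into one nonnegative statistic, `errorStat`, of bounded mean
(`integral_errorStat_le`). Where it is at most z the error bound is deterministic
(`sum_frobSq_covWhat_sub_le`), and Markov's inequality turns this into O_p. -/

theorem eigenvector_inner {A : E →ₗ[ℝ] E} (hA : A.IsSymmetric) {μ : ℝ} {v : E} (hv : A v = μ • v)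
    (x : E) : ⟪v, A x⟫ = μ * ⟪v, x⟫ := by
  rw [← hA v x, hv, real_inner_smul_left]

/-- One half of Weyl's inequality, for operators diagonalized by orthonormal bases. -/
theorem weyl_le (A B : E →ₗ[ℝ] E) (hA : A.IsSymmetric) (hB : B.IsSymmetric)
    (b b' : OrthonormalBasis (Fin a) ℝ E) (l l' : Fin a → ℝ)
    (hb : ∀ i, A (b i) = l i • b i) (hb' : ∀ i, B (b' i) = l' i • b' i)
    (hl : Antitone l) (hl' : Antitone l') {N : ℝ} (hN : ∀ x, ‖A x - B x‖ ≤ N * ‖x‖) (j : Fin a) :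
    l j ≤ l' j + N := by
  have hle : (j : ℕ) + 1 ≤ a := j.2
  -- Dimension count: j + 1 coordinates against j linear constraints leave a nonzero x in the span
  -- of the top j + 1 eigenvectors of A that is orthogonal to the top j eigenvectors of B. Its
  -- Rayleigh quotient is at least l j for A and at most l' j for B.
  let Φ : (Fin (j + 1) → ℝ) →ₗ[ℝ] E := Fintype.linearCombination ℝ fun i => b (Fin.castLE hle i)
  let Ψ : (Fin (j + 1) → ℝ) →ₗ[ℝ] (Fin j → ℝ) :=
    (LinearMap.pi fun i : Fin j => (innerₛₗ ℝ (b' (Fin.castLE j.2.le i)))) ∘ₗ Φ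
  have hker : LinearMap.ker Ψ ≠ ⊥ := LinearMap.ker_ne_bot_of_finrank_lt (by simp)
  obtain ⟨c, hc, hc0⟩ := (Submodule.ne_bot_iff _).1 hker
  set x := Φ c with hx
  have hxb : ∀ i, j < i → ⟪b i, x⟫ = 0 := by
    intro i hi
    simp only [hx, Φ, Fintype.linearCombination_apply, inner_sum, real_inner_smul_right]
    refine Finset.sum_eq_zero fun s _ => ?_
    rw [orthonormal_iff_ite.1 b.orthonormal, if_neg, mul_zero]
    rintro rfl
    have := s.2
    simp only [Fin.lt_def, Fin.val_castLE] at hi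
    omega
  have hxb' : ∀ i, i < j → ⟪b' i, x⟫ = 0 := by
    intro i hi
    have := congrFun (LinearMap.mem_ker.1 hc) ⟨i, hi⟩
    simpa [Ψ] using this
  have hx0 : x ≠ 0 := by
    intro h
    apply hc0
    have hli : LinearIndependent ℝ fun i => b (Fin.castLE hle i) :=
      (b.orthonormal.comp _ (Fin.castLE_injective hle)).linearIndependent
    have := Fintype.linearIndependent_iff.1 hli c (by simpa [hx, Φ, Fintype.linearCombination_apply] using h)
    exact funext this
  have hpos : 0 < ‖x‖ ^ 2 := by positivity
  have h1 : l j * ‖x‖ ^ 2 ≤ ⟪x, A x⟫ := by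
    rw [← b.sum_inner_mul_inner, ← b.sum_sq_inner_right x, Finset.mul_sum]
    refine Finset.sum_le_sum fun i _ => ?_
    rw [eigenvector_inner hA (hb i), real_inner_comm (b i) x]
    rcases le_or_gt i j with h | h
    · nlinarith [hl h, sq_nonneg ⟪b i, x⟫]
    · rw [hxb i h]; simp
  have h2 : ⟪x, B x⟫ ≤ l' j * ‖x‖ ^ 2 := by
    rw [← b'.sum_inner_mul_inner, ← b'.sum_sq_inner_right x, Finset.mul_sum]
    refine Finset.sum_le_sum fun i _ => ?_
    rw [eigenvector_inner hB (hb' i), real_inner_comm (b' i) x]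
    rcases le_or_gt j i with h | h
    · nlinarith [hl' h, sq_nonneg ⟪b' i, x⟫]
    · rw [hxb' i h]; simp
  have h3 : ⟪x, A x - B x⟫ ≤ N * ‖x‖ ^ 2 := by
    refine (real_inner_le_norm _ _).trans ?_
    nlinarith [hN x, norm_nonneg x]
  rw [inner_sub_right] at h3
  by_contra hcon
  push Not at hcon
  nlinarith

/-- A unit eigenvector of a perturbed operator is close to that of the unperturbed one. -/
theorem eigenvector_perturbation (A B : E →ₗ[ℝ] E) (hA : A.IsSymmetric)
    (b : OrthonormalBasis (Fin a) ℝ E) (l : Fin a → ℝ)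
    (hb : ∀ i, A (b i) = l i • b i) {N g : ℝ} (hN : ∀ x, ‖A x - B x‖ ≤ N * ‖x‖)
    (j : Fin a) (hg : 0 < g) (hgap : ∀ i, i ≠ j → g ≤ |l i - l j|)
    {μ : ℝ} (hμ : |μ - l j| ≤ N) {v w : E} (hv : ‖v‖ = 1) (hw : ‖w‖ = 1)
    (hAv : A v = l j • v) (hBw : B w = μ • w) (hvw : 0 ≤ ⟪w, v⟫) :
    ‖w - v‖ ^ 2 ≤ 8 * (N / g) ^ 2 := by
  -- The gap makes l j a simple eigenvalue, so v is b j up to sign.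
  have hortho : ∀ i, i ≠ j → ⟪b i, v⟫ = 0 := by
    intro i hi
    have h1 := eigenvector_inner hA (hb i) v
    rw [hAv, real_inner_smul_right] at h1
    have h2 := hgap i hi
    have h3 : (l i - l j) * ⟪b i, v⟫ = 0 := by linarith
    rcases mul_eq_zero.1 h3 with h | h
    · rw [h, abs_zero] at h2; linarith
    · exact h
  have hv1 : ⟪b j, v⟫ ^ 2 = 1 := by
    have := b.sum_sq_inner_right v
    rw [Finset.sum_eq_single j (fun i _ hi => by simp [hortho i hi]) (by simp), hv] at this
    simpa using this
  have hwv : ⟪w, v⟫ = ⟪b j, w⟫ * ⟪b j, v⟫ := by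
    rw [← b.sum_inner_mul_inner w v,
      Finset.sum_eq_single j (fun i _ hi => by simp [hortho i hi]) (by simp), real_inner_comm]
  have hsum := b.sum_sq_inner_right w
  have hres : ‖A w - l j • w‖ ≤ 2 * N := by
    have : A w - l j • w = (A w - B w) + (μ - l j) • w := by rw [hBw, sub_smul]; abel
    rw [this]
    refine (norm_add_le _ _).trans ?_
    have := hN w
    rw [norm_smul, hw, Real.norm_eq_abs]
    rw [hw] at this
    linarith
  -- A - l j stretches every component of w off b j by at least g, while the residual of w is at
  -- most 2N.
  have hlow : g ^ 2 * (1 - ⟪b j, w⟫ ^ 2) ≤ ‖A w - l j • w‖ ^ 2 := by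
    rw [← b.sum_sq_inner_right (A w - l j • w)]
    have : 1 - ⟪b j, w⟫ ^ 2 = ∑ i, if i = j then 0 else ⟪b i, w⟫ ^ 2 := by
      rw [hw] at hsum
      rw [← Finset.add_sum_erase _ _ (Finset.mem_univ j)] at hsum
      rw [← Finset.add_sum_erase _ _ (Finset.mem_univ j), if_pos rfl, zero_add,
        Finset.sum_congr rfl fun i hi => if_neg (Finset.ne_of_mem_erase hi)]
      linarith
    rw [this, Finset.mul_sum]
    refine Finset.sum_le_sum fun i _ => ?_
    split_ifs with h
    · simp [sq_nonneg]
    · rw [inner_sub_right, eigenvector_inner hA (hb i), real_inner_smul_right, ← sub_mul, mul_pow]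
      refine mul_le_mul_of_nonneg_right ?_ (sq_nonneg _)
      rw [← sq_abs (l i - l j)]
      exact pow_le_pow_left₀ hg.le (hgap i h) 2
  have hN0 : 0 ≤ N := (abs_nonneg _).trans hμ
  have h4 : g ^ 2 * (1 - ⟪w, v⟫ ^ 2) ≤ 4 * N ^ 2 := by
    rw [hwv, mul_pow, hv1, mul_one]
    refine hlow.trans ?_
    nlinarith [norm_nonneg (A w - l j • w)]
  have h5 : ‖w - v‖ ^ 2 = 2 - 2 * ⟪w, v⟫ := by
    rw [norm_sub_sq_real, hv, hw]; ring
  have h6 : ⟪w, v⟫ ≤ 1 := by simpa [hv, hw] using real_inner_le_norm w v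
  rw [h5, div_pow, ← mul_div_assoc, le_div_iff₀ (by positivity)]
  -- With t = ⟪w, v⟫ in [0, 1] one has 1 - t ≤ 1 - t², so 2(1 - t) is at most twice 4N²/g².
  nlinarith [mul_nonneg (sq_nonneg g) (mul_nonneg hvw (sub_nonneg.2 h6))]

end Perturbation

/-! ### Ordered eigenvalues of a symmetric matrix. -/

section Spectral

variable {a d : ℕ}

theorem eigVal_eq {M : Matrix (Fin a) (Fin a) ℝ} (hM : M.IsHermitian) (i : Fin a) :
    eigVal M i = hM.eigenvalues₀ (Fin.cast (Fintype.card_fin a).symm i) := by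
  rw [eigVal, dif_pos ⟨hM, by simp⟩]
  rfl

theorem eigVal_antitone {M : Matrix (Fin a) (Fin a) ℝ} (hM : M.IsHermitian) :
    Antitone fun i : Fin a => eigVal M i := by
  intro i j hij
  simp only [eigVal_eq hM]
  exact hM.eigenvalues₀_antitone hij

theorem eigVal_of_le (M : Matrix (Fin a) (Fin a) ℝ) {j : ℕ} (hj : a ≤ j) : eigVal M j = 0 := by
  rw [eigVal, dif_neg]
  simp only [Fintype.card_fin, not_and, not_lt]
  exact fun _ => hj

theorem exists_eigenbasis {M : Matrix (Fin a) (Fin a) ℝ} (hM : M.IsHermitian) :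
    ∃ b : OrthonormalBasis (Fin a) ℝ (EuclideanSpace ℝ (Fin a)),
      ∀ i, Matrix.toEuclideanLin M (b i) = eigVal M i • b i := by
  refine ⟨((Matrix.isSymmetric_toEuclideanLin_iff.mpr hM).eigenvectorBasis
    finrank_euclideanSpace).reindex (finCongr (Fintype.card_fin a)), fun i => ?_⟩
  have h := (Matrix.isSymmetric_toEuclideanLin_iff.mpr hM).apply_eigenvectorBasis
    finrank_euclideanSpace (Fin.cast (Fintype.card_fin a).symm i)
  rw [eigVal_eq hM, Matrix.IsHermitian.eigenvalues₀, OrthonormalBasis.reindex_apply]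
  exact h

theorem eigVal_sum {M : Matrix (Fin a) (Fin a) ℝ} (hM : M.IsHermitian) :
    M.trace = ∑ i : Fin a, eigVal M i := by
  rw [hM.trace_eq_sum_eigenvalues]
  simp only [Matrix.IsHermitian.eigenvalues, eigVal_eq hM, RCLike.ofReal_real_eq_id, id]
  rw [Equiv.sum_comp (Fintype.equivOfCardEq (Fintype.card_fin (Fintype.card (Fin a)))).symm
    hM.eigenvalues₀]
  exact (Equiv.sum_comp (finCongr (Fintype.card_fin a).symm) hM.eigenvalues₀).symm

theorem card_eigVal_ne_zero {M : Matrix (Fin a) (Fin a) ℝ} (hM : M.IsHermitian) :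
    (Finset.univ.filter fun i : Fin a => eigVal M i ≠ 0).card = M.rank := by
  rw [hM.rank_eq_card_non_zero_eigs, ← Fintype.card_subtype]
  refine Fintype.card_congr (((finCongr (Fintype.card_fin a).symm).trans
    (Fintype.equivOfCardEq (Fintype.card_fin (Fintype.card (Fin a))))).subtypeEquiv fun i => ?_)
  simp [Matrix.IsHermitian.eigenvalues, eigVal_eq hM]

/-- The rank counts the nonzero eigenvalues, and the d leading ones already exhaust it. -/
theorem eigVal_eq_zero_of_rank_le {M : Matrix (Fin a) (Fin a) ℝ} (hM : M.IsHermitian)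
    (hrank : M.rank ≤ d) (hpos : ∀ j < d, eigVal M j ≠ 0) {i : ℕ} (hi : d ≤ i) :
    eigVal M i = 0 := by
  by_contra h0
  have hia : i < a := by
    by_contra h
    exact h0 (eigVal_of_le M (not_lt.1 h))
  have hda : d ≤ a := hi.trans hia.le
  have hsub : insert (⟨i, hia⟩ : Fin a) (Finset.univ.map (Fin.castLEEmb hda)) ⊆
      Finset.univ.filter fun i : Fin a => eigVal M i ≠ 0 := by
    intro s hs
    rw [Finset.mem_filter]
    refine ⟨Finset.mem_univ _, ?_⟩
    rcases Finset.mem_insert.1 hs with rfl | hs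
    · exact h0
    · obtain ⟨t, -, rfl⟩ := Finset.mem_map.1 hs
      exact hpos _ t.2
  have hcard := Finset.card_le_card hsub
  rw [card_eigVal_ne_zero hM, Finset.card_insert_of_notMem, Finset.card_map, Finset.card_univ,
    Fintype.card_fin] at hcard
  · omega
  · intro hs
    obtain ⟨t, -, ht⟩ := Finset.mem_map.1 hs
    have := congrArg Fin.val ht
    simp at this
    have := t.2
    omega

/-- Only the d leading eigenvalues contribute to the trace. Applied to a Gram matrix, this measures
the Frobenius energy of the autocovariances in units of the largest eigenvalue. -/
theorem trace_le_mul_eigVal {M : Matrix (Fin a) (Fin a) ℝ} (hM : M.IsHermitian)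
    (hrank : M.rank ≤ d) (hpos : ∀ j < d, 0 < eigVal M j) :
    M.trace ≤ d * eigVal M 0 := by
  rw [eigVal_sum hM]
  have hz : ∀ i : ℕ, d ≤ i → eigVal M i = 0 := fun i hi =>
    eigVal_eq_zero_of_rank_le hM hrank (fun j hj => (hpos j hj).ne') hi
  -- Out-of-range indices have `eigVal` equal to 0, so positivity of the first d values forces d ≤
  -- a.
  have hda : d ≤ a := by
    by_contra h
    exact (hpos a (by omega)).ne' (eigVal_of_le M le_rfl)
  have : ∑ i : Fin a, eigVal M i = ∑ i ∈ Finset.range d, eigVal M i := by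
    rw [Fin.sum_univ_eq_sum_range (fun i => eigVal M i) a]
    refine (Finset.sum_subset (Finset.range_mono hda) fun i _ hi => hz i ?_).symm
    simpa using hi
  rw [this]
  calc ∑ i ∈ Finset.range d, eigVal M i ≤ ∑ i ∈ Finset.range d, eigVal M 0 := by
        refine Finset.sum_le_sum fun i hi => ?_
        have hi' : i < a := (Finset.mem_range.1 hi).trans_le hda
        exact @eigVal_antitone a M hM ⟨0, by omega⟩ ⟨i, hi'⟩ (by simp)
    _ = d * eigVal M 0 := by simp

theorem eigVal_last_mul_le {M : Matrix (Fin a) (Fin a) ℝ} (hM : M.IsHermitian)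
    (x : Fin a → ℝ) : eigVal M (a - 1) * ∑ i, x i ^ 2 ≤ ∑ i, x i * M.mulVec x i := by
  obtain ⟨b, hb⟩ := exists_eigenbasis hM
  set y : EuclideanSpace ℝ (Fin a) := WithLp.toLp 2 x with hy
  have h1 : ∑ i, x i ^ 2 = ‖y‖ ^ 2 := by simp [EuclideanSpace.norm_sq_eq, hy]
  have h2 : ∑ i, x i * M.mulVec x i = inner ℝ y (Matrix.toEuclideanLin M y) := by
    simp [PiLp.inner_apply, hy, mul_comm]
  rw [h1, h2, ← b.sum_inner_mul_inner, ← b.sum_sq_inner_right y, Finset.mul_sum]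
  refine Finset.sum_le_sum fun i _ => ?_
  rw [eigenvector_inner (Matrix.isSymmetric_toEuclideanLin_iff.mpr hM) (hb i),
    real_inner_comm (b i) y]
  have hle : eigVal M (a - 1) ≤ eigVal M i :=
    @eigVal_antitone a M hM i ⟨a - 1, by have := i.2; omega⟩ (by
      have := i.2
      exact Nat.le_sub_one_of_lt this)
  nlinarith [sq_nonneg (inner ℝ (b i) y)]

end Spectral

/-! ### Frobenius norm, spectral norm and smallest singular value. -/

section Norms

variable {ι κ : Type*} [Fintype ι] [Fintype κ]

/-- The square of the Frobenius norm. -/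
def frobSq (A : Matrix ι κ ℝ) : ℝ := ∑ i, ∑ j, A i j ^ 2

theorem frobSq_nonneg (A : Matrix ι κ ℝ) : 0 ≤ frobSq A :=
  Finset.sum_nonneg fun _ _ => Finset.sum_nonneg fun _ _ => sq_nonneg _

open scoped Matrix.Norms.Frobenius in
theorem frobSq_eq_norm_sq (A : Matrix ι κ ℝ) : frobSq A = ‖A‖ ^ 2 := by
  rw [Matrix.frobenius_norm_def, ← Real.sqrt_eq_rpow, Real.sq_sqrt]
  · simp [frobSq]
  · exact Finset.sum_nonneg fun _ _ => Finset.sum_nonneg fun _ _ => by positivity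

theorem specNorm_nonneg [DecidableEq κ] (A : Matrix ι κ ℝ) : 0 ≤ specNorm A := by
  rw [specNorm, Matrix.l2_opNorm_def]
  exact norm_nonneg _

theorem norm_mulVec_le [DecidableEq κ] (A : Matrix ι κ ℝ) (x : κ → ℝ) :
    ∑ i, A.mulVec x i ^ 2 ≤ specNorm A ^ 2 * ∑ j, x j ^ 2 := by
  have := Matrix.l2_opNorm_mulVec A (WithLp.toLp 2 x)
  have h2 := pow_le_pow_left₀ (norm_nonneg _) this 2
  rw [mul_pow] at h2
  simpa [EuclideanSpace.norm_sq_eq, specNorm] using h2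

theorem specNorm_le_of_mulVec [DecidableEq κ] (A : Matrix ι κ ℝ) {c : ℝ} (hc : 0 ≤ c)
    (h : ∀ x : κ → ℝ, ∑ i, A.mulVec x i ^ 2 ≤ c ^ 2 * ∑ j, x j ^ 2) : specNorm A ≤ c := by
  unfold specNorm
  rw [Matrix.l2_opNorm_def]
  refine ContinuousLinearMap.opNorm_le_bound _ hc fun x => ?_
  have hx := h x.ofLp
  rw [← sq_le_sq₀ (norm_nonneg _) (by positivity)]
  rw [mul_pow, EuclideanSpace.norm_sq_eq, EuclideanSpace.norm_sq_eq]
  simpa using hx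

theorem specNorm_sq_le_frobSq [DecidableEq κ] (A : Matrix ι κ ℝ) : specNorm A ^ 2 ≤ frobSq A := by
  have h0 := frobSq_nonneg A
  have : specNorm A ≤ Real.sqrt (frobSq A) := by
    refine specNorm_le_of_mulVec A (Real.sqrt_nonneg _) fun x => ?_
    rw [Real.sq_sqrt h0, frobSq, Finset.sum_mul]
    exact Finset.sum_le_sum fun i _ => Finset.sum_mul_sq_le_sq_mul_sq _ _ _
  calc specNorm A ^ 2 ≤ Real.sqrt (frobSq A) ^ 2 := pow_le_pow_left₀ (specNorm_nonneg A) this 2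
    _ = _ := Real.sq_sqrt h0

theorem frobSq_le_card_mul_specNorm_sq [DecidableEq κ] (A : Matrix ι κ ℝ) :
    frobSq A ≤ Fintype.card κ * specNorm A ^ 2 := by
  rw [frobSq, Finset.sum_comm]
  calc ∑ j, ∑ i, A i j ^ 2 ≤ ∑ _j : κ, specNorm A ^ 2 := by
        refine Finset.sum_le_sum fun j _ => ?_
        have := norm_mulVec_le A (Pi.single j 1)
        simpa [Pi.single_apply, ite_pow] using this
    _ = _ := by simp

theorem minNorm_sq_mul_le {a d : ℕ} (A : Matrix (Fin a) (Fin d) ℝ) (x : Fin d → ℝ) :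
    minNorm A ^ 2 * ∑ j, x j ^ 2 ≤ ∑ i, A.mulVec x i ^ 2 := by
  have hM : (A.transpose * A).IsHermitian := Matrix.isHermitian_conjTranspose_mul_self A
  have h1 := eigVal_last_mul_le hM x
  have h2 : ∑ i, x i * (A.transpose * A).mulVec x i = ∑ i, A.mulVec x i ^ 2 := by
    have : x ⬝ᵥ (A.transpose * A).mulVec x = A.mulVec x ⬝ᵥ A.mulVec x := by
      rw [← Matrix.mulVec_mulVec, Matrix.dotProduct_mulVec, Matrix.vecMul_transpose]
    simpa [dotProduct, sq] using this
  rw [h2] at h1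
  unfold minNorm singVal
  -- Semidefiniteness of A'A is not needed: for a negative value the square root is 0 and the left
  -- side vanishes.
  rcases le_or_gt 0 (eigVal (A.transpose * A) (d - 1)) with h | h
  · rwa [Real.sq_sqrt h]
  · rw [Real.sqrt_eq_zero_of_nonpos h.le]
    simp only [ne_eq, OfNat.ofNat_ne_zero, not_false_eq_true, zero_pow, zero_mul]
    exact Finset.sum_nonneg fun _ _ => sq_nonneg _

end Norms

/-! ### Leading eigenvectors of a low-rank matrix under perturbation. -/

section Leading

variable {a d : ℕ}

theorem abs_eigVal_sub_le {M M' : Matrix (Fin a) (Fin a) ℝ} (hM : M.IsHermitian)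
    (hM' : M'.IsHermitian) (j : Fin a) : |eigVal M j - eigVal M' j| ≤ specNorm (M - M') := by
  obtain ⟨b, hb⟩ := exists_eigenbasis hM
  obtain ⟨b', hb'⟩ := exists_eigenbasis hM'
  have hA := Matrix.isSymmetric_toEuclideanLin_iff.mpr hM
  have hB := Matrix.isSymmetric_toEuclideanLin_iff.mpr hM'
  have hN : ∀ x, ‖Matrix.toEuclideanLin M x - Matrix.toEuclideanLin M' x‖ ≤
      specNorm (M - M') * ‖x‖ := by
    intro x
    rw [← LinearMap.sub_apply, ← map_sub]
    exact Matrix.l2_opNorm_mulVec (M - M') x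
  have h1 := weyl_le _ _ hA hB b b' _ _ hb hb' (eigVal_antitone hM) (eigVal_antitone hM') hN j
  have h2 := weyl_le _ _ hB hA b' b _ _ hb' hb (eigVal_antitone hM') (eigVal_antitone hM)
    (fun x => by rw [norm_sub_rev]; exact hN x) j
  rw [abs_le]
  constructor <;> linarith

/-- Perturbation bound for leading eigenvectors with matching signs. -/
theorem specNorm_leading_sub_le {M M' : Matrix (Fin a) (Fin a) ℝ} (hM : M.IsHermitian)
    (hM' : M'.IsHermitian) (hrank : M.rank ≤ d) {g : ℝ} (hg : 0 < g)
    (hpos : ∀ j < d, g ≤ eigVal M j)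
    (hgap : ∀ i j, i < j → j < d → g ≤ eigVal M i - eigVal M j)
    {Q Q' : Matrix (Fin a) (Fin d) ℝ} (hQ : IsLeadingEigenvectors M Q)
    (hQ' : IsLeadingEigenvectors M' Q') (hsign : ∀ j, 0 ≤ ∑ u, Q' u j * Q u j) :
    specNorm (Q' - Q) ≤ Real.sqrt (8 * d) * (specNorm (M - M') / g) := by
  obtain ⟨b, hb⟩ := exists_eigenbasis hM
  have hz : ∀ i : ℕ, d ≤ i → eigVal M i = 0 := fun i hi =>
    eigVal_eq_zero_of_rank_le hM hrank (fun j hj => (hg.trans_le (hpos j hj)).ne') hi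
  have hda : d ≤ a := by
    by_contra h
    exact (hg.trans_le (hpos a (by omega))).ne' (eigVal_of_le M le_rfl)
  have hunit : ∀ {R : Matrix (Fin a) (Fin d) ℝ}, R.transpose * R = 1 → ∀ j,
      ‖(WithLp.toLp 2 fun u => R u j : EuclideanSpace ℝ (Fin a))‖ = 1 := by
    intro R hR j
    have h := congrFun (congrFun hR j) j
    rw [← sq_eq_sq₀ (norm_nonneg _) zero_le_one, EuclideanSpace.norm_sq_eq]
    simpa [Matrix.mul_apply, sq] using h
  have hcol : ∀ j : Fin d, ∑ u, (Q' - Q) u j ^ 2 ≤ 8 * (specNorm (M - M') / g) ^ 2 := by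
    intro j
    have := eigenvector_perturbation (Matrix.toEuclideanLin M) (Matrix.toEuclideanLin M')
      (Matrix.isSymmetric_toEuclideanLin_iff.mpr hM) b (fun i => eigVal M i) hb
      (N := specNorm (M - M')) (g := g)
      (fun x => by
        rw [← LinearMap.sub_apply, ← map_sub]
        exact Matrix.l2_opNorm_mulVec (M - M') x)
      (Fin.castLE hda j) hg
      (fun i hi => by
        simp only [Fin.val_castLE]
        have hne : (i : ℕ) ≠ j := fun h => hi (Fin.ext h)
        rcases lt_or_gt_of_ne hne with h | h
        · exact (hgap i j h j.2).trans (le_abs_self _)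
        · rw [abs_sub_comm]
          refine le_trans ?_ (le_abs_self _)
          -- Beyond index d the eigenvalues vanish by the rank bound, so the gap there is the j-th
          -- eigenvalue itself.
          rcases lt_or_ge (i : ℕ) d with h' | h'
          · exact hgap j i h h'
          · rw [hz i h', sub_zero]; exact hpos j j.2)
      (μ := eigVal M' j) (by
        rw [abs_sub_comm]
        exact abs_eigVal_sub_le hM hM' (Fin.castLE hda j))
      (v := WithLp.toLp 2 fun u => Q u j) (w := WithLp.toLp 2 fun u => Q' u j)
      (hunit hQ.1 j) (hunit hQ'.1 j)
      (by
        have := hQ.2 j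
        simp only [Matrix.toLpLin_apply, this]
        rfl)
      (by
        have := hQ'.2 j
        simp only [Matrix.toLpLin_apply, this]
        rfl)
      (by simpa [PiLp.inner_apply, mul_comm] using hsign j)
    simpa [EuclideanSpace.norm_sq_eq] using this
  have hN : 0 ≤ specNorm (M - M') / g := div_nonneg (specNorm_nonneg _) hg.le
  have hfrob : specNorm (Q' - Q) ^ 2 ≤ (Real.sqrt (8 * d) * (specNorm (M - M') / g)) ^ 2 := by
    refine (specNorm_sq_le_frobSq _).trans ?_
    rw [frobSq, Finset.sum_comm, mul_pow, Real.sq_sqrt (by positivity)]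
    refine (Finset.sum_le_sum fun j _ => hcol j).trans ?_
    simp only [Finset.sum_const, Finset.card_univ, Fintype.card_fin, nsmul_eq_mul]
    apply le_of_eq; ring
  exact (sq_le_sq₀ (specNorm_nonneg _) (by positivity)).1 hfrob

end Leading

/-! ### Covariance inequalities under α-mixing. -/

section Mixing

variable {Ω : Type*} {m m₁ m₂ m₀ : MeasurableSpace Ω} {P : Measure Ω} [IsProbabilityMeasure P]

/-- The integral is linear in U, so an indicator is optimal: replace V by its conditional
expectation and take for A the set where that is positive. -/
theorem exists_integral_mul_le_setIntegral (hm : m ≤ m₀) {U V : Ω → ℝ}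
    (hU : Measurable[m] U) (hU0 : ∀ ω, 0 ≤ U ω) (hU1 : ∀ ω, U ω ≤ 1) (hV : Integrable V P) :
    ∃ A, MeasurableSet[m] A ∧ ∫ ω, U ω * V ω ∂P ≤ ∫ ω in A, V ω ∂P := by
  have hsm : StronglyMeasurable[m] U := hU.stronglyMeasurable
  have hbd : ∀ᵐ ω ∂P, ‖U ω‖ ≤ 1 := ae_of_all _ fun ω => by
    rw [Real.norm_eq_abs, abs_of_nonneg (hU0 ω)]; exact hU1 ω
  have hUm : AEStronglyMeasurable U P := (hU.mono hm le_rfl).aestronglyMeasurable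
  have hUV : Integrable (U * V) P := hV.bdd_mul hUm hbd
  set g : Ω → ℝ := P[V|m] with hg
  have hgi : Integrable g P := integrable_condExp
  have hgm : Measurable[m] g := stronglyMeasurable_condExp.measurable
  have hA : MeasurableSet[m] {ω | 0 < g ω} := hgm measurableSet_Ioi
  refine ⟨{ω | 0 < g ω}, hA, ?_⟩
  have h1 : ∫ ω, U ω * V ω ∂P = ∫ ω, U ω * g ω ∂P := by
    calc ∫ ω, U ω * V ω ∂P = ∫ ω, (P[U * V|m]) ω ∂P := (integral_condExp hm).symm
      _ = _ := integral_congr_ae (condExp_mul_of_stronglyMeasurable_left hsm hUV hV)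
  rw [h1, ← setIntegral_condExp hm hV hA, ← integral_indicator (hm _ hA)]
  refine integral_mono (hgi.bdd_mul hUm hbd) (hgi.indicator (hm _ hA)) fun ω => ?_
  by_cases h : ω ∈ {ω | 0 < g ω}
  · rw [Set.indicator_of_mem h]
    have : 0 < g ω := h
    exact mul_le_of_le_one_left this.le (hU1 ω)
  · rw [Set.indicator_of_notMem h]
    have : g ω ≤ 0 := not_lt.1 h
    exact mul_nonpos_of_nonneg_of_nonpos (hU0 ω) this

/-- Indicators are the extreme case: exchange U for 1_A against V - E V, then V for 1_B against 1_A
- P(A). What remains is P(A ∩ B) - P(A) P(B). -/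
theorem integral_mul_sub_le (h₁ : m₁ ≤ m₀) (h₂ : m₂ ≤ m₀) {α : ℝ}
    (hα : ∀ A B, MeasurableSet[m₁] A → MeasurableSet[m₂] B →
      |P.real A * P.real B - P.real (A ∩ B)| ≤ α)
    {U V : Ω → ℝ} (hU : Measurable[m₁] U) (hV : Measurable[m₂] V)
    (hU0 : ∀ ω, 0 ≤ U ω) (hU1 : ∀ ω, U ω ≤ 1) (hV0 : ∀ ω, 0 ≤ V ω) (hV1 : ∀ ω, V ω ≤ 1) :
    ∫ ω, U ω * V ω ∂P - (∫ ω, U ω ∂P) * ∫ ω, V ω ∂P ≤ α := by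
  have hUi : Integrable U P := Integrable.of_bound (hU.mono h₁ le_rfl).aestronglyMeasurable 1
    (ae_of_all _ fun ω => by rw [Real.norm_eq_abs, abs_of_nonneg (hU0 ω)]; exact hU1 ω)
  have hVi : Integrable V P := Integrable.of_bound (hV.mono h₂ le_rfl).aestronglyMeasurable 1
    (ae_of_all _ fun ω => by rw [Real.norm_eq_abs, abs_of_nonneg (hV0 ω)]; exact hV1 ω)
  have hUV : Integrable (fun ω => U ω * V ω) P :=
    hVi.bdd_mul hUi.1
      (ae_of_all _ fun ω => by rw [Real.norm_eq_abs, abs_of_nonneg (hU0 ω)]; exact hU1 ω)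
  obtain ⟨A, hA, hAle⟩ := exists_integral_mul_le_setIntegral (P := P) h₁ hU hU0 hU1
    (hVi.sub (integrable_const (∫ ω, V ω ∂P)))
  have hA' := h₁ _ hA
  have hind : Integrable (A.indicator fun _ => (1 : ℝ)) P := (integrable_const 1).indicator hA'
  obtain ⟨B, hB, hBle⟩ := exists_integral_mul_le_setIntegral (P := P) h₂ hV hV0 hV1
    (hind.sub (integrable_const (P.real A)))
  have hB' := h₂ _ hB
  have e1 : ∫ ω, U ω * (V - fun _ => ∫ ω, V ω ∂P : Ω → ℝ) ω ∂P =
      ∫ ω, U ω * V ω ∂P - (∫ ω, U ω ∂P) * ∫ ω, V ω ∂P := by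
    simp only [Pi.sub_apply, mul_sub]
    rw [integral_sub hUV (hUi.mul_const _), integral_mul_const]
  have e2 : ∫ ω in A, (V - fun _ => ∫ ω, V ω ∂P : Ω → ℝ) ω ∂P =
      ∫ ω, V ω * (A.indicator (fun _ => (1 : ℝ)) - fun _ => P.real A : Ω → ℝ) ω ∂P := by
    simp only [Pi.sub_apply, mul_sub]
    rw [integral_sub hVi.integrableOn (integrable_const _), integral_sub _ (hVi.mul_const _),
      integral_mul_const, ← integral_indicator hA']
    · have : ∀ ω, V ω * A.indicator (fun _ => (1 : ℝ)) ω = A.indicator V ω := fun ω => by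
        by_cases h : ω ∈ A <;> simp [h]
      simp [this, mul_comm]
    · have : (fun ω => V ω * A.indicator (fun _ => (1 : ℝ)) ω) = A.indicator V := by
        ext ω
        by_cases h : ω ∈ A <;> simp [h]
      rw [this]
      exact hVi.indicator hA'
  have e3 : ∫ ω in B, (A.indicator (fun _ => (1 : ℝ)) - fun _ => P.real A : Ω → ℝ) ω ∂P =
      P.real (A ∩ B) - P.real A * P.real B := by
    simp only [Pi.sub_apply]
    rw [integral_sub hind.integrableOn (integrable_const _), setIntegral_indicator hA']
    simp [Set.inter_comm, mul_comm]
  rw [e1, e2] at hAle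
  rw [e3] at hBle
  have := (abs_le.1 (hα A B hA hB)).1
  linarith

/-- The map x ↦ (x + M)/(2M) sends [-M, M] into [0, 1] and divides covariances by 4M². The lower
bound comes from replacing U by -U. -/
theorem abs_integral_mul_sub_le (h₁ : m₁ ≤ m₀) (h₂ : m₂ ≤ m₀) {α : ℝ}
    (hα : ∀ A B, MeasurableSet[m₁] A → MeasurableSet[m₂] B →
      |P.real A * P.real B - P.real (A ∩ B)| ≤ α)
    {U V : Ω → ℝ} (hU : Measurable[m₁] U) (hV : Measurable[m₂] V) {M : ℝ} (hM : 0 < M)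
    (hUM : ∀ ω, |U ω| ≤ M) (hVM : ∀ ω, |V ω| ≤ M) :
    |∫ ω, U ω * V ω ∂P - (∫ ω, U ω ∂P) * ∫ ω, V ω ∂P| ≤ 4 * M ^ 2 * α := by
  have key : ∀ {U' : Ω → ℝ}, Measurable[m₁] U' → (∀ ω, |U' ω| ≤ M) →
      ∫ ω, U' ω * V ω ∂P - (∫ ω, U' ω ∂P) * ∫ ω, V ω ∂P ≤ 4 * M ^ 2 * α := by
    intro U' hU' hUM'
    have hUi : Integrable U' P := Integrable.of_bound (hU'.mono h₁ le_rfl).aestronglyMeasurable M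
      (ae_of_all _ hUM')
    have hVi : Integrable V P := Integrable.of_bound (hV.mono h₂ le_rfl).aestronglyMeasurable M
      (ae_of_all _ hVM)
    have hUV : Integrable (fun ω => U' ω * V ω) P := hVi.bdd_mul hUi.1 (ae_of_all _ hUM')
    have hs : ∀ x : ℝ, |x| ≤ M → 0 ≤ (x + M) / (2 * M) ∧ (x + M) / (2 * M) ≤ 1 := by
      intro x hx
      have := abs_le.1 hx
      refine ⟨div_nonneg (by linarith) (by linarith), ?_⟩
      rw [div_le_one (by linarith)]
      linarith
    have h := integral_mul_sub_le h₁ h₂ hα (U := fun ω => (U' ω + M) / (2 * M))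
      (V := fun ω => (V ω + M) / (2 * M)) ((hU'.add_const M).div_const _)
      ((hV.add_const M).div_const _) (fun ω => (hs _ (hUM' ω)).1) (fun ω => (hs _ (hUM' ω)).2)
      (fun ω => (hs _ (hVM ω)).1) (fun ω => (hs _ (hVM ω)).2)
    have e : ∀ ω, (U' ω + M) / (2 * M) * ((V ω + M) / (2 * M)) =
        (U' ω * V ω + M * U' ω + M * V ω + M ^ 2) / (4 * M ^ 2) := by
      intro ω
      field_simp
      ring
    simp only [e] at h
    rw [integral_div, integral_div, integral_div, integral_add, integral_add, integral_add,
      integral_add hUi (integrable_const _), integral_add hVi (integrable_const _),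
      integral_const_mul, integral_const_mul] at h
    · simp only [integral_const, probReal_univ, smul_eq_mul, one_mul] at h
      have h' : ((∫ ω, U' ω * V ω ∂P) - (∫ ω, U' ω ∂P) * ∫ ω, V ω ∂P) / (4 * M ^ 2) ≤ α := by
        refine le_trans (le_of_eq ?_) h
        field_simp
        ring
      rw [div_le_iff₀ (by positivity)] at h'
      linarith
    · exact hUV
    · exact hUi.const_mul _
    · exact hUV.add (hUi.const_mul _)
    · exact hVi.const_mul _
    · exact (hUV.add (hUi.const_mul _)).add (hVi.const_mul _)
    · exact integrable_const _
  rw [abs_le]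
  refine ⟨?_, key hU hUM⟩
  have := key hU.neg (fun ω => by simpa using hUM ω)
  simp only [Pi.neg_apply, neg_mul, integral_neg] at this
  linarith

theorem abs_le_one_add_rpow {x γ : ℝ} (hγ : 1 ≤ γ) : |x| ≤ 1 + |x| ^ γ := by
  rcases le_or_gt |x| 1 with h | h
  · have := Real.rpow_nonneg (abs_nonneg x) γ
    linarith
  · have := Real.self_le_rpow_of_one_le h.le hγ
    linarith

theorem AbsMomentLE.integrable {f : Ω → ℝ} {γ K : ℝ} (h : AbsMomentLE P f γ K) (hγ : 1 ≤ γ)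
    (hf : Measurable f) : Integrable f P := by
  refine ((integrable_const (1 : ℝ)).add h.1).mono' hf.aestronglyMeasurable
    (ae_of_all _ fun ω => ?_)
  exact abs_le_one_add_rpow hγ

theorem sq_le_one_add_rpow {x γ : ℝ} (hγ : 2 ≤ γ) : x ^ 2 ≤ 1 + |x| ^ γ := by
  have h := abs_le_one_add_rpow (x := x ^ 2) (γ := γ / 2) (by linarith)
  have e : |x ^ 2| ^ (γ / 2) = |x| ^ γ := by
    rw [abs_pow, ← Real.rpow_natCast, ← Real.rpow_mul (abs_nonneg x)]
    congr 1
    push_cast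
    ring
  rw [e, abs_of_nonneg (sq_nonneg x)] at h
  exact h

/-- Davydov's covariance inequality for uniformly bounded moments of order `γ > 2`. -/
theorem davydov_aux (h₁ : m₁ ≤ m₀) (h₂ : m₂ ≤ m₀) {β : ℝ}
    (hβ : 0 < β) (hβ1 : β ≤ 1)
    (hα : ∀ A B, MeasurableSet[m₁] A → MeasurableSet[m₂] B →
      |P.real A * P.real B - P.real (A ∩ B)| ≤ β)
    {U V : Ω → ℝ} (hU : Measurable[m₁] U) (hV : Measurable[m₂] V) {γ K : ℝ} (hγ : 2 < γ)
    (hUK : AbsMomentLE P U γ K) (hVK : AbsMomentLE P V γ K) :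
    |∫ ω, U ω * V ω ∂P - (∫ ω, U ω ∂P) * ∫ ω, V ω ∂P| ≤
      (4 + 2 * K + 2 * K * (1 + K)) * β ^ (1 - 2 / γ) := by
  have hγ0 : (0 : ℝ) < γ := by linarith
  have hUm : Measurable U := hU.mono h₁ le_rfl
  have hVm : Measurable V := hV.mono h₂ le_rfl
  have hK : 0 ≤ K := le_trans (integral_nonneg fun ω => by positivity) hUK.2
  -- This truncation level balances the truncated covariance, of order M²β, against the tails, of
  -- order M^(2 - γ): both equal β^(1 - 2/γ).
  set M : ℝ := β ^ (-(1 / γ)) with hMdef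
  have hM1 : 1 ≤ M := Real.one_le_rpow_of_pos_of_le_one_of_nonpos hβ hβ1 (by
    rw [neg_nonpos]; positivity)
  have hM0 : 0 < M := by linarith
  have hM2 : M ^ 2 * β = β ^ (1 - 2 / γ) := by
    rw [hMdef, ← Real.rpow_natCast, ← Real.rpow_mul hβ.le, ← Real.rpow_add_one hβ.ne']
    congr 1
    push_cast
    field_simp
    ring
  have hMγ : M ^ (2 - γ) = β ^ (1 - 2 / γ) := by
    rw [hMdef, ← Real.rpow_mul hβ.le]
    congr 1
    field_simp
    ring
  have hMγ1 : M ^ (1 - γ) ≤ β ^ (1 - 2 / γ) := by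
    rw [← hMγ]
    exact Real.rpow_le_rpow_of_exponent_le hM1 (by linarith)
  let tr : ℝ → ℝ := fun x => if |x| ≤ M then x else 0
  have htr : Measurable tr :=
    Measurable.ite (measurableSet_le measurable_norm measurable_const) measurable_id
      measurable_const
  have htrM : ∀ x, |tr x| ≤ M := by
    intro x
    by_cases h : |x| ≤ M
    · simp only [tr, if_pos h]; exact h
    · simp only [tr, if_neg h, abs_zero]; exact hM0.le
  have hpow2 : ∀ x : ℝ, M < x → x ^ 2 ≤ M ^ (2 - γ) * x ^ γ := by
    intro x hx
    have hx0 : 0 < x := hM0.trans hx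
    have h2 : x ^ (2 - γ) ≤ M ^ (2 - γ) :=
      Real.rpow_le_rpow_of_nonpos hM0 hx.le (by linarith)
    calc x ^ 2 = x ^ (2 - γ) * x ^ γ := by
          rw [← Real.rpow_add hx0, sub_add_cancel]; norm_cast
      _ ≤ _ := mul_le_mul_of_nonneg_right h2 (Real.rpow_nonneg hx0.le _)
  have hpow1 : ∀ x : ℝ, |x - tr x| ≤ M ^ (1 - γ) * |x| ^ γ := by
    intro x
    by_cases h : |x| ≤ M
    · simp only [tr, if_pos h, sub_self, abs_zero]; positivity
    · simp only [tr, if_neg h, sub_zero]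
      have hx0 : 0 < |x| := hM0.trans (not_le.1 h)
      have h2 : |x| ^ (1 - γ) ≤ M ^ (1 - γ) :=
        Real.rpow_le_rpow_of_nonpos hM0 (not_le.1 h).le (by linarith)
      calc |x| = |x| ^ (1 - γ) * |x| ^ γ := by
            rw [← Real.rpow_add hx0, sub_add_cancel, Real.rpow_one]
        _ ≤ _ := mul_le_mul_of_nonneg_right h2 (Real.rpow_nonneg hx0.le _)
  have hprod : ∀ x y : ℝ, |x * y - tr x * tr y| ≤ M ^ (2 - γ) * (|x| ^ γ + |y| ^ γ) := by
    intro x y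
    have hnx : 0 ≤ |x| ^ γ := by positivity
    have hny : 0 ≤ |y| ^ γ := by positivity
    have hMp : 0 ≤ M ^ (2 - γ) := by positivity
    -- The product is at most the square of the larger factor, and that factor exceeds M.
    have hmain : M < |x| ∨ M < |y| → |x * y| ≤ M ^ (2 - γ) * (|x| ^ γ + |y| ^ γ) := by
      intro h
      rw [abs_mul]
      rcases le_total |x| |y| with hxy | hxy
      · have := hpow2 |y| (h.elim (fun h => h.trans_le hxy) id)
        nlinarith [abs_nonneg x, abs_nonneg y, mul_nonneg hMp hnx]
      · have := hpow2 |x| (h.elim id fun h => h.trans_le hxy)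
        nlinarith [abs_nonneg x, abs_nonneg y, mul_nonneg hMp hny]
    by_cases hx : |x| ≤ M
    · by_cases hy : |y| ≤ M
      · simp only [tr, if_pos hx, if_pos hy, sub_self, abs_zero]; positivity
      · simp only [tr, if_neg hy, mul_zero, sub_zero]
        exact hmain (Or.inr (not_le.1 hy))
    · simp only [tr, if_neg hx, zero_mul, sub_zero]
      exact hmain (Or.inl (not_le.1 hx))
  have hUi := hUK.integrable (by linarith) hUm
  have hVi := hVK.integrable (by linarith) hVm
  have bdi : ∀ {f : Ω → ℝ}, Measurable f → (∀ ω, |f ω| ≤ M) → Integrable f P := fun hf hb =>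
    Integrable.of_bound hf.aestronglyMeasurable M (ae_of_all _ hb)
  have hU1i : Integrable (fun ω => tr (U ω)) P := bdi (htr.comp hUm) fun ω => htrM _
  have hV1i : Integrable (fun ω => tr (V ω)) P := bdi (htr.comp hVm) fun ω => htrM _
  have hUV1i : Integrable (fun ω => tr (U ω) * tr (V ω)) P :=
    hV1i.bdd_mul hU1i.1 (ae_of_all _ fun ω => htrM _)
  have hdi : Integrable (fun ω => U ω * V ω - tr (U ω) * tr (V ω)) P :=
    ((hUK.1.add hVK.1).const_mul (M ^ (2 - γ))).mono'
      ((hUm.mul hVm).sub ((htr.comp hUm).mul (htr.comp hVm))).aestronglyMeasurable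
      (ae_of_all _ fun ω => hprod _ _)
  have hUVi : Integrable (fun ω => U ω * V ω) P := by
    refine (hdi.add hUV1i).congr (ae_of_all _ fun ω => ?_)
    simp
  have b1 : |∫ ω, U ω * V ω ∂P - ∫ ω, tr (U ω) * tr (V ω) ∂P| ≤ M ^ (2 - γ) * (K + K) := by
    rw [← integral_sub hUVi hUV1i]
    refine abs_integral_le_integral_abs.trans ?_
    calc ∫ ω, |U ω * V ω - tr (U ω) * tr (V ω)| ∂P
        ≤ ∫ ω, M ^ (2 - γ) * (|U ω| ^ γ + |V ω| ^ γ) ∂P :=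
          integral_mono hdi.abs ((hUK.1.add hVK.1).const_mul _) fun ω => hprod _ _
      _ = M ^ (2 - γ) * (∫ ω, |U ω| ^ γ ∂P + ∫ ω, |V ω| ^ γ ∂P) := by
          rw [integral_const_mul, integral_add hUK.1 hVK.1]
      _ ≤ _ := by
          have := hUK.2
          have := hVK.2
          gcongr
  have b2 : ∀ {f : Ω → ℝ}, Measurable f → AbsMomentLE P f γ K → Integrable f P →
      Integrable (fun ω => tr (f ω)) P →
      |∫ ω, f ω ∂P - ∫ ω, tr (f ω) ∂P| ≤ M ^ (1 - γ) * K := by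
    intro f hf hfK hfi hfti
    rw [← integral_sub hfi hfti]
    refine abs_integral_le_integral_abs.trans ?_
    calc ∫ ω, |f ω - tr (f ω)| ∂P ≤ ∫ ω, M ^ (1 - γ) * |f ω| ^ γ ∂P :=
          integral_mono (hfi.sub hfti).abs (hfK.1.const_mul _) fun ω => hpow1 _
      _ = M ^ (1 - γ) * ∫ ω, |f ω| ^ γ ∂P := integral_const_mul _ _
      _ ≤ _ := by
          have := hfK.2
          gcongr
  have b3 : |∫ ω, V ω ∂P| ≤ 1 + K := by
    refine abs_integral_le_integral_abs.trans ?_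
    calc ∫ ω, |V ω| ∂P ≤ ∫ ω, (1 + |V ω| ^ γ) ∂P :=
          integral_mono hVi.abs ((integrable_const _).add hVK.1) fun ω =>
            abs_le_one_add_rpow (by linarith)
      _ = 1 + ∫ ω, |V ω| ^ γ ∂P := by
          rw [integral_add (integrable_const _) hVK.1]; simp
      _ ≤ _ := by linarith [hVK.2]
  have b4 : |∫ ω, tr (U ω) ∂P| ≤ 1 + K := by
    refine abs_integral_le_integral_abs.trans ?_
    calc ∫ ω, |tr (U ω)| ∂P ≤ ∫ ω, (1 + |U ω| ^ γ) ∂P := by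
          refine integral_mono hU1i.abs ((integrable_const _).add hUK.1) fun ω => ?_
          refine le_trans ?_ (abs_le_one_add_rpow (x := U ω) (γ := γ) (by linarith))
          by_cases h : |U ω| ≤ M
          · simp only [tr, if_pos h]; exact le_rfl
          · simp only [tr, if_neg h, abs_zero]; exact abs_nonneg _
      _ = 1 + ∫ ω, |U ω| ^ γ ∂P := by
          rw [integral_add (integrable_const _) hUK.1]; simp
      _ ≤ _ := by linarith [hUK.2]
  have b5 := abs_integral_mul_sub_le h₁ h₂ hα (U := fun ω => tr (U ω)) (V := fun ω => tr (V ω))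
    (htr.comp hU) (htr.comp hV) hM0 (fun ω => htrM _) (fun ω => htrM _)
  have b6 := b2 hUm hUK hUi hU1i
  have b7 := b2 hVm hVK hVi hV1i
  set θ := β ^ (1 - 2 / γ)
  have hθ : 0 ≤ θ := Real.rpow_nonneg hβ.le _
  have b8 : |∫ ω, U ω ∂P - ∫ ω, tr (U ω) ∂P| * |∫ ω, V ω ∂P| ≤ (θ * K) * (1 + K) := by
    gcongr
    exact b6.trans (by gcongr)
  have b9 : |∫ ω, tr (U ω) ∂P| * |∫ ω, V ω ∂P - ∫ ω, tr (V ω) ∂P| ≤ (1 + K) * (θ * K) := by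
    gcongr
    exact b7.trans (by gcongr)
  rw [hMγ] at b1
  have b5' : 4 * M ^ 2 * β = 4 * θ := by rw [mul_assoc, hM2]
  rw [b5'] at b5
  rw [← abs_mul] at b8 b9
  -- With θ = β^(1 - 2/γ), the four terms are at most 2Kθ, 4θ, K(1 + K)θ and K(1 + K)θ.
  have e : ∫ ω, U ω * V ω ∂P - (∫ ω, U ω ∂P) * ∫ ω, V ω ∂P =
      (∫ ω, U ω * V ω ∂P - ∫ ω, tr (U ω) * tr (V ω) ∂P) +
      (∫ ω, tr (U ω) * tr (V ω) ∂P - (∫ ω, tr (U ω) ∂P) * ∫ ω, tr (V ω) ∂P) -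
      (∫ ω, U ω ∂P - ∫ ω, tr (U ω) ∂P) * (∫ ω, V ω ∂P) -
      (∫ ω, tr (U ω) ∂P) * (∫ ω, V ω ∂P - ∫ ω, tr (V ω) ∂P) := by ring
  rw [e]
  refine (abs_sub _ _).trans ?_
  have c1 := abs_sub ((∫ ω, U ω * V ω ∂P - ∫ ω, tr (U ω) * tr (V ω) ∂P) +
      (∫ ω, tr (U ω) * tr (V ω) ∂P - (∫ ω, tr (U ω) ∂P) * ∫ ω, tr (V ω) ∂P))
      ((∫ ω, U ω ∂P - ∫ ω, tr (U ω) ∂P) * (∫ ω, V ω ∂P))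
  have c2 := abs_add_le (∫ ω, U ω * V ω ∂P - ∫ ω, tr (U ω) * tr (V ω) ∂P)
      (∫ ω, tr (U ω) * tr (V ω) ∂P - (∫ ω, tr (U ω) ∂P) * ∫ ω, tr (V ω) ∂P)
  nlinarith

/-- Davydov's covariance inequality for uniformly bounded moments of order `γ > 2`. -/
theorem davydov (h₁ : m₁ ≤ m₀) (h₂ : m₂ ≤ m₀) {α : ℝ}
    (hα0 : 0 ≤ α) (hα1 : α ≤ 1)
    (hα : ∀ A B, MeasurableSet[m₁] A → MeasurableSet[m₂] B →
      |P.real A * P.real B - P.real (A ∩ B)| ≤ α)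
    {U V : Ω → ℝ} (hU : Measurable[m₁] U) (hV : Measurable[m₂] V) {γ K : ℝ} (hγ : 2 < γ)
    (hUK : AbsMomentLE P U γ K) (hVK : AbsMomentLE P V γ K) :
    |∫ ω, U ω * V ω ∂P - (∫ ω, U ω ∂P) * ∫ ω, V ω ∂P| ≤
      (4 + 2 * K + 2 * K * (1 + K)) * α ^ (1 - 2 / γ) := by
  -- For α = 0 there is no finite truncation level; let β decrease to 0 in the bound for positive β.
  rcases hα0.eq_or_lt with rfl | hpos
  · have hθ : 0 ≤ 1 - 2 / γ := by
      rw [sub_nonneg, div_le_one (by linarith)]; linarith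
    have hlim : Tendsto (fun β : ℝ => (4 + 2 * K + 2 * K * (1 + K)) * β ^ (1 - 2 / γ)) (𝓝[>] 0)
        (𝓝 ((4 + 2 * K + 2 * K * (1 + K)) * 0 ^ (1 - 2 / γ))) :=
      (((Real.continuous_rpow_const hθ).tendsto 0).mono_left nhdsWithin_le_nhds).const_mul _
    refine ge_of_tendsto hlim ?_
    filter_upwards [Ioc_mem_nhdsGT (zero_lt_one' ℝ)] with β hβ
    exact davydov_aux h₁ h₂ hβ.1 hβ.2 (fun A B hA hB => (hα A B hA hB).trans hβ.1.le) hU hV hγ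
      hUK hVK
  · exact davydov_aux h₁ h₂ hpos hα1 hα hU hV hγ hUK hVK

end Mixing

/-! ### Mean square of averages of weakly dependent series. -/

section Average

variable {Ω : Type*} {m₀ : MeasurableSpace Ω} {P : Measure Ω}

/-- The at most 2h + 1 times within distance h of s cost V each. The times on either side are
indexed injectively by their distance to this band; that distance is at least 1, hence the shift by
one in c. -/
theorem sum_abs_le_of_decay {N h : ℕ} {V : ℝ} {c : ℕ → ℝ} (hc : Summable c) (hc0 : ∀ d, 0 ≤ c d)
    (r : ℤ → ℝ) (s : ℤ) (hV : ∀ t ∈ Finset.Icc (1 : ℤ) N, r t ≤ V) (hV0 : 0 ≤ V)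
    (hr : ∀ t ∈ Finset.Icc (1 : ℤ) N, s + h < t → r t ≤ c (t - s - h - 1).toNat)
    (hl : ∀ t ∈ Finset.Icc (1 : ℤ) N, t + h < s → r t ≤ c (s - t - h - 1).toNat) :
    ∑ t ∈ Finset.Icc (1 : ℤ) N, r t ≤ (2 * h + 1) * V + 2 * ∑' d, c d := by
  have hbound : ∀ t ∈ Finset.Icc (1 : ℤ) N, r t ≤
      (if t ∈ Finset.Icc (s - h) (s + h) then V else 0) +
      ((if s + h < t then c (t - s - h - 1).toNat else 0) +
        (if t + h < s then c (s - t - h - 1).toNat else 0)) := by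
    intro t ht
    by_cases h1 : s + h < t
    · have h2 : ¬ t + h < s := by omega
      have h3 : t ∉ Finset.Icc (s - h) (s + h) := by
        rw [Finset.mem_Icc]; omega
      rw [if_pos h1, if_neg h2, if_neg h3]
      simpa using hr t ht h1
    · by_cases h2 : t + h < s
      · have h3 : t ∉ Finset.Icc (s - h) (s + h) := by
          rw [Finset.mem_Icc]; omega
        rw [if_neg h1, if_pos h2, if_neg h3]
        simpa using hl t ht h2
      · have h3 : t ∈ Finset.Icc (s - h) (s + h) := by
          rw [Finset.mem_Icc]; omega
        rw [if_neg h1, if_neg h2, if_pos h3]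
        simpa using hV t ht
  refine (Finset.sum_le_sum hbound).trans ?_
  rw [Finset.sum_add_distrib, Finset.sum_add_distrib]
  have hinj : ∀ (f : ℤ → ℕ) (p : ℤ → Prop) [DecidablePred p],
      (∀ x y, p x → p y → f x = f y → x = y) →
      ∑ t ∈ Finset.Icc (1 : ℤ) N, (if p t then c (f t) else 0) ≤ ∑' d, c d := by
    intro f p _ hf
    rw [← Finset.sum_filter, ← Finset.sum_image (f := c) (g := f)]
    · exact hc.sum_le_tsum _ fun i _ => hc0 i
    · intro x hx y hy hxy
      exact hf x y (Finset.mem_filter.1 hx).2 (Finset.mem_filter.1 hy).2 hxy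
  have i1 := hinj (fun t => (t - s - h - 1).toNat) (fun t => s + h < t)
    (fun x y hx hy hxy => by omega)
  have i2 := hinj (fun t => (s - t - h - 1).toNat) (fun t => t + h < s)
    (fun x y hx hy hxy => by omega)
  have i3 : ∑ t ∈ Finset.Icc (1 : ℤ) N, (if t ∈ Finset.Icc (s - h) (s + h) then V else 0) ≤
      (2 * h + 1) * V := by
    rw [← Finset.sum_filter, Finset.sum_const, nsmul_eq_mul]
    refine mul_le_mul_of_nonneg_right ?_ hV0
    have hcard : ((Finset.Icc (1 : ℤ) N).filter (fun t => t ∈ Finset.Icc (s - h) (s + h))).card ≤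
        (Finset.Icc (s - h) (s + h)).card := by
      refine Finset.card_le_card fun t ht => (Finset.mem_filter.1 ht).2
    rw [Int.card_Icc] at hcard
    have : (s + h + 1 - (s - h)).toNat = 2 * h + 1 := by omega
    rw [this] at hcard
    exact_mod_cast hcard
  linarith

/-- The mean square of the average of a series with decaying autocovariances. -/
theorem integral_sq_average_le {N h : ℕ} (hN : 0 < N) {V : ℝ} {c : ℕ → ℝ} (hc : Summable c)
    (hc0 : ∀ d, 0 ≤ c d) (η : ℤ → Ω → ℝ) (hη : ∀ t ∈ Finset.Icc (1 : ℤ) N, MemLp (η t) 2 P)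
    (hV : ∀ t ∈ Finset.Icc (1 : ℤ) N, ∫ ω, η t ω ^ 2 ∂P ≤ V)
    (hr : ∀ s ∈ Finset.Icc (1 : ℤ) N, ∀ t ∈ Finset.Icc (1 : ℤ) N, s + h < t →
      |∫ ω, η s ω * η t ω ∂P| ≤ c (t - s - h - 1).toNat) :
    MemLp (fun ω => 1 / (N : ℝ) * ∑ t ∈ Finset.Icc (1 : ℤ) N, η t ω) 2 P ∧
    ∫ ω, (1 / (N : ℝ) * ∑ t ∈ Finset.Icc (1 : ℤ) N, η t ω) ^ 2 ∂P ≤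
      ((2 * h + 1) * V + 2 * ∑' d, c d) / N := by
  have hint : ∀ s ∈ Finset.Icc (1 : ℤ) N, ∀ t ∈ Finset.Icc (1 : ℤ) N,
      Integrable (fun ω => η s ω * η t ω) P := fun s hs t ht => (hη s hs).integrable_mul (hη t ht)
  have hsq : ∀ t ∈ Finset.Icc (1 : ℤ) N, Integrable (fun ω => η t ω ^ 2) P := fun t ht =>
    (hη t ht).integrable_sq
  have e : ∀ ω, (1 / (N : ℝ) * ∑ t ∈ Finset.Icc (1 : ℤ) N, η t ω) ^ 2 =
      1 / (N : ℝ) ^ 2 * ∑ s ∈ Finset.Icc (1 : ℤ) N, ∑ t ∈ Finset.Icc (1 : ℤ) N,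
        η s ω * η t ω := by
    intro ω
    rw [mul_pow, sq (∑ t ∈ _, _), Finset.sum_mul_sum, one_div, one_div, inv_pow]
  refine ⟨(memLp_finsetSum _ hη).const_mul _, ?_⟩
  simp only [e]
  rw [integral_const_mul, integral_finsetSum _ fun s hs =>
    integrable_finsetSum _ fun t ht => hint s hs t ht]
  have hV0 : 0 ≤ V := le_trans (integral_nonneg fun ω => sq_nonneg _)
    (hV 1 (by rw [Finset.mem_Icc]; omega))
  have hab : ∀ s ∈ Finset.Icc (1 : ℤ) N, ∀ t ∈ Finset.Icc (1 : ℤ) N,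
      |∫ ω, η s ω * η t ω ∂P| ≤ V := by
    intro s hs t ht
    refine abs_integral_le_integral_abs.trans ?_
    calc ∫ ω, |η s ω * η t ω| ∂P ≤ ∫ ω, (η s ω ^ 2 + η t ω ^ 2) / 2 ∂P := by
          refine integral_mono (hint s hs t ht).abs (((hsq s hs).add (hsq t ht)).div_const 2)
            fun ω => ?_
          dsimp only
          rw [abs_mul, ← sq_abs (η s ω), ← sq_abs (η t ω)]
          nlinarith [sq_nonneg (|η s ω| - |η t ω|)]
      _ = (∫ ω, η s ω ^ 2 ∂P + ∫ ω, η t ω ^ 2 ∂P) / 2 := by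
          rw [integral_div, integral_add (hsq s hs) (hsq t ht)]
      _ ≤ V := by linarith [hV s hs, hV t ht]
  have hrow : ∀ s ∈ Finset.Icc (1 : ℤ) N,
      ∫ ω, ∑ t ∈ Finset.Icc (1 : ℤ) N, η s ω * η t ω ∂P ≤ (2 * h + 1) * V + 2 * ∑' d, c d := by
    intro s hs
    rw [integral_finsetSum _ fun t ht => hint s hs t ht]
    refine sum_abs_le_of_decay hc hc0 _ s
      (fun t ht => (le_abs_self _).trans (hab s hs t ht)) hV0
      (fun t ht hst => (le_abs_self _).trans (hr s hs t ht hst)) fun t ht hst => ?_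
    simp only [mul_comm (η s _)]
    exact (le_abs_self _).trans (hr t ht s hs hst)
  have hN' : (0 : ℝ) < N := by exact_mod_cast hN
  calc 1 / (N : ℝ) ^ 2 * ∑ s ∈ Finset.Icc (1 : ℤ) N,
        ∫ ω, ∑ t ∈ Finset.Icc (1 : ℤ) N, η s ω * η t ω ∂P
      ≤ 1 / (N : ℝ) ^ 2 * ∑ s ∈ Finset.Icc (1 : ℤ) N, ((2 * h + 1) * V + 2 * ∑' d, c d) := by
        gcongr with s hs
        exact hrow s hs
    _ = _ := by
        rw [Finset.sum_const, Int.card_Icc, nsmul_eq_mul]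
        simp only [add_sub_cancel_right, Int.toNat_natCast]
        field_simp

end Average

/-! ### Moment bounds for products and squares. -/

section Moments

variable {Ω : Type*} {m₀ : MeasurableSpace Ω} {P : Measure Ω}

theorem rpow_two_mul_eq (x γ : ℝ) : |x| ^ (2 * γ) = (|x| ^ γ) ^ 2 := by
  rw [mul_comm, Real.rpow_mul (abs_nonneg x)]
  norm_cast

/-- By the inequality of arithmetic and geometric means. This is why moments of order 2γ are
assumed: the covariance inequality is applied to products of entries, which need order γ. -/
theorem AbsMomentLE.mul {U V : Ω → ℝ} {γ K : ℝ} (hU : AbsMomentLE P U (2 * γ) K)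
    (hV : AbsMomentLE P V (2 * γ) K) (hUm : Measurable U) (hVm : Measurable V) :
    AbsMomentLE P (fun ω => U ω * V ω) γ K := by
  have hle : ∀ ω, |U ω * V ω| ^ γ ≤ (|U ω| ^ (2 * γ) + |V ω| ^ (2 * γ)) / 2 := by
    intro ω
    rw [abs_mul, Real.mul_rpow (abs_nonneg _) (abs_nonneg _), rpow_two_mul_eq, rpow_two_mul_eq]
    nlinarith [sq_nonneg (|U ω| ^ γ - |V ω| ^ γ)]
  have hi : Integrable (fun ω => |U ω * V ω| ^ γ) P := by
    refine ((hU.1.add hV.1).div_const 2).mono'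
      ((hUm.mul hVm).abs.pow_const γ).aestronglyMeasurable (ae_of_all _ fun ω => ?_)
    rw [Real.norm_eq_abs, abs_of_nonneg (Real.rpow_nonneg (abs_nonneg _) _)]
    exact hle ω
  refine ⟨hi, (integral_mono hi ((hU.1.add hV.1).div_const 2) hle).trans ?_⟩
  simp only [Pi.add_apply]
  rw [integral_div, integral_add hU.1 hV.1]
  linarith [hU.2, hV.2]

variable [IsProbabilityMeasure P]

theorem AbsMomentLE.memLp_two {U : Ω → ℝ} {γ K : ℝ} (hU : AbsMomentLE P U γ K) (hγ : 2 ≤ γ)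
    (hUm : Measurable U) : MemLp U 2 P := by
  rw [memLp_two_iff_integrable_sq hUm.aestronglyMeasurable]
  refine ((integrable_const (1 : ℝ)).add hU.1).mono' (hUm.pow_const 2).aestronglyMeasurable
    (ae_of_all _ fun ω => ?_)
  rw [Real.norm_eq_abs, abs_of_nonneg (sq_nonneg _)]
  exact sq_le_one_add_rpow hγ

theorem AbsMomentLE.integral_sq_le {U : Ω → ℝ} {γ K : ℝ} (hU : AbsMomentLE P U γ K) (hγ : 2 ≤ γ)
    (hUm : Measurable U) : ∫ ω, U ω ^ 2 ∂P ≤ 1 + K := by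
  calc ∫ ω, U ω ^ 2 ∂P ≤ ∫ ω, (1 + |U ω| ^ γ) ∂P :=
        integral_mono (hU.memLp_two hγ hUm).integrable_sq ((integrable_const _).add hU.1) fun ω =>
          sq_le_one_add_rpow hγ
    _ = 1 + ∫ ω, |U ω| ^ γ ∂P := by
        rw [integral_add (integrable_const _) hU.1]; simp
    _ ≤ _ := by linarith [hU.2]

end Moments

/-! ### Mixing coefficients and sample lagged moments of observed series. -/

namespace Model

variable {p q m k r T : ℕ} {Ω : Type*} [m₀ : MeasurableSpace Ω] {P : Measure Ω}
  (S : Model p q m k r T P)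

theorem measurable_observation (t : ℤ) :
    Measurable fun ω => ((S.Y t ω).vec, (S.X t ω).vec, (S.F t ω).vec) := by
  refine Measurable.prodMk ?_ (Measurable.prodMk ?_ ?_)
  · exact measurable_pi_lambda _ fun a => S.measurable_Y t a.2 a.1
  · exact measurable_pi_lambda _ fun a => S.measurable_X t a.2 a.1
  · exact measurable_pi_lambda _ fun a => S.measurable_F t a.2 a.1

theorem sigmaField_le (I : Set ℤ) : S.sigmaField I ≤ m₀ :=
  iSup₂_le fun t _ => (S.measurable_observation t).comap_le

theorem sigmaField_mono {I J : Set ℤ} (h : I ⊆ J) : S.sigmaField I ≤ S.sigmaField J :=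
  biSup_mono h

theorem measurable_observation_sigmaField (t : ℤ) :
    Measurable[S.sigmaField {t}]
      fun ω => ((S.Y t ω).vec, (S.X t ω).vec, (S.F t ω).vec) := by
  rw [measurable_iff_comap_le]
  exact le_biSup (fun t => MeasurableSpace.comap
    (fun ω => ((S.Y t ω).vec, (S.X t ω).vec, (S.F t ω).vec)) inferInstance) (Set.mem_singleton t)

theorem measurable_Y_sigmaField (t : ℤ) (i : Fin p) (j : Fin q) :
    Measurable[S.sigmaField {t}] fun ω => S.Y t ω i j :=
  (measurable_pi_apply (j, i)).comp (measurable_fst.comp (S.measurable_observation_sigmaField t))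

theorem measurable_X_sigmaField (t : ℤ) (i : Fin m) (j : Fin q) :
    Measurable[S.sigmaField {t}] fun ω => S.X t ω i j :=
  (measurable_pi_apply (j, i)).comp (measurable_fst.comp (measurable_snd.comp
    (S.measurable_observation_sigmaField t)))

/-- A real series is observed with moments of order `s` at most `K` when, in the observation
window, its value at time `t` is a function of the data at time `t` with such moments. -/
structure ObservedSeries (ξ : ℤ → Ω → ℝ) (s K : ℝ) : Prop where
  measurable : ∀ t ∈ Set.Icc (1 : ℤ) T, Measurable[S.sigmaField {t}] (ξ t)
  moment : ∀ t ∈ Set.Icc (1 : ℤ) T, AbsMomentLE P (ξ t) s K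

variable {S} in
theorem ObservedSeries.measurable' {ξ : ℤ → Ω → ℝ} {s K : ℝ} (h : S.ObservedSeries ξ s K)
    {t : ℤ} (ht : t ∈ Set.Icc (1 : ℤ) T) : Measurable (ξ t) :=
  (h.measurable t ht).mono (S.sigmaField_le _) le_rfl

variable [IsProbabilityMeasure P]

theorem abs_mixing_defect_le_one (A B : Set Ω) :
    |P.real A * P.real B - P.real (A ∩ B)| ≤ 1 := by
  have h1 : 0 ≤ P.real A * P.real B := by positivity
  have h2 : P.real A * P.real B ≤ 1 := mul_le_one₀ measureReal_le_one measureReal_nonneg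
    measureReal_le_one
  have h3 : P.real (A ∩ B) ≤ 1 := measureReal_le_one
  have h4 : 0 ≤ P.real (A ∩ B) := measureReal_nonneg
  rw [abs_le]
  constructor <;> linarith

theorem le_mixing (d : ℕ) (i : ℤ) {A B : Set Ω} (hA : MeasurableSet[S.sigmaField (Set.Iic i)] A)
    (hB : MeasurableSet[S.sigmaField (Set.Ici (i + d))] B) :
    |P.real A * P.real B - P.real (A ∩ B)| ≤ S.mixing d := by
  refine le_csSup ⟨1, ?_⟩ ⟨i, A, B, hA, hB, rfl⟩
  rintro x ⟨i, A, B, -, -, rfl⟩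
  exact abs_mixing_defect_le_one A B

theorem mixing_nonneg (d : ℕ) : 0 ≤ S.mixing d :=
  (abs_nonneg _).trans (S.le_mixing d 0 (@MeasurableSet.empty _ (S.sigmaField _))
    (@MeasurableSet.empty _ (S.sigmaField _)))

theorem mixing_le_one (d : ℕ) : S.mixing d ≤ 1 := by
  refine csSup_le ⟨_, 0, ∅, ∅, @MeasurableSet.empty _ (S.sigmaField _),
    @MeasurableSet.empty _ (S.sigmaField _), rfl⟩ ?_
  rintro x ⟨i, A, B, -, -, rfl⟩
  exact abs_mixing_defect_le_one A B

/-- The constant in the mean square bound for sample autocovariances. -/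
def lagConst (h : ℕ) (K D : ℝ) : ℝ :=
  (2 * h + 1) * (1 + K) + 2 * ((4 + 2 * K + 2 * K * (1 + K)) * D)

variable {S}

/-- Sample lagged second moments of observed series converge at rate `T⁻¹` in mean square. -/
theorem ObservedSeries.integral_sq_lag_le {ξ ζ : ℤ → Ω → ℝ} {γ K D : ℝ} (hγ : 2 < γ)
    (hξ : S.ObservedSeries ξ (2 * γ) K) (hζ : S.ObservedSeries ζ (2 * γ) K)
    (hsum : Summable fun d : ℕ => S.mixing (d + 1) ^ (1 - 2 / γ))
    (hD : ∑' d : ℕ, S.mixing (d + 1) ^ (1 - 2 / γ) ≤ D) (h : ℕ) (hT : h < T) :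
    MemLp (fun ω => 1 / ((T : ℝ) - h) * ∑ t ∈ Finset.Icc (1 : ℤ) ((T : ℤ) - h),
      (ξ t ω * ζ (t + h) ω - ∫ ω, ξ t ω * ζ (t + h) ω ∂P)) 2 P ∧
    ∫ ω, (1 / ((T : ℝ) - h) * ∑ t ∈ Finset.Icc (1 : ℤ) ((T : ℤ) - h),
      (ξ t ω * ζ (t + h) ω - ∫ ω, ξ t ω * ζ (t + h) ω ∂P)) ^ 2 ∂P ≤
      lagConst h K D / ((T : ℝ) - h) := by
  obtain ⟨N, rfl⟩ : ∃ N, T = N + h := ⟨T - h, by omega⟩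
  have hN : 0 < N := by omega
  have e1 : ((N + h : ℕ) : ℝ) - h = N := by push_cast; ring
  have e2 : ((N + h : ℕ) : ℤ) - h = N := by push_cast; ring
  rw [e1, e2]
  have hmem : ∀ t ∈ Finset.Icc (1 : ℤ) N, t ∈ Set.Icc (1 : ℤ) ((N + h : ℕ) : ℤ) ∧
      t + h ∈ Set.Icc (1 : ℤ) ((N + h : ℕ) : ℤ) := by
    intro t ht
    rw [Finset.mem_Icc] at ht
    simp only [Set.mem_Icc]
    push_cast
    omega
  set U : ℤ → Ω → ℝ := fun t ω => ξ t ω * ζ (t + h) ω with hU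
  have hUm : ∀ t ∈ Finset.Icc (1 : ℤ) N, Measurable (U t) := fun t ht =>
    (hξ.measurable' (hmem t ht).1).mul (hζ.measurable' (hmem t ht).2)
  -- The product at time t uses data from times t and t + h only. Products at s and t with t > s + h
  -- are thus separated by a mixing gap of t - s - h.
  have hUpast : ∀ t ∈ Finset.Icc (1 : ℤ) N, Measurable[S.sigmaField (Set.Iic (t + h))] (U t) :=
    fun t ht =>
    ((hξ.measurable t (hmem t ht).1).mono (S.sigmaField_mono (by simp)) le_rfl).mul
      ((hζ.measurable _ (hmem t ht).2).mono (S.sigmaField_mono (by simp)) le_rfl)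
  have hUfut : ∀ t ∈ Finset.Icc (1 : ℤ) N, Measurable[S.sigmaField (Set.Ici t)] (U t) :=
    fun t ht =>
    ((hξ.measurable t (hmem t ht).1).mono (S.sigmaField_mono (by simp)) le_rfl).mul
      ((hζ.measurable _ (hmem t ht).2).mono (S.sigmaField_mono (by simp)) le_rfl)
  have hUK : ∀ t ∈ Finset.Icc (1 : ℤ) N, AbsMomentLE P (U t) γ K := fun t ht =>
    (hξ.moment t (hmem t ht).1).mul (hζ.moment _ (hmem t ht).2)
      (hξ.measurable' (hmem t ht).1) (hζ.measurable' (hmem t ht).2)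
  have hU2 : ∀ t ∈ Finset.Icc (1 : ℤ) N, MemLp (U t) 2 P := fun t ht =>
    (hUK t ht).memLp_two hγ.le (hUm t ht)
  have hUi : ∀ t ∈ Finset.Icc (1 : ℤ) N, Integrable (U t) P := fun t ht =>
    (hU2 t ht).integrable one_le_two
  have hK : 0 ≤ K := le_trans (integral_nonneg fun ω => by positivity)
    (hUK 1 (by rw [Finset.mem_Icc]; omega)).2
  have hC : 0 ≤ 4 + 2 * K + 2 * K * (1 + K) := by positivity
  have hcov : ∀ s ∈ Finset.Icc (1 : ℤ) N, ∀ t ∈ Finset.Icc (1 : ℤ) N,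
      ∫ ω, (U s ω - ∫ ω, U s ω ∂P) * (U t ω - ∫ ω, U t ω ∂P) ∂P =
        ∫ ω, U s ω * U t ω ∂P - (∫ ω, U s ω ∂P) * ∫ ω, U t ω ∂P := by
    intro s hs t ht
    exact covariance_eq_sub (hU2 s hs) (hU2 t ht)
  have hmain := integral_sq_average_le (P := P) hN (h := h) (V := 1 + K)
    (hsum.mul_left (4 + 2 * K + 2 * K * (1 + K)))
    (fun d => mul_nonneg hC (Real.rpow_nonneg (S.mixing_nonneg _) _))
    (fun t ω => U t ω - ∫ ω, U t ω ∂P)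
    (fun t ht => (hU2 t ht).sub (memLp_const _))
    (fun t ht => by
      simp only [sq]
      rw [hcov t ht t ht]
      have := (hUK t ht).integral_sq_le hγ.le (hUm t ht)
      simp only [sq] at this
      nlinarith [mul_self_nonneg (∫ ω, U t ω ∂P)])
    (fun s hs t ht hst => by
      rw [hcov s hs t ht]
      refine davydov (S.sigmaField_le (Set.Iic (s + h))) (S.sigmaField_le (Set.Ici t))
        (S.mixing_nonneg _) (S.mixing_le_one _) (fun A B hA hB => ?_) (hUpast s hs) (hUfut t ht)
        hγ (hUK s hs) (hUK t ht)
      -- The summable sequence is `mixing (d + 1)`; at d = t - s - h - 1 this is the coefficient at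
      -- the gap t - s - h.
      refine S.le_mixing _ (s + h) hA ?_
      convert hB using 3
      push_cast
      omega)
  refine ⟨hmain.1, hmain.2.trans ?_⟩
  rw [tsum_mul_left]
  unfold lagConst
  gcongr

end Model

/-! ### Sums of Gram matrices and their perturbation. -/

section Gram

variable {τ : Type*} {a d : ℕ}

/-- `∑ Ω Ω'` over a finite family of matrices. -/
def gramSum (s : Finset τ) (B : τ → Matrix (Fin a) (Fin a) ℝ) : Matrix (Fin a) (Fin a) ℝ :=
  ∑ x ∈ s, B x * (B x).transpose

theorem gramSum_isHermitian (s : Finset τ) (B : τ → Matrix (Fin a) (Fin a) ℝ) :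
    (gramSum s B).IsHermitian := by
  unfold gramSum Matrix.IsHermitian
  rw [Matrix.conjTranspose_sum]
  refine Finset.sum_congr rfl fun x _ => ?_
  exact Matrix.isHermitian_mul_conjTranspose_self (B x)

theorem trace_gramSum (s : Finset τ) (B : τ → Matrix (Fin a) (Fin a) ℝ) :
    (gramSum s B).trace = ∑ x ∈ s, frobSq (B x) := by
  rw [gramSum, Matrix.trace_sum]
  refine Finset.sum_congr rfl fun x _ => ?_
  simp [Matrix.trace, Matrix.mul_apply, frobSq, sq]

theorem rank_gramSum_le (s : Finset τ) (B : τ → Matrix (Fin a) (Fin a) ℝ)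
    (R : Matrix (Fin a) (Fin d) ℝ) (N : τ → Matrix (Fin d) (Fin a) ℝ)
    (h : ∀ x ∈ s, B x = R * N x) : (gramSum s B).rank ≤ d := by
  have : gramSum s B = R * ∑ x ∈ s, N x * (B x).transpose := by
    rw [gramSum, Matrix.mul_sum]
    refine Finset.sum_congr rfl fun x hx => ?_
    rw [← Matrix.mul_assoc, ← h x hx]
  rw [this]
  refine (Matrix.rank_mul_le_left _ _).trans ?_
  simpa using Matrix.rank_le_width R

open scoped Matrix.Norms.Frobenius in
theorem specNorm_le_frobenius (A : Matrix (Fin a) (Fin a) ℝ) : specNorm A ≤ ‖A‖ := by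
  rw [← sq_le_sq₀ (specNorm_nonneg _) (norm_nonneg _), ← frobSq_eq_norm_sq]
  exact specNorm_sq_le_frobSq A

open scoped Matrix.Norms.Frobenius in
-- With D = B' - B, each difference is, up to sign, D Dᵀ + D Bᵀ + B Dᵀ. Submultiplicativity of the
-- Frobenius norm handles each term, and Cauchy-Schwarz over the family handles the two cross terms.
theorem specNorm_gramSum_sub_le (s : Finset τ) (B B' : τ → Matrix (Fin a) (Fin a) ℝ) :
    specNorm (gramSum s B - gramSum s B') ≤ ∑ x ∈ s, frobSq (B' x - B x) +
      2 * Real.sqrt (∑ x ∈ s, frobSq (B' x - B x)) * Real.sqrt (∑ x ∈ s, frobSq (B x)) := by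
  have hterm : ∀ x, ‖B x * (B x).transpose - B' x * (B' x).transpose‖ ≤
      frobSq (B' x - B x) + 2 * (‖B' x - B x‖ * ‖B x‖) := by
    intro x
    have e : B x * (B x).transpose - B' x * (B' x).transpose =
        -((B' x - B x) * (B' x - B x).transpose + (B' x - B x) * (B x).transpose +
          B x * (B' x - B x).transpose) := by
      simp only [Matrix.transpose_sub, Matrix.sub_mul, Matrix.mul_sub]
      abel
    rw [e, norm_neg]
    refine (norm_add₃_le).trans ?_
    have h1 := Matrix.frobenius_norm_mul (B' x - B x) (B' x - B x).transpose
    have h2 := Matrix.frobenius_norm_mul (B' x - B x) (B x).transpose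
    have h3 := Matrix.frobenius_norm_mul (B x) (B' x - B x).transpose
    rw [Matrix.frobenius_norm_transpose] at h1 h2 h3
    rw [frobSq_eq_norm_sq]
    nlinarith
  refine (specNorm_le_frobenius _).trans ?_
  rw [gramSum, gramSum, ← Finset.sum_sub_distrib]
  refine (norm_sum_le _ _).trans ((Finset.sum_le_sum fun x _ => hterm x).trans ?_)
  rw [Finset.sum_add_distrib, ← Finset.mul_sum]
  have hcs := Real.sum_mul_le_sqrt_mul_sqrt s (fun x => ‖B' x - B x‖) fun x => ‖B x‖
  simp only [frobSq_eq_norm_sq]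
  linarith

end Gram

/-! ### Gram matrices built from the blocks of autocovariance matrices. -/

section Blocks

variable {a b d : ℕ}

/-- `∑_h ∑_i ∑_j G_{ij}(h) G_{ij}(h)'` over the blocks of the matrices `G(h)`. -/
def blockGram (h₀ : ℕ) (G : ℕ → Matrix (Fin b × Fin a) (Fin b × Fin a) ℝ) :
    Matrix (Fin a) (Fin a) ℝ :=
  gramSum (Finset.Icc 1 h₀ ×ˢ (Finset.univ : Finset (Fin b × Fin b)))
    fun x => (G x.1).submatrix (Prod.mk x.2.1) (Prod.mk x.2.2)

theorem frobSq_blocks (G : Matrix (Fin b × Fin a) (Fin b × Fin a) ℝ) :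
    ∑ x : Fin b × Fin b, frobSq (G.submatrix (Prod.mk x.1) (Prod.mk x.2)) = frobSq G := by
  simp only [frobSq, Matrix.submatrix_apply, Fintype.sum_prod_type]
  refine Finset.sum_congr rfl fun i _ => ?_
  rw [Finset.sum_comm]

theorem sum_frobSq_blocks (h₀ : ℕ) (G : ℕ → Matrix (Fin b × Fin a) (Fin b × Fin a) ℝ) :
    ∑ x ∈ Finset.Icc 1 h₀ ×ˢ (Finset.univ : Finset (Fin b × Fin b)),
      frobSq ((G x.1).submatrix (Prod.mk x.2.1) (Prod.mk x.2.2)) =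
      ∑ h ∈ Finset.Icc 1 h₀, frobSq (G h) := by
  rw [Finset.sum_product]
  exact Finset.sum_congr rfl fun h _ => frobSq_blocks (G h)

/-- Transposing the matrix series only reorders the index pairs of vec, so error bounds for M₁ carry
over to M₂. -/
theorem frobSq_submatrix_swap (G : Matrix (Fin b × Fin a) (Fin b × Fin a) ℝ) :
    frobSq (G.submatrix Prod.swap Prod.swap) = frobSq G := by
  simp only [frobSq, Matrix.submatrix_apply]
  rw [← Equiv.sum_comp (Equiv.prodComm (Fin a) (Fin b))]
  refine Finset.sum_congr rfl fun i _ => ?_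
  rw [← Equiv.sum_comp (Equiv.prodComm (Fin a) (Fin b))]
  rfl

/-- Leading eigenvectors of two block Gram matrices are close when the block matrices are. -/
theorem specNorm_leading_blockGram_le {h₀ : ℕ}
    {G G' : ℕ → Matrix (Fin b × Fin a) (Fin b × Fin a) ℝ}
    (hrank : (blockGram h₀ G).rank ≤ d) {c x : ℝ} (hc : 0 < c) (hx : 0 ≤ x)
    (h0 : 0 < eigVal (blockGram h₀ G) 0)
    (hpos : ∀ j < d, c * eigVal (blockGram h₀ G) 0 ≤ eigVal (blockGram h₀ G) j)
    (hgap : ∀ i j, i < j → j < d → c * eigVal (blockGram h₀ G) 0 ≤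
      eigVal (blockGram h₀ G) i - eigVal (blockGram h₀ G) j)
    {Q Q' : Matrix (Fin a) (Fin d) ℝ} (hQ : IsLeadingEigenvectors (blockGram h₀ G) Q)
    (hQ' : IsLeadingEigenvectors (blockGram h₀ G') Q') (hsign : ∀ j, 0 ≤ ∑ u, Q' u j * Q u j)
    (hclose : ∑ h ∈ Finset.Icc 1 h₀, frobSq (G' h - G h) ≤
      x ^ 2 * ∑ h ∈ Finset.Icc 1 h₀, frobSq (G h)) :
    specNorm (Q' - Q) ≤ Real.sqrt (8 * d) * (d / c * (x ^ 2 + 2 * x)) := by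
  set l := eigVal (blockGram h₀ G) 0
  have hl : 0 < c * l := mul_pos hc h0
  refine (specNorm_leading_sub_le (gramSum_isHermitian _ _) (gramSum_isHermitian _ _) hrank hl hpos
    hgap hQ hQ' hsign).trans (mul_le_mul_of_nonneg_left ?_ (Real.sqrt_nonneg _))
  set e := ∑ h ∈ Finset.Icc 1 h₀, frobSq (G h) with he
  have he0 : 0 ≤ e := Finset.sum_nonneg fun _ _ => frobSq_nonneg _
  -- The blocks tile the matrices G(h), so the trace of the block Gram matrix is exactly e.
  have htr : e ≤ d * l := by
    have : (blockGram h₀ G).trace ≤ d * l := trace_le_mul_eigVal (gramSum_isHermitian _ _) hrank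
      fun j hj => hl.trans_le (hpos j hj)
    rwa [blockGram, trace_gramSum, sum_frobSq_blocks] at this
  have hmain := specNorm_gramSum_sub_le
    (Finset.Icc 1 h₀ ×ˢ (Finset.univ : Finset (Fin b × Fin b)))
    (fun y => (G y.1).submatrix (Prod.mk y.2.1) (Prod.mk y.2.2))
    (fun y => (G' y.1).submatrix (Prod.mk y.2.1) (Prod.mk y.2.2))
  have e2 : ∀ y : ℕ × Fin b × Fin b, (G' y.1).submatrix (Prod.mk y.2.1) (Prod.mk y.2.2) -
      (G y.1).submatrix (Prod.mk y.2.1) (Prod.mk y.2.2) =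
      (G' y.1 - G y.1).submatrix (Prod.mk y.2.1) (Prod.mk y.2.2) := fun y => rfl
  simp only [e2] at hmain
  rw [sum_frobSq_blocks, sum_frobSq_blocks h₀ fun h => G' h - G h] at hmain
  have hs : Real.sqrt (∑ h ∈ Finset.Icc 1 h₀, frobSq (G' h - G h)) * Real.sqrt e ≤ x * e := by
    calc _ ≤ Real.sqrt (x ^ 2 * e) * Real.sqrt e := by gcongr
      _ = x * (Real.sqrt e * Real.sqrt e) := by
          rw [Real.sqrt_mul (sq_nonneg x), Real.sqrt_sq hx, mul_assoc]
      _ = x * e := by rw [Real.mul_self_sqrt he0]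
  have hfin : specNorm (blockGram h₀ G - blockGram h₀ G') ≤ (x ^ 2 + 2 * x) * (d * l) := by
    calc _ ≤ (x ^ 2 + 2 * x) * e := by
          refine hmain.trans ?_
          nlinarith
      _ ≤ _ := by gcongr
  rw [div_le_iff₀ hl]
  refine hfin.trans (le_of_eq ?_)
  field_simp

end Blocks

/-! ### Lower bounds for Kronecker products of loadings. -/

section LowerBound

variable {ι κ τ : Type*} [Fintype ι] [Fintype κ] [Fintype τ]

theorem frobSq_transpose (A : Matrix ι κ ℝ) : frobSq A.transpose = frobSq A :=
  Finset.sum_comm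

theorem mul_frobSq_le {A : Matrix ι κ ℝ} {c : ℝ}
    (hA : ∀ x : κ → ℝ, c * ∑ j, x j ^ 2 ≤ ∑ i, A.mulVec x i ^ 2) (Z : Matrix κ τ ℝ) :
    c * frobSq Z ≤ frobSq (A * Z) := by
  rw [← frobSq_transpose Z, ← frobSq_transpose (A * Z), frobSq, frobSq, Finset.mul_sum]
  exact Finset.sum_le_sum fun t _ => hA fun j => Z j t

/-- (C ⊗ R) vec X = vec(R X C'), so the lower bounds for C and R apply one after the other. -/
theorem kronecker_lower_bound {p q k r : ℕ} (R : Matrix (Fin p) (Fin k) ℝ)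
    (C : Matrix (Fin q) (Fin r) ℝ) (x : Fin r × Fin k → ℝ) :
    (minNorm R ^ 2 * minNorm C ^ 2) * ∑ j, x j ^ 2 ≤
      ∑ i, (Matrix.kroneckerMap (· * ·) C R).mulVec x i ^ 2 := by
  set X : Matrix (Fin k) (Fin r) ℝ := Matrix.of fun a b => x (b, a) with hX
  have h1 : ∑ j, x j ^ 2 = frobSq X := by
    rw [Fintype.sum_prod_type, Finset.sum_comm]
    rfl
  have h2 : ∑ i, (Matrix.kroneckerMap (· * ·) C R).mulVec x i ^ 2 =
      frobSq (R * (C * X.transpose).transpose) := by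
    rw [Fintype.sum_prod_type, Finset.sum_comm, frobSq]
    refine Finset.sum_congr rfl fun u _ => Finset.sum_congr rfl fun i _ => ?_
    congr 1
    simp only [Matrix.mulVec, dotProduct, Matrix.kroneckerMap_apply, Fintype.sum_prod_type,
      Matrix.mul_apply, Matrix.transpose_apply, hX, Matrix.of_apply, Finset.mul_sum]
    rw [Finset.sum_comm]
    exact Finset.sum_congr rfl fun a _ => Finset.sum_congr rfl fun b _ => by ring
  rw [h1, h2]
  calc minNorm R ^ 2 * minNorm C ^ 2 * frobSq X
      = minNorm R ^ 2 * (minNorm C ^ 2 * frobSq X.transpose) := by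
        rw [frobSq_transpose, mul_assoc]
    _ ≤ minNorm R ^ 2 * frobSq (C * X.transpose) := by
        gcongr
        exact mul_frobSq_le (minNorm_sq_mul_le C) _
    _ = minNorm R ^ 2 * frobSq (C * X.transpose).transpose := by rw [frobSq_transpose]
    _ ≤ _ := mul_frobSq_le (minNorm_sq_mul_le R) _

end LowerBound

/-! ### Averaged lag covariances entry by entry and in block form. -/

section Covariances

variable {Ω ι κ : Type*} [MeasurableSpace Ω] {P : Measure Ω}

theorem covariance_fun_add_left [IsFiniteMeasure P] {X Y Z : Ω → ℝ} (hX : MemLp X 2 P)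
    (hY : MemLp Y 2 P) (hZ : MemLp Z 2 P) :
    covariance (fun ω => X ω + Y ω) Z P = covariance X Z P + covariance Y Z P :=
  covariance_add_left hX hY hZ

theorem covariance_fun_add_right [IsFiniteMeasure P] {X Y Z : Ω → ℝ} (hX : MemLp X 2 P)
    (hY : MemLp Y 2 P) (hZ : MemLp Z 2 P) :
    covariance X (fun ω => Y ω + Z ω) P = covariance X Y P + covariance X Z P :=
  covariance_add_right hX hY hZ

theorem avgLagCov_apply (T h : ℕ) (U : ℤ → Ω → ι → ℝ) (V : ℤ → Ω → κ → ℝ) (a : ι) (b : κ) :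
    avgLagCov P T h U V a b = 1 / ((T : ℝ) - h) * ∑ t ∈ Finset.Icc (1 : ℤ) ((T : ℤ) - h),
      covariance (fun ω => U t ω a) (fun ω => V (t + h) ω b) P := by
  simp [avgLagCov, Matrix.sum_apply, crossCov]

theorem sampleLagCov_apply (T h : ℕ) (u : ℤ → ι → ℝ) (v : ℤ → κ → ℝ) (a : ι) (b : κ) :
    sampleLagCov T h u v a b = 1 / ((T : ℝ) - h) * ∑ t ∈ Finset.Icc (1 : ℤ) ((T : ℤ) - h),
      u t a * v (t + h) b := by
  simp [sampleLagCov, Matrix.sum_apply, Matrix.vecMulVec_apply]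

theorem popM_eq_blockGram (T h₀ : ℕ) {a b : ℕ} (W : ℤ → Ω → Matrix (Fin a) (Fin b) ℝ) :
    popM P T h₀ W = blockGram h₀ fun h =>
      avgLagCov P T h (fun t ω => (W t ω).vec) fun t ω => (W t ω).vec := by
  have : ∀ h i j, (avgLagCov P T h (fun t ω => (W t ω).vec) fun t ω => (W t ω).vec).submatrix
      (Prod.mk i) (Prod.mk j) =
      avgLagCov P T h (fun t ω u => W t ω u i) (fun t ω u => W t ω u j) := by
    intro h i j
    ext u v
    rw [Matrix.submatrix_apply, avgLagCov_apply, avgLagCov_apply]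
    rfl
  simp only [popM, blockGram, gramSum, this]
  rw [Finset.sum_product]
  simp only [Fintype.sum_prod_type]

theorem sampleM_eq_blockGram (T h₀ : ℕ) {a b : ℕ} (w : ℤ → Matrix (Fin a) (Fin b) ℝ) :
    sampleM T h₀ w = blockGram h₀ fun h =>
      sampleLagCov T h (fun t => (w t).vec) fun t => (w t).vec := by
  have : ∀ h i j, (sampleLagCov T h (fun t => (w t).vec) fun t => (w t).vec).submatrix
      (Prod.mk i) (Prod.mk j) =
      sampleLagCov T h (fun t u => w t u i) (fun t u => w t u j) := by
    intro h i j
    ext u v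
    rw [Matrix.submatrix_apply, sampleLagCov_apply, sampleLagCov_apply]
    rfl
  simp only [sampleM, blockGram, gramSum, this]
  rw [Finset.sum_product]
  simp only [Fintype.sum_prod_type]

end Covariances

/-! ### Population autocovariances of W: factor structure, rank and strength. -/

namespace Model

variable {p q m k r T : ℕ} {Ω : Type*} [MeasurableSpace Ω] {P : Measure Ω}
  (S : Model p q m k r T P)

/-- The averaged lag-`h` autocovariance matrix of `vec(W_t)`. -/
def covW (h : ℕ) : Matrix (Fin q × Fin p) (Fin q × Fin p) ℝ :=
  avgLagCov P T h (fun t ω => (S.W t ω).vec) fun t ω => (S.W t ω).vec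

/-- The sample lag-`h` autocovariance matrix of the residuals `vec(Ŵ_t)`. -/
def covWhat (h : ℕ) (ω : Ω) : Matrix (Fin q × Fin p) (Fin q × Fin p) ℝ :=
  sampleLagCov T h (fun t => (S.What t ω).vec) fun t => (S.What t ω).vec

theorem M₁_eq (h₀ : ℕ) : S.M₁ h₀ = blockGram h₀ S.covW :=
  popM_eq_blockGram T h₀ S.W

theorem M₂_eq (h₀ : ℕ) :
    S.M₂ h₀ = blockGram h₀ fun h => (S.covW h).submatrix Prod.swap Prod.swap := by
  rw [M₂, popM_eq_blockGram]
  congr 1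
  ext h x y
  rw [Matrix.submatrix_apply, covW, avgLagCov_apply, avgLagCov_apply]
  rfl

theorem Mhat₁_eq (h₀ : ℕ) (ω : Ω) : S.Mhat₁ h₀ ω = blockGram h₀ fun h => S.covWhat h ω :=
  sampleM_eq_blockGram T h₀ fun t => S.What t ω

theorem Mhat₂_eq (h₀ : ℕ) (ω : Ω) :
    S.Mhat₂ h₀ ω = blockGram h₀ fun h => (S.covWhat h ω).submatrix Prod.swap Prod.swap := by
  rw [Mhat₂, sampleM_eq_blockGram]
  congr 1
  ext h x y
  rw [Matrix.submatrix_apply, covWhat, sampleLagCov_apply, sampleLagCov_apply]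
  rfl

theorem W_apply (t : ℤ) (ω : Ω) (u : Fin p) (i : Fin q) :
    S.W t ω u i = ∑ x : Fin r × Fin k, (S.C i x.1 * S.R u x.2) * S.F t ω x.2 x.1 + S.E t ω u i := by
  rw [W, Matrix.add_apply]
  congr 1
  simp only [Matrix.mul_apply, Matrix.transpose_apply, Fintype.sum_prod_type, Finset.sum_mul]
  exact Finset.sum_congr rfl fun b _ => Finset.sum_congr rfl fun a _ => by ring

variable [IsProbabilityMeasure P]

/-- At distinct times the error autocovariance is zero, and both factor-error cross terms vanish at
all leads and lags; only the factor part survives. -/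
theorem covariance_W {s t : ℤ} (hs : s ∈ Set.Icc (1 : ℤ) T) (ht : t ∈ Set.Icc (1 : ℤ) T)
    (hst : s ≠ t) (u : Fin p) (i : Fin q) (v : Fin p) (j : Fin q) :
    covariance (fun ω => S.W s ω u i) (fun ω => S.W t ω v j) P =
      ∑ x : Fin r × Fin k, ∑ y : Fin r × Fin k, (S.C i x.1 * S.R u x.2) *
        (S.C j y.1 * S.R v y.2) *
        covariance (fun ω => S.F s ω x.2 x.1) (fun ω => S.F t ω y.2 y.1) P := by
  have hEF : ∀ s ∈ Set.Icc (1 : ℤ) T, ∀ t ∈ Set.Icc (1 : ℤ) T, ∀ u i a b,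
      covariance (fun ω => S.E s ω u i) (fun ω => S.F t ω a b) P = 0 := fun s hs t ht u i a b =>
    congrFun (congrFun (S.uncorr_E_F s hs t ht) (i, u)) (b, a)
  have hEE : covariance (fun ω => S.E s ω u i) (fun ω => S.E t ω v j) P = 0 :=
    congrFun (congrFun (S.white_E s hs t ht hst) (i, u)) (j, v)
  have hF : ∀ t ∈ Set.Icc (1 : ℤ) T, ∀ (c : ℝ) a b, MemLp (fun ω => c * S.F t ω a b) 2 P :=
    fun t ht c a b => (S.memLp_F t ht a b).const_mul c
  have hsF : ∀ t ∈ Set.Icc (1 : ℤ) T, ∀ u i, MemLp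
      (fun ω => ∑ x : Fin r × Fin k, (S.C i x.1 * S.R u x.2) * S.F t ω x.2 x.1) 2 P :=
    fun t ht u i => memLp_finsetSum _ fun x _ => hF t ht _ _ _
  have hW : MemLp (fun ω => ∑ x : Fin r × Fin k, (S.C j x.1 * S.R v x.2) * S.F t ω x.2 x.1 +
      S.E t ω v j) 2 P := (hsF t ht v j).add (S.memLp_E t ht v j)
  simp only [W_apply]
  rw [covariance_fun_add_left (hsF s hs u i) (S.memLp_E s hs u i) hW,
    covariance_fun_add_right (hsF s hs u i) (hsF t ht v j) (S.memLp_E t ht v j),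
    covariance_fun_add_right (S.memLp_E s hs u i) (hsF t ht v j) (S.memLp_E t ht v j), hEE]
  rw [covariance_fun_sum_fun_sum (fun x => hF s hs _ _ _) (fun x => hF t ht _ _ _)]
  rw [covariance_fun_sum_left (fun x => hF s hs _ _ _) (S.memLp_E t ht v j),
    covariance_fun_sum_right (fun x => hF t ht _ _ _) (S.memLp_E s hs u i)]
  simp only [covariance_const_mul_left, covariance_const_mul_right, hEF s hs t ht]
  simp only [covariance_comm (fun ω => S.F s ω _ _) (fun ω => S.E t ω v j), hEF t ht s hs]
  simp only [mul_zero, Finset.sum_const_zero, add_zero]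
  exact Finset.sum_congr rfl fun x _ => Finset.sum_congr rfl fun y _ => by ring

theorem covW_eq {h : ℕ} (hh : 1 ≤ h) : S.covW h =
    Matrix.kroneckerMap (· * ·) S.C S.R *
      (S.covF h * (Matrix.kroneckerMap (· * ·) S.C S.R).transpose) := by
  ext ⟨i, u⟩ ⟨j, v⟩
  rw [covW, avgLagCov_apply]
  simp only [Matrix.mul_apply, Matrix.transpose_apply, Matrix.kroneckerMap_apply, covF,
    avgLagCov_apply, Matrix.vec]
  have : ∀ t ∈ Finset.Icc (1 : ℤ) ((T : ℤ) - h),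
      covariance (fun ω => S.W t ω u i) (fun ω => S.W (t + h) ω v j) P =
      ∑ x : Fin r × Fin k, ∑ y : Fin r × Fin k, (S.C i x.1 * S.R u x.2) *
        (S.C j y.1 * S.R v y.2) *
        covariance (fun ω => S.F t ω x.2 x.1) (fun ω => S.F (t + h) ω y.2 y.1) P := by
    intro t ht
    rw [Finset.mem_Icc] at ht
    exact S.covariance_W ⟨by omega, by omega⟩ ⟨by omega, by omega⟩ (by omega) u i v j
  rw [Finset.sum_congr rfl this, Finset.sum_comm, Finset.mul_sum]
  refine Finset.sum_congr rfl fun x _ => ?_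
  rw [Finset.sum_comm, Finset.mul_sum, Finset.mul_sum]
  refine Finset.sum_congr rfl fun y _ => ?_
  rw [← Finset.mul_sum]
  ring

theorem rank_M₁_le (h₀ : ℕ) : (S.M₁ h₀).rank ≤ k := by
  rw [M₁_eq]
  -- A block fixes the column index of W_t, so the left Kronecker factor reduces to one row of C
  -- times R, and R comes out on the left.
  refine rank_gramSum_le _ _ S.R (fun x => Matrix.of fun a v => ∑ b, S.C x.2.1 b *
    (S.covF x.1 * (Matrix.kroneckerMap (· * ·) S.C S.R).transpose) (b, a) (x.2.2, v))
    fun x hx => ?_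
  have hh : 1 ≤ x.1 := (Finset.mem_Icc.1 (Finset.mem_product.1 hx).1).1
  ext u v
  rw [Matrix.submatrix_apply, S.covW_eq hh, Matrix.mul_apply, Matrix.mul_apply,
    Fintype.sum_prod_type, Finset.sum_comm]
  simp only [Matrix.of_apply, Matrix.kroneckerMap_apply, Finset.mul_sum]
  exact Finset.sum_congr rfl fun a _ => Finset.sum_congr rfl fun b _ => by ring

theorem rank_M₂_le (h₀ : ℕ) : (S.M₂ h₀).rank ≤ r := by
  rw [M₂_eq]
  refine rank_gramSum_le _ _ S.C (fun x => Matrix.of fun b j => ∑ a, S.R x.2.1 a *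
    (S.covF x.1 * (Matrix.kroneckerMap (· * ·) S.C S.R).transpose) (b, a) (j, x.2.2))
    fun x hx => ?_
  have hh : 1 ≤ x.1 := (Finset.mem_Icc.1 (Finset.mem_product.1 hx).1).1
  ext i j
  change S.covW x.1 (i, x.2.1) (j, x.2.2) = _
  rw [S.covW_eq hh, Matrix.mul_apply, Matrix.mul_apply, Fintype.sum_prod_type]
  simp only [Matrix.of_apply, Matrix.kroneckerMap_apply, Finset.mul_sum]
  exact Finset.sum_congr rfl fun a _ => Finset.sum_congr rfl fun b _ => by ring

/-- The Kronecker bound is used on each side of Σ_f(h), on the right through transposition; hence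
the square of the loading factor. -/
theorem le_frobSq_covW {h : ℕ} (hh : 1 ≤ h) :
    (minNorm S.R ^ 2 * minNorm S.C ^ 2) ^ 2 * specNorm (S.covF h) ^ 2 ≤ frobSq (S.covW h) := by
  have hB := kronecker_lower_bound S.R S.C
  set c := minNorm S.R ^ 2 * minNorm S.C ^ 2 with hc
  have hc0 : 0 ≤ c := by positivity
  set B := Matrix.kroneckerMap (· * ·) S.C S.R
  calc c ^ 2 * specNorm (S.covF h) ^ 2 ≤ c ^ 2 * frobSq (S.covF h) := by
        gcongr
        exact specNorm_sq_le_frobSq _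
    _ = c * (c * frobSq (S.covF h).transpose) := by rw [frobSq_transpose]; ring
    _ ≤ c * frobSq (B * (S.covF h).transpose) := by
        gcongr
        exact mul_frobSq_le hB _
    _ = c * frobSq (S.covF h * B.transpose) := by
        rw [← frobSq_transpose (B * _), Matrix.transpose_mul, Matrix.transpose_transpose]
    _ ≤ frobSq (B * (S.covF h * B.transpose)) := mul_frobSq_le hB _
    _ = _ := by rw [S.covW_eq hh]

end Model

/-! ### Deterministic inequalities for sample moments. -/

section Sample

variable {ι κ τ : Type*} [Fintype ι] [Fintype κ] [Fintype τ]

theorem frobSq_mul_le (A : Matrix ι κ ℝ) (B : Matrix κ τ ℝ) :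
    frobSq (A * B) ≤ frobSq A * frobSq B := by
  have hB : frobSq B = ∑ t, ∑ j, B j t ^ 2 := Finset.sum_comm
  rw [hB, frobSq, frobSq, Finset.sum_mul_sum]
  refine Finset.sum_le_sum fun i _ => Finset.sum_le_sum fun t _ => ?_
  rw [Matrix.mul_apply]
  exact Finset.sum_mul_sq_le_sq_mul_sq _ _ _

theorem sum_sq_vec {a b : ℕ} (A : Matrix (Fin a) (Fin b) ℝ) : ∑ x, A.vec x ^ 2 = frobSq A := by
  rw [Fintype.sum_prod_type, Finset.sum_comm]
  rfl

/-- Cauchy-Schwarz in time for each entry; the 4 is the square of the loss in 1/(T - h) ≤ 2/T. -/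
theorem frobSq_sampleLagCov_le {T h : ℕ} (hT : 2 * h ≤ T) (hT0 : 0 < T)
    (f : ℤ → ι → ℝ) (g : ℤ → κ → ℝ) :
    frobSq (sampleLagCov T h f g) ≤
      4 * ((1 / (T : ℝ) * ∑ t ∈ Finset.Icc (1 : ℤ) T, ∑ a, f t a ^ 2) *
        (1 / (T : ℝ) * ∑ t ∈ Finset.Icc (1 : ℤ) T, ∑ b, g t b ^ 2)) := by
  set I := Finset.Icc (1 : ℤ) ((T : ℤ) - h) with hI
  have hTr : (0 : ℝ) < T := by exact_mod_cast hT0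
  have hTh : (T : ℝ) / 2 ≤ (T : ℝ) - h := by
    have : (2 : ℝ) * h ≤ T := by exact_mod_cast hT
    linarith
  have hf : ∀ a, ∑ t ∈ I, f t a ^ 2 ≤ ∑ t ∈ Finset.Icc (1 : ℤ) T, f t a ^ 2 := fun a =>
    Finset.sum_le_sum_of_subset_of_nonneg
      (Finset.Icc_subset_Icc_right (by omega)) fun _ _ _ => sq_nonneg _
  have hg : ∀ b, ∑ t ∈ I, g (t + h) b ^ 2 ≤ ∑ t ∈ Finset.Icc (1 : ℤ) T, g t b ^ 2 := by
    intro b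
    rw [← Finset.sum_image (f := fun t => g t b ^ 2) (g := fun t : ℤ => t + h)
      (fun x _ y _ hxy => by simpa using hxy)]
    refine Finset.sum_le_sum_of_subset_of_nonneg (fun t ht => ?_) fun _ _ _ => sq_nonneg _
    obtain ⟨s, hs, rfl⟩ := Finset.mem_image.1 ht
    rw [hI, Finset.mem_Icc] at hs
    rw [Finset.mem_Icc]
    omega
  have hc : (1 / ((T : ℝ) - h)) ^ 2 ≤ 4 * (1 / (T : ℝ)) ^ 2 := by
    have h2 : 1 / ((T : ℝ) - h) ≤ 2 * (1 / T) := by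
      calc 1 / ((T : ℝ) - h) ≤ 1 / ((T : ℝ) / 2) :=
            one_div_le_one_div_of_le (by positivity) hTh
        _ = _ := by field_simp
    calc (1 / ((T : ℝ) - h)) ^ 2 ≤ (2 * (1 / T)) ^ 2 :=
          pow_le_pow_left₀ (one_div_nonneg.2 (by linarith)) h2 2
      _ = _ := by ring
  have hentry : ∀ a b, sampleLagCov T h f g a b ^ 2 ≤ 4 * (1 / (T : ℝ)) ^ 2 *
      ((∑ t ∈ Finset.Icc (1 : ℤ) T, f t a ^ 2) * ∑ t ∈ Finset.Icc (1 : ℤ) T, g t b ^ 2) := by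
    intro a b
    rw [sampleLagCov_apply, mul_pow]
    refine mul_le_mul hc ((Finset.sum_mul_sq_le_sq_mul_sq _ _ _).trans
      (mul_le_mul (hf a) (hg b) ?_ ?_)) (sq_nonneg _) (by positivity)
    · exact Finset.sum_nonneg fun _ _ => sq_nonneg _
    · exact Finset.sum_nonneg fun _ _ => sq_nonneg _
  calc frobSq (sampleLagCov T h f g) ≤ ∑ a, ∑ b, 4 * (1 / (T : ℝ)) ^ 2 *
      ((∑ t ∈ Finset.Icc (1 : ℤ) T, f t a ^ 2) * ∑ t ∈ Finset.Icc (1 : ℤ) T, g t b ^ 2) :=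
        Finset.sum_le_sum fun a _ => Finset.sum_le_sum fun b _ => hentry a b
    _ = _ := by
        simp only [← Finset.mul_sum]
        rw [← Finset.sum_mul, Finset.sum_comm,
          Finset.sum_comm (s := Finset.Icc (1 : ℤ) T) (f := fun t b => g t b ^ 2)]
        ring

theorem frobSq_add_four_le (A B C D : Matrix ι κ ℝ) :
    frobSq (A - B - C + D) ≤ 4 * (frobSq A + frobSq B + frobSq C + frobSq D) := by
  simp only [frobSq, ← Finset.sum_add_distrib, Finset.mul_sum]
  refine Finset.sum_le_sum fun i _ => Finset.sum_le_sum fun j _ => ?_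
  simp only [Matrix.add_apply, Matrix.sub_apply]
  nlinarith [sq_nonneg (A i j + B i j), sq_nonneg (A i j + C i j), sq_nonneg (A i j - D i j),
    sq_nonneg (B i j - C i j), sq_nonneg (B i j + D i j), sq_nonneg (C i j + D i j)]

theorem sampleLagCov_sub_sub {ι : Type*} {T h : ℕ} {f y : ℤ → ι → ℝ} {w : ℤ → ι → ℝ}
    (hw : ∀ t ∈ Set.Icc (1 : ℤ) T, w t = f t - y t) :
    sampleLagCov T h w w = sampleLagCov T h f f - sampleLagCov T h y f - sampleLagCov T h f y +
      sampleLagCov T h y y := by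
  ext a b
  simp only [Matrix.add_apply, Matrix.sub_apply, sampleLagCov_apply, ← mul_sub, ← mul_add,
    ← Finset.sum_sub_distrib, ← Finset.sum_add_distrib]
  congr 1
  refine Finset.sum_congr rfl fun t ht => ?_
  rw [Finset.mem_Icc] at ht
  rw [hw t ⟨by omega, by omega⟩, hw (t + h) ⟨by omega, by omega⟩, Pi.sub_apply, Pi.sub_apply]
  ring

/-- Right division by a symmetric matrix which is bounded below. -/
theorem frobSq_le_of_mul_eq {a m : ℕ} {D V : Matrix (Fin a) (Fin m) ℝ}
    {G : Matrix (Fin m) (Fin m) ℝ} {c : ℝ} (hc : 0 < c)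
    (hG : ∀ x : Fin m → ℝ, c * ∑ i, x i ^ 2 ≤ ∑ i, x i * G.mulVec x i)
    (hDV : D * G = V) : c ^ 2 * frobSq D ≤ frobSq V := by
  rw [frobSq, frobSq, Finset.mul_sum]
  refine Finset.sum_le_sum fun u _ => ?_
  have h1 := hG (D u)
  have h2 : ∑ i, D u i * G.mulVec (D u) i = ∑ l, V u l * D u l := by
    rw [← hDV]
    simp only [Matrix.mul_apply, Matrix.mulVec, dotProduct, Finset.mul_sum, Finset.sum_mul]
    rw [Finset.sum_comm]
    exact Finset.sum_congr rfl fun _ _ => Finset.sum_congr rfl fun _ _ => by ring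
  rw [h2] at h1
  have h3 := Finset.sum_mul_sq_le_sq_mul_sq Finset.univ (V u) (D u)
  set x := ∑ i, D u i ^ 2
  set y := ∑ i, V u i ^ 2
  have hx : 0 ≤ x := Finset.sum_nonneg fun _ _ => sq_nonneg _
  have hy : 0 ≤ y := Finset.sum_nonneg fun _ _ => sq_nonneg _
  have h4 : (c * x) ^ 2 ≤ y * x := (pow_le_pow_left₀ (by positivity) h1 2).trans h3
  rcases hx.eq_or_lt with h | h
  · rw [← h]; simpa using hy
  · have : (c ^ 2 * x) * x ≤ y * x := by linarith [h4, mul_pow c x 2, sq x]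
    exact le_of_mul_le_mul_right this h

theorem isUnit_det_of_lower_bound {m : ℕ} {G : Matrix (Fin m) (Fin m) ℝ} {c : ℝ} (hc : 0 < c)
    (hG : ∀ x : Fin m → ℝ, c * ∑ i, x i ^ 2 ≤ ∑ i, x i * G.mulVec x i) : IsUnit G.det := by
  rw [isUnit_iff_ne_zero]
  intro h
  obtain ⟨x, hx, hGx⟩ := Matrix.exists_mulVec_eq_zero_iff.2 h
  have h1 := hG x
  simp only [hGx, Pi.zero_apply, mul_zero, Finset.sum_const_zero] at h1
  obtain ⟨i, hi⟩ := Function.ne_iff.1 hx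
  have h2 : 0 < ∑ i, x i ^ 2 := Finset.sum_pos' (fun _ _ => sq_nonneg _)
    ⟨i, Finset.mem_univ _, by have : x i ≠ 0 := hi; positivity⟩
  nlinarith

theorem abs_sum_mul_mulVec_le {m : ℕ} (G : Matrix (Fin m) (Fin m) ℝ) (x : Fin m → ℝ) {e : ℝ}
    (hG : specNorm G ≤ e) : |∑ i, x i * G.mulVec x i| ≤ e * ∑ i, x i ^ 2 := by
  have hx : 0 ≤ ∑ i, x i ^ 2 := Finset.sum_nonneg fun _ _ => sq_nonneg _
  have hG0 := specNorm_nonneg G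
  refine abs_le_of_sq_le_sq ?_ (mul_nonneg (hG0.trans hG) hx)
  calc (∑ i, x i * G.mulVec x i) ^ 2 ≤ (∑ i, x i ^ 2) * ∑ i, G.mulVec x i ^ 2 :=
        Finset.sum_mul_sq_le_sq_mul_sq _ _ _
    _ ≤ (∑ i, x i ^ 2) * (e ^ 2 * ∑ i, x i ^ 2) := by
        gcongr
        exact (norm_mulVec_le G x).trans (by gcongr)
    _ = _ := by ring

end Sample

/-! ### Pathwise control of the residual autocovariances. -/

namespace Model

variable {p q m k r T : ℕ} {Ω : Type*} [MeasurableSpace Ω] {P : Measure Ω}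
  (S : Model p q m k r T P)

/-- The sample lag-`h` autocovariance matrix of the unobserved `vec(W_t)`. -/
def sampleCovW (h : ℕ) (ω : Ω) : Matrix (Fin q × Fin p) (Fin q × Fin p) ℝ :=
  sampleLagCov T h (fun t => (S.W t ω).vec) fun t => (S.W t ω).vec

/-- `T⁻¹ ∑ W_t X_t'`. -/
def crossWX (ω : Ω) : Matrix (Fin p) (Fin m) ℝ :=
  (1 / (T : ℝ)) • ∑ t ∈ Finset.Icc (1 : ℤ) T, S.W t ω * (S.X t ω).transpose

/-- `T⁻¹ ∑ X_t X_t'`. -/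
def gramX (ω : Ω) : Matrix (Fin m) (Fin m) ℝ :=
  (1 / (T : ℝ)) • ∑ t ∈ Finset.Icc (1 : ℤ) T, S.X t ω * (S.X t ω).transpose

/-- `T⁻¹ ∑ E(X_t X_t')`. -/
def meanGramX : Matrix (Fin m) (Fin m) ℝ :=
  (1 / (T : ℝ)) • ∑ t ∈ Finset.Icc (1 : ℤ) T, S.secondMomentX t

/-- `T⁻¹ ∑ ‖X_t‖_F²`. -/
def energyX (ω : Ω) : ℝ := 1 / (T : ℝ) * ∑ t ∈ Finset.Icc (1 : ℤ) T, frobSq (S.X t ω)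

/-- `T⁻¹ ∑ ‖W_t‖_F²`. -/
def energyW (ω : Ω) : ℝ := 1 / (T : ℝ) * ∑ t ∈ Finset.Icc (1 : ℤ) T, frobSq (S.W t ω)

/-- A statistic of bounded mean which controls all estimation errors. -/
def errorStat (h₀ : ℕ) (ω : Ω) : ℝ :=
  (T : ℝ) / ((p : ℝ) * q) ^ 2 *
      ∑ h ∈ Finset.Icc 1 h₀, frobSq (S.sampleCovW h ω - S.covW h) +
    (T : ℝ) / ((p : ℝ) * (q : ℝ) ^ 2) * frobSq (S.crossWX ω) +
    (T : ℝ) / (q : ℝ) ^ 2 * frobSq (S.gramX ω - S.meanGramX) +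
    1 / (q : ℝ) * S.energyX ω + 1 / ((p : ℝ) * q) * S.energyW ω

theorem Y_eq {t : ℤ} (ht : t ∈ Set.Icc (1 : ℤ) T) (ω : Ω) :
    S.Y t ω = S.A * S.X t ω + S.W t ω := by
  rw [S.model_eq t ht ω, W, add_assoc]

theorem What_eq {t : ℤ} (ht : t ∈ Set.Icc (1 : ℤ) T) (ω : Ω) :
    S.What t ω = S.W t ω - (S.Ahat ω - S.A) * S.X t ω := by
  rw [What, S.Y_eq ht, Matrix.sub_mul]
  abel

/-- The normal equations. Invertibility is assumed because the matrix inverse of a singular matrix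
is 0 by convention. -/
theorem Ahat_sub_mul_gramX {ω : Ω} (hG : IsUnit (S.gramX ω).det) :
    (S.Ahat ω - S.A) * S.gramX ω = S.crossWX ω := by
  have h1 : S.Ahat ω * S.gramX ω =
      (1 / (T : ℝ)) • ∑ t ∈ Finset.Icc (1 : ℤ) T, S.Y t ω * (S.X t ω).transpose := by
    rw [Ahat, ← gramX, Matrix.mul_assoc, Matrix.nonsing_inv_mul _ hG, Matrix.mul_one]
  rw [Matrix.sub_mul, h1, gramX, crossWX, Matrix.mul_smul, Matrix.mul_sum, ← smul_sub,
    ← Finset.sum_sub_distrib]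
  congr 1
  refine Finset.sum_congr rfl fun t ht => ?_
  rw [S.Y_eq (Finset.mem_Icc.1 ht), Matrix.add_mul, Matrix.mul_assoc]
  abel

theorem energyX_nonneg (ω : Ω) : 0 ≤ S.energyX ω :=
  mul_nonneg (by positivity) (Finset.sum_nonneg fun _ _ => frobSq_nonneg _)

theorem energyW_nonneg (ω : Ω) : 0 ≤ S.energyW ω :=
  mul_nonneg (by positivity) (Finset.sum_nonneg fun _ _ => frobSq_nonneg _)

theorem errorStat_nonneg (h₀ : ℕ) (ω : Ω) : 0 ≤ S.errorStat h₀ ω := by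
  have h1 := S.energyX_nonneg ω
  have h2 := S.energyW_nonneg ω
  have h3 := frobSq_nonneg (S.crossWX ω)
  have h4 := frobSq_nonneg (S.gramX ω - S.meanGramX)
  have h5 : 0 ≤ ∑ h ∈ Finset.Icc 1 h₀, frobSq (S.sampleCovW h ω - S.covW h) :=
    Finset.sum_nonneg fun _ _ => frobSq_nonneg _
  unfold errorStat
  positivity

/-- The components of the error statistic. -/
theorem errorStat_components {h₀ : ℕ} {ω : Ω} {z : ℝ} (hz : S.errorStat h₀ ω ≤ z)
    (hp : 0 < p) (hq : 0 < q) (hT : 0 < T) :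
    ∑ h ∈ Finset.Icc 1 h₀, frobSq (S.sampleCovW h ω - S.covW h) ≤ z * (((p : ℝ) * q) ^ 2 / T) ∧
    frobSq (S.crossWX ω) ≤ z * ((p : ℝ) * (q : ℝ) ^ 2 / T) ∧
    frobSq (S.gramX ω - S.meanGramX) ≤ z * ((q : ℝ) ^ 2 / T) ∧
    S.energyX ω ≤ z * q ∧ S.energyW ω ≤ z * (p * q) := by
  have hp' : (0 : ℝ) < p := by exact_mod_cast hp
  have hq' : (0 : ℝ) < q := by exact_mod_cast hq
  have hT' : (0 : ℝ) < T := by exact_mod_cast hT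
  have h5 : 0 ≤ ∑ h ∈ Finset.Icc 1 h₀, frobSq (S.sampleCovW h ω - S.covW h) :=
    Finset.sum_nonneg fun _ _ => frobSq_nonneg _
  have key : ∀ {a b x : ℝ}, 0 < a → a * b = 1 → a * x ≤ z → x ≤ z * b := by
    intro a b x ha hab h
    calc x = (a * x) * b := by rw [mul_right_comm, hab, one_mul]
      _ ≤ z * b := by
        refine mul_le_mul_of_nonneg_right h ?_
        by_contra hb
        nlinarith
  unfold errorStat at hz
  have e1 : 0 ≤ (T : ℝ) / ((p : ℝ) * q) ^ 2 *
      ∑ h ∈ Finset.Icc 1 h₀, frobSq (S.sampleCovW h ω - S.covW h) := by positivity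
  have e2 : 0 ≤ (T : ℝ) / ((p : ℝ) * (q : ℝ) ^ 2) * frobSq (S.crossWX ω) :=
    mul_nonneg (by positivity) (frobSq_nonneg _)
  have e3 : 0 ≤ (T : ℝ) / (q : ℝ) ^ 2 * frobSq (S.gramX ω - S.meanGramX) :=
    mul_nonneg (by positivity) (frobSq_nonneg _)
  have e4 : 0 ≤ 1 / (q : ℝ) * S.energyX ω := mul_nonneg (by positivity) (S.energyX_nonneg ω)
  have e5 : 0 ≤ 1 / ((p : ℝ) * q) * S.energyW ω := mul_nonneg (by positivity) (S.energyW_nonneg ω)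
  refine ⟨key (a := (T : ℝ) / ((p : ℝ) * q) ^ 2) (by positivity) (by field_simp) (by linarith),
    key (a := (T : ℝ) / ((p : ℝ) * (q : ℝ) ^ 2)) (by positivity) (by field_simp) (by linarith),
    key (a := (T : ℝ) / (q : ℝ) ^ 2) (by positivity) (by field_simp) (by linarith),
    key (a := 1 / (q : ℝ)) (by positivity) (by field_simp) (by linarith),
    key (a := 1 / ((p : ℝ) * q)) (by positivity) (by field_simp) (by linarith)⟩

/-- The residual autocovariances are close to the population ones when the error statistic is
bounded. -/
theorem sum_frobSq_covWhat_sub_le {h₀ : ℕ} {ω : Ω} {z c : ℝ} (hz : S.errorStat h₀ ω ≤ z)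
    (hp : 0 < p) (hq : 0 < q) (hT : 0 < T) (hTh : 2 * h₀ ≤ T) (hc : 0 < c)
    (hG : ∀ x : Fin m → ℝ, 2 * c * q * ∑ i, x i ^ 2 ≤ ∑ i, x i * S.meanGramX.mulVec x i)
    (hzT : z / T ≤ c ^ 2) :
    ∑ h ∈ Finset.Icc 1 h₀, frobSq (S.covWhat h ω - S.covW h) ≤
      (4 * z + h₀ * (4 * (8 * (z ^ 3 / c ^ 2) + 4 * (z ^ 4 / c ^ 4)))) *
        (((p : ℝ) * q) ^ 2 / T) := by
  have hp' : (0 : ℝ) < p := by exact_mod_cast hp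
  have hq' : (0 : ℝ) < q := by exact_mod_cast hq
  have hT' : (0 : ℝ) < T := by exact_mod_cast hT
  have hz0 : 0 ≤ z := (S.errorStat_nonneg h₀ ω).trans hz
  obtain ⟨z1, z2, z3, z4, z5⟩ := S.errorStat_components hz hp hq hT
  -- The mean Gram matrix is bounded below by 2cq and the deviation has norm at most q√(z/T) ≤ cq,
  -- so half of the bound survives.
  have hGlow : ∀ x : Fin m → ℝ, (c * q) * ∑ i, x i ^ 2 ≤ ∑ i, x i * (S.gramX ω).mulVec x i := by
    intro x
    have h1 := abs_sum_mul_mulVec_le (S.gramX ω - S.meanGramX) x (e := c * q) (by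
      rw [← sq_le_sq₀ (specNorm_nonneg _) (by positivity)]
      refine (specNorm_sq_le_frobSq _).trans (z3.trans ?_)
      calc z * ((q : ℝ) ^ 2 / T) = z / T * (q : ℝ) ^ 2 := by ring
        _ ≤ c ^ 2 * (q : ℝ) ^ 2 := by gcongr
        _ = _ := by ring)
    have h2 := hG x
    have h3 : ∑ i, x i * (S.gramX ω - S.meanGramX).mulVec x i =
        ∑ i, x i * (S.gramX ω).mulVec x i - ∑ i, x i * S.meanGramX.mulVec x i := by
      rw [Matrix.sub_mulVec, ← Finset.sum_sub_distrib]
      exact Finset.sum_congr rfl fun i _ => by rw [Pi.sub_apply]; ring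
    rw [h3] at h1
    have := (abs_le.1 h1).1
    linarith
  have hcq : 0 < c * q := by positivity
  have hD := frobSq_le_of_mul_eq hcq hGlow
    (S.Ahat_sub_mul_gramX (isUnit_det_of_lower_bound hcq hGlow))
  set D := S.Ahat ω - S.A with hDdef
  have hD' : frobSq D ≤ z / c ^ 2 * (p / T) := by
    have h1 : (c * q) ^ 2 * frobSq D ≤ (c * q) ^ 2 * (z / c ^ 2 * (p / T)) := by
      refine (hD.trans z2).trans (le_of_eq ?_)
      field_simp
    exact le_of_mul_le_mul_left h1 (by positivity)
  have hD0 := frobSq_nonneg D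
  -- The mean energy of the residual correction (Â - A) X_t. It is of order pq/T while that of W_t
  -- is of order pq, so the cross terms are of order p²q²/T, like the sampling error.
  set Ey : ℝ := 1 / (T : ℝ) * ∑ t ∈ Finset.Icc (1 : ℤ) T, ∑ x, (D * S.X t ω).vec x ^ 2 with hEy
  have hEy0 : 0 ≤ Ey := by positivity
  have hEyle : Ey ≤ z / c ^ 2 * (p / T) * (z * q) := by
    calc Ey ≤ 1 / (T : ℝ) * ∑ t ∈ Finset.Icc (1 : ℤ) T, frobSq D * frobSq (S.X t ω) := by
          rw [hEy]
          gcongr with t ht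
          rw [sum_sq_vec]
          exact frobSq_mul_le _ _
      _ = frobSq D * S.energyX ω := by
          rw [← Finset.mul_sum, energyX]; ring
      _ ≤ _ := mul_le_mul hD' z4 (S.energyX_nonneg ω) (by positivity)
  have hEw : 1 / (T : ℝ) * ∑ t ∈ Finset.Icc (1 : ℤ) T, ∑ x, (S.W t ω).vec x ^ 2 = S.energyW ω := by
    simp only [sum_sq_vec, energyW]
  have hEw0 := S.energyW_nonneg ω
  have hT1 : (1 : ℝ) ≤ T := by exact_mod_cast hT
  have hyw : Ey * S.energyW ω ≤ z ^ 3 / c ^ 2 * (((p : ℝ) * q) ^ 2 / T) := by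
    calc Ey * S.energyW ω ≤ (z / c ^ 2 * (p / T) * (z * q)) * (z * (p * q)) :=
          mul_le_mul hEyle z5 hEw0 (by positivity)
      _ = _ := by field_simp
  have hyy : Ey * Ey ≤ z ^ 4 / c ^ 4 * (((p : ℝ) * q) ^ 2 / T) := by
    calc Ey * Ey ≤ (z / c ^ 2 * (p / T) * (z * q)) * (z / c ^ 2 * (p / T) * (z * q)) :=
          mul_le_mul hEyle hEyle hEy0 (by positivity)
      _ = (z ^ 4 / c ^ 4 * (((p : ℝ) * q) ^ 2 / T)) * (1 / T) := by field_simp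
      _ ≤ _ := mul_le_of_le_one_right (by positivity) ((div_le_one hT').2 hT1)
  -- The outer 4s come from squaring a sum of four terms. Inside, two cross terms with constant 4
  -- each give 8, and the quadratic term gives 4.
  have hlag : ∀ h ∈ Finset.Icc 1 h₀, frobSq (S.covWhat h ω - S.covW h) ≤
      4 * frobSq (S.sampleCovW h ω - S.covW h) +
        4 * (8 * (z ^ 3 / c ^ 2) + 4 * (z ^ 4 / c ^ 4)) * (((p : ℝ) * q) ^ 2 / T) := by
    intro h hh
    have hTh' : 2 * h ≤ T := by
      have := (Finset.mem_Icc.1 hh).2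
      omega
    have e : S.covWhat h ω - S.covW h = (S.sampleCovW h ω - S.covW h) -
        sampleLagCov T h (fun t => (D * S.X t ω).vec) (fun t => (S.W t ω).vec) -
        sampleLagCov T h (fun t => (S.W t ω).vec) (fun t => (D * S.X t ω).vec) +
        sampleLagCov T h (fun t => (D * S.X t ω).vec) (fun t => (D * S.X t ω).vec) := by
      rw [covWhat, sampleLagCov_sub_sub (f := fun t => (S.W t ω).vec)
        (y := fun t => (D * S.X t ω).vec), sampleCovW]
      · abel
      · intro t ht
        rw [S.What_eq ht]
        rfl
    rw [e]
    refine (frobSq_add_four_le _ _ _ _).trans ?_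
    have b1 := frobSq_sampleLagCov_le hTh' hT (fun t => (D * S.X t ω).vec)
      (fun t => (S.W t ω).vec)
    have b2 := frobSq_sampleLagCov_le hTh' hT (fun t => (S.W t ω).vec)
      (fun t => (D * S.X t ω).vec)
    have b3 := frobSq_sampleLagCov_le hTh' hT (fun t => (D * S.X t ω).vec)
      (fun t => (D * S.X t ω).vec)
    rw [hEw, ← hEy] at b1 b2
    rw [← hEy] at b3
    rw [mul_comm (S.energyW ω)] at b2
    linarith
  refine (Finset.sum_le_sum hlag).trans ?_
  rw [Finset.sum_add_distrib, ← Finset.mul_sum, Finset.sum_const, Nat.card_Icc,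
    Nat.add_sub_cancel, nsmul_eq_mul]
  linarith

end Model

/-! ### Moments of sums and integrals of averages. -/

theorem AbsMomentLE.mono {Ω : Type*} [MeasurableSpace Ω] {P : Measure Ω} {f : Ω → ℝ} {s K K' : ℝ}
    (h : AbsMomentLE P f s K) (hK : K ≤ K') : AbsMomentLE P f s K' :=
  ⟨h.1, h.2.trans hK⟩

theorem AbsMomentLE.of_abs_le_sum {Ω ι : Type*} [Fintype ι] [MeasurableSpace Ω] {P : Measure Ω}
    {f : Ω → ℝ} {g : ι → Ω → ℝ} {s K : ℝ} (hs : 1 ≤ s) (hf : Measurable f)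
    (hg : ∀ i, AbsMomentLE P (g i) s K) (hfg : ∀ ω, |f ω| ≤ ∑ i, |g i ω|) :
    AbsMomentLE P f s ((Fintype.card ι : ℝ) ^ (s - 1) * (Fintype.card ι * K)) := by
  have hle : ∀ ω, |f ω| ^ s ≤ (Fintype.card ι : ℝ) ^ (s - 1) * ∑ i, |g i ω| ^ s := fun ω =>
    (Real.rpow_le_rpow (abs_nonneg _) (hfg ω) (by linarith)).trans
      (Real.rpow_sum_le_const_mul_sum_rpow Finset.univ (fun i => g i ω) hs)
  have hgi : Integrable (fun ω => (Fintype.card ι : ℝ) ^ (s - 1) * ∑ i, |g i ω| ^ s) P :=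
    (integrable_finsetSum _ fun i _ => (hg i).1).const_mul _
  have hfi : Integrable (fun ω => |f ω| ^ s) P := by
    refine hgi.mono' (hf.abs.pow_const s).aestronglyMeasurable (ae_of_all _ fun ω => ?_)
    rw [Real.norm_eq_abs, abs_of_nonneg (Real.rpow_nonneg (abs_nonneg _) _)]
    exact hle ω
  refine ⟨hfi, (integral_mono hfi hgi hle).trans ?_⟩
  rw [integral_const_mul, integral_finsetSum _ fun i _ => (hg i).1]
  refine mul_le_mul_of_nonneg_left ?_ (by positivity)
  calc ∑ i, ∫ ω, |g i ω| ^ s ∂P ≤ ∑ _i : ι, K := Finset.sum_le_sum fun i _ => (hg i).2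
    _ = _ := by simp

theorem integral_average_frobSq_le {Ω : Type*} [MeasurableSpace Ω] {P : Measure Ω} {a b T : ℕ} (hT : 0 < T)
   
    (B : ℤ → Ω → Matrix (Fin a) (Fin b) ℝ) (c : Fin a → Fin b → ℝ)
    (hB : ∀ t ∈ Set.Icc (1 : ℤ) T, ∀ u i, MemLp (fun ω => B t ω u i) 2 P)
    (hc : ∀ t ∈ Set.Icc (1 : ℤ) T, ∀ u i, ∫ ω, B t ω u i ^ 2 ∂P ≤ c u i) :
    Integrable (fun ω => 1 / (T : ℝ) * ∑ t ∈ Finset.Icc (1 : ℤ) T, frobSq (B t ω)) P ∧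
    ∫ ω, 1 / (T : ℝ) * ∑ t ∈ Finset.Icc (1 : ℤ) T, frobSq (B t ω) ∂P ≤ ∑ u, ∑ i, c u i := by
  have hi : ∀ t ∈ Finset.Icc (1 : ℤ) T, ∀ u, Integrable (fun ω => ∑ i, B t ω u i ^ 2) P :=
    fun t ht u => integrable_finsetSum _ fun i _ => (hB t (Finset.mem_Icc.1 ht) u i).integrable_sq
  have hi' : ∀ t ∈ Finset.Icc (1 : ℤ) T, Integrable (fun ω => frobSq (B t ω)) P :=
    fun t ht => integrable_finsetSum _ fun u _ => hi t ht u
  refine ⟨(integrable_finsetSum _ hi').const_mul _, ?_⟩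
  rw [integral_const_mul, integral_finsetSum _ hi']
  have hT' : (0 : ℝ) < T := by exact_mod_cast hT
  calc 1 / (T : ℝ) * ∑ t ∈ Finset.Icc (1 : ℤ) T, ∫ ω, frobSq (B t ω) ∂P
      ≤ 1 / (T : ℝ) * ∑ t ∈ Finset.Icc (1 : ℤ) T, ∑ u, ∑ i, c u i := by
        gcongr with t ht
        simp only [frobSq]
        rw [integral_finsetSum _ fun u _ => hi t ht u]
        refine Finset.sum_le_sum fun u _ => ?_
        rw [integral_finsetSum _ fun i _ => (hB t (Finset.mem_Icc.1 ht) u i).integrable_sq]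
        exact Finset.sum_le_sum fun i _ => hc t (Finset.mem_Icc.1 ht) u i
    _ = _ := by
        rw [Finset.sum_const, Int.card_Icc, nsmul_eq_mul]
        simp only [add_sub_cancel_right, Int.toNat_natCast]
        field_simp

theorem integral_add_five {Ω : Type*} [MeasurableSpace Ω] {P : Measure Ω}
    {f₁ f₂ f₃ f₄ f₅ : Ω → ℝ} (h₁ : Integrable f₁ P) (h₂ : Integrable f₂ P) (h₃ : Integrable f₃ P)
    (h₄ : Integrable f₄ P) (h₅ : Integrable f₅ P) :
    Integrable (fun ω => f₁ ω + f₂ ω + f₃ ω + f₄ ω + f₅ ω) P ∧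
    ∫ ω, (f₁ ω + f₂ ω + f₃ ω + f₄ ω + f₅ ω) ∂P =
      ∫ ω, f₁ ω ∂P + ∫ ω, f₂ ω ∂P + ∫ ω, f₃ ω ∂P + ∫ ω, f₄ ω ∂P + ∫ ω, f₅ ω ∂P := by
  have h12 : Integrable (fun ω => f₁ ω + f₂ ω) P := h₁.add h₂
  have h123 : Integrable (fun ω => f₁ ω + f₂ ω + f₃ ω) P := h12.add h₃
  have h1234 : Integrable (fun ω => f₁ ω + f₂ ω + f₃ ω + f₄ ω) P := h123.add h₄
  refine ⟨h1234.add h₅, ?_⟩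
  rw [integral_add h1234 h₅, integral_add h123 h₄, integral_add h12 h₃, integral_add h₁ h₂]

/-! ### The mean of the error statistic. -/

namespace Model

variable {p q m k r T : ℕ} {Ω : Type*} [MeasurableSpace Ω] {P : Measure Ω}
  (S : Model p q m k r T P)

theorem lagConst_mono {h h' : ℕ} {K D : ℝ} (hh : h ≤ h') (hK : 0 ≤ K) :
    lagConst h K D ≤ lagConst h' K D := by
  unfold lagConst
  gcongr

/-- Weights for which the entries of `W_t` have moments of constant order. -/
def weightW (u : Fin p) (i : Fin q) : ℝ := 1 + (∑ a, |S.R u a|) * ∑ b, |S.C i b|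

theorem weightW_pos (u : Fin p) (i : Fin q) : 0 < S.weightW u i := by
  unfold weightW
  positivity

/-- Single loadings need not be bounded, so neither need the moments of single entries of W_t; only
the total of the squared weights is controlled. It splits by (1 + x)² ≤ 2 + 2x² into a product of
row sums of R and of C. -/
theorem sum_weightW_sq_le : ∑ u, ∑ i, S.weightW u i ^ 2 ≤
    2 * ((p : ℝ) * q) + 2 * ((k ^ 2 * specNorm S.R ^ 2) * (r ^ 2 * specNorm S.C ^ 2)) := by
  have hrow : ∀ {a d : ℕ} (A : Matrix (Fin a) (Fin d) ℝ),
      ∑ u, (∑ j, |A u j|) ^ 2 ≤ d ^ 2 * specNorm A ^ 2 := by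
    intro a d A
    have h1 : ∀ u, (∑ j, |A u j|) ^ 2 ≤ d * ∑ j, A u j ^ 2 := fun u => by
      simpa using sq_sum_le_card_mul_sum_sq (s := Finset.univ) (f := fun j => |A u j|)
    have h2 := frobSq_le_card_mul_specNorm_sq A
    rw [Fintype.card_fin] at h2
    calc _ ≤ ∑ u, d * ∑ j, A u j ^ 2 := Finset.sum_le_sum fun u _ => h1 u
      _ = d * frobSq A := by rw [← Finset.mul_sum, frobSq]
      _ ≤ d * (d * specNorm A ^ 2) := by gcongr
      _ = _ := by ring
  calc ∑ u, ∑ i, S.weightW u i ^ 2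
      ≤ ∑ u, ∑ i, (2 + 2 * ((∑ a, |S.R u a|) ^ 2 * (∑ b, |S.C i b|) ^ 2)) := by
        refine Finset.sum_le_sum fun u _ => Finset.sum_le_sum fun i _ => ?_
        unfold weightW
        nlinarith [sq_nonneg (1 - (∑ a, |S.R u a|) * ∑ b, |S.C i b|)]
    _ = 2 * ((p : ℝ) * q) + 2 * ((∑ u, (∑ a, |S.R u a|) ^ 2) * ∑ i, (∑ b, |S.C i b|) ^ 2) := by
        simp only [Finset.sum_add_distrib, ← Finset.mul_sum, Finset.sum_const, Finset.card_univ,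
          Fintype.card_fin, nsmul_eq_mul, ← Finset.sum_mul]
        ring
    _ ≤ _ := by
        have h1 := hrow S.R
        have h2 := hrow S.C
        gcongr

theorem observedSeries_X {s K : ℝ} (hX : ∀ t ∈ Set.Icc (1 : ℤ) T, ∀ l i,
    AbsMomentLE P (fun ω => S.X t ω l i) s K) (l : Fin m) (i : Fin q) :
    S.ObservedSeries (fun t ω => S.X t ω l i) s K :=
  ⟨fun t _ => S.measurable_X_sigmaField t l i, fun t ht => hX t ht l i⟩

/-- The errors are not among the generators of the σ-field, but within the window W_t = Y_t - A X_t.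
-/
theorem measurable_W_sigmaField {t : ℤ} (ht : t ∈ Set.Icc (1 : ℤ) T) (u : Fin p) (i : Fin q) :
    Measurable[S.sigmaField {t}] fun ω => S.W t ω u i := by
  have e : (fun ω => S.W t ω u i) = fun ω => S.Y t ω u i - ∑ l, S.A u l * S.X t ω l i := by
    ext ω
    rw [S.Y_eq ht, Matrix.add_apply, Matrix.mul_apply]
    ring
  rw [e]
  exact (S.measurable_Y_sigmaField t u i).sub (Finset.measurable_sum _ fun l _ =>
    (S.measurable_X_sigmaField t l i).const_mul _)

theorem observedSeries_W {s K : ℝ} (hs : 1 ≤ s)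
    (hF : ∀ t ∈ Set.Icc (1 : ℤ) T, ∀ i j, AbsMomentLE P (fun ω => S.F t ω i j) s K)
    (hE : ∀ t ∈ Set.Icc (1 : ℤ) T, ∀ i j, AbsMomentLE P (fun ω => S.E t ω i j) s K)
    (u : Fin p) (i : Fin q) :
    S.ObservedSeries (fun t ω => S.W t ω u i / S.weightW u i) s
      (((r * k + 1 : ℕ) : ℝ) ^ (s - 1) * ((r * k + 1 : ℕ) * K)) := by
  have hw := S.weightW_pos u i
  refine ⟨fun t ht => (S.measurable_W_sigmaField ht u i).div_const _, fun t ht => ?_⟩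
  -- There are rk + 1 summands: `none` stands for the error entry, `some x` for a factor entry.
  have h := AbsMomentLE.of_abs_le_sum (P := P) (ι := Option (Fin r × Fin k))
    (f := fun ω => S.W t ω u i / S.weightW u i)
    (g := fun o ω => o.elim (S.E t ω u i) fun x => S.F t ω x.2 x.1) (K := K) hs
    (((S.measurable_W_sigmaField ht u i).mono (S.sigmaField_le _) le_rfl).div_const _)
    (fun o => by
      cases o with
      | none => exact hE t ht u i
      | some x => exact hF t ht x.2 x.1)
    (fun ω => by
      rw [abs_div, abs_of_pos hw, div_le_iff₀ hw, S.W_apply, Fintype.sum_option, add_comm]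
      refine (abs_add_le _ _).trans ?_
      simp only [Option.elim_none, Option.elim_some]
      rw [add_mul]
      refine add_le_add ?_ ((Finset.abs_sum_le_sum_abs _ _).trans ?_)
      · refine le_mul_of_one_le_right (abs_nonneg _) ?_
        unfold weightW
        have : 0 ≤ (∑ a, |S.R u a|) * ∑ b, |S.C i b| := by positivity
        linarith
      · rw [Finset.sum_mul]
        refine Finset.sum_le_sum fun x _ => ?_
        rw [abs_mul, abs_mul, mul_comm]
        refine mul_le_mul_of_nonneg_left ?_ (abs_nonneg _)
        have h1 : |S.C i x.1| ≤ ∑ b, |S.C i b| :=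
          Finset.single_le_sum (f := fun b => |S.C i b|) (fun _ _ => abs_nonneg _)
            (Finset.mem_univ _)
        have h2 : |S.R u x.2| ≤ ∑ a, |S.R u a| :=
          Finset.single_le_sum (f := fun a => |S.R u a|) (fun _ _ => abs_nonneg _)
            (Finset.mem_univ _)
        unfold weightW
        have h3 : |S.C i x.1| * |S.R u x.2| ≤ (∑ b, |S.C i b|) * ∑ a, |S.R u a| :=
          mul_le_mul h1 h2 (abs_nonneg _) (by positivity)
        linarith)
  simpa using h

theorem memLp_W {t : ℤ} (ht : t ∈ Set.Icc (1 : ℤ) T) (u : Fin p) (i : Fin q) :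
    MemLp (fun ω => S.W t ω u i) 2 P := by
  simp only [W_apply]
  exact (memLp_finsetSum _ fun x _ => (S.memLp_F t ht _ _).const_mul _).add (S.memLp_E t ht u i)

variable [IsProbabilityMeasure P]

theorem integral_W {t : ℤ} (ht : t ∈ Set.Icc (1 : ℤ) T) (u : Fin p) (i : Fin q) :
    ∫ ω, S.W t ω u i ∂P = 0 := by
  have hF : ∀ x : Fin r × Fin k, Integrable
      (fun ω => (S.C i x.1 * S.R u x.2) * S.F t ω x.2 x.1) P := fun x =>
    ((S.memLp_F t ht _ _).integrable one_le_two).const_mul _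
  simp only [W_apply]
  rw [integral_add (integrable_finsetSum _ fun x _ => hF x)
    ((S.memLp_E t ht u i).integrable one_le_two), integral_finsetSum _ fun x _ => hF x,
    S.mean_E t ht]
  simp only [integral_const_mul, S.mean_F t ht, mul_zero, Finset.sum_const_zero, add_zero]

/-- W_t is uncorrelated with X_t and centred, so the product has mean zero even when X_t is not
centred. -/
theorem integral_W_mul_X {t : ℤ} (ht : t ∈ Set.Icc (1 : ℤ) T) (u : Fin p) (i : Fin q)
    (l : Fin m) (j : Fin q) : ∫ ω, S.W t ω u i * S.X t ω l j ∂P = 0 := by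
  have hEX : covariance (fun ω => S.E t ω u i) (fun ω => S.X t ω l j) P = 0 :=
    congrFun (congrFun (S.uncorr_E_X t ht) (i, u)) (j, l)
  have hXF : ∀ a b, covariance (fun ω => S.X t ω l j) (fun ω => S.F t ω a b) P = 0 := fun a b =>
    congrFun (congrFun (S.uncorr_X_F t ht) (j, l)) (b, a)
  have hF : ∀ x : Fin r × Fin k, MemLp
      (fun ω => (S.C i x.1 * S.R u x.2) * S.F t ω x.2 x.1) 2 P := fun x =>
    (S.memLp_F t ht _ _).const_mul _
  have h1 : covariance (fun ω => S.W t ω u i) (fun ω => S.X t ω l j) P = 0 := by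
    simp only [W_apply]
    rw [covariance_fun_add_left (memLp_finsetSum _ fun x _ => hF x) (S.memLp_E t ht u i)
      (S.memLp_X t ht l j), covariance_fun_sum_left hF (S.memLp_X t ht l j), hEX]
    simp only [covariance_const_mul_left]
    simp only [covariance_comm _ (fun ω => S.X t ω l j), hXF, mul_zero, Finset.sum_const_zero,
      add_zero]
  rw [covariance_eq_sub (S.memLp_W ht u i) (S.memLp_X t ht l j), S.integral_W ht, zero_mul,
    sub_zero] at h1
  exact h1

variable {S}

theorem ObservedSeries.integral_sq_lag_scaled_le {f g : ℤ → Ω → ℝ} {γ K D a b : ℝ} (hγ : 2 < γ)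
    (ha : 0 < a) (hb : 0 < b) (hf : S.ObservedSeries (fun t ω => f t ω / a) (2 * γ) K)
    (hg : S.ObservedSeries (fun t ω => g t ω / b) (2 * γ) K)
    (hsum : Summable fun d : ℕ => S.mixing (d + 1) ^ (1 - 2 / γ))
    (hD : ∑' d : ℕ, S.mixing (d + 1) ^ (1 - 2 / γ) ≤ D) (h : ℕ) (hT : h < T) :
    MemLp (fun ω => 1 / ((T : ℝ) - h) * ∑ t ∈ Finset.Icc (1 : ℤ) ((T : ℤ) - h),
      (f t ω * g (t + h) ω - ∫ ω, f t ω * g (t + h) ω ∂P)) 2 P ∧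
    ∫ ω, (1 / ((T : ℝ) - h) * ∑ t ∈ Finset.Icc (1 : ℤ) ((T : ℤ) - h),
      (f t ω * g (t + h) ω - ∫ ω, f t ω * g (t + h) ω ∂P)) ^ 2 ∂P ≤
      a ^ 2 * b ^ 2 * (lagConst h K D / ((T : ℝ) - h)) := by
  obtain ⟨h1, h2⟩ := hf.integral_sq_lag_le hγ hg hsum hD h hT
  have e : ∀ ω, 1 / ((T : ℝ) - h) * ∑ t ∈ Finset.Icc (1 : ℤ) ((T : ℤ) - h),
      (f t ω * g (t + h) ω - ∫ ω, f t ω * g (t + h) ω ∂P) =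
      (a * b) * (1 / ((T : ℝ) - h) * ∑ t ∈ Finset.Icc (1 : ℤ) ((T : ℤ) - h),
      (f t ω / a * (g (t + h) ω / b) - ∫ ω, f t ω / a * (g (t + h) ω / b) ∂P)) := by
    intro ω
    have e1 : ∀ t ω, f t ω * g (t + h) ω = (a * b) * (f t ω / a * (g (t + h) ω / b)) := by
      intro t ω
      field_simp
    simp only [e1, integral_const_mul, ← mul_sub, ← Finset.mul_sum]
    ring
  simp only [e]
  refine ⟨h1.const_mul _, ?_⟩
  simp only [mul_pow (a * b)]
  rw [integral_const_mul, mul_pow]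
  gcongr

variable (S)

/-- Mean square error of cross products between an observed matrix series and `X`. -/
theorem integral_frobSq_cross_le {d : ℕ} {γ K D : ℝ} (hγ : 2 < γ)
    (B : ℤ → Ω → Matrix (Fin d) (Fin q) ℝ) (c : Fin d → Fin q → ℝ) (hc : ∀ u i, 0 < c u i)
    (hB : ∀ u i, S.ObservedSeries (fun t ω => B t ω u i / c u i) (2 * γ) K)
    (hX : ∀ l i, S.ObservedSeries (fun t ω => S.X t ω l i) (2 * γ) K)
    (hsum : Summable fun d : ℕ => S.mixing (d + 1) ^ (1 - 2 / γ))
    (hD : ∑' d : ℕ, S.mixing (d + 1) ^ (1 - 2 / γ) ≤ D) (hT : 0 < T) :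
    Integrable (fun ω => ∑ u, ∑ l, (∑ i, 1 / (T : ℝ) * ∑ t ∈ Finset.Icc (1 : ℤ) T,
      (B t ω u i * S.X t ω l i - ∫ ω, B t ω u i * S.X t ω l i ∂P)) ^ 2) P ∧
    ∫ ω, ∑ u, ∑ l, (∑ i, 1 / (T : ℝ) * ∑ t ∈ Finset.Icc (1 : ℤ) T,
      (B t ω u i * S.X t ω l i - ∫ ω, B t ω u i * S.X t ω l i ∂P)) ^ 2 ∂P ≤
      q * (m * ∑ u, ∑ i, c u i ^ 2) * (lagConst 0 K D / T) := by
  have hentry : ∀ u l i, MemLp (fun ω => 1 / (T : ℝ) * ∑ t ∈ Finset.Icc (1 : ℤ) T,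
      (B t ω u i * S.X t ω l i - ∫ ω, B t ω u i * S.X t ω l i ∂P)) 2 P ∧
      ∫ ω, (1 / (T : ℝ) * ∑ t ∈ Finset.Icc (1 : ℤ) T,
      (B t ω u i * S.X t ω l i - ∫ ω, B t ω u i * S.X t ω l i ∂P)) ^ 2 ∂P ≤
      c u i ^ 2 * (lagConst 0 K D / T) := by
    intro u l i
    have := (hB u i).integral_sq_lag_scaled_le hγ (hc u i) one_pos
      (g := fun t ω => S.X t ω l i) (by simpa using hX l i) hsum hD 0 hT
    simpa using this
  set Z : Fin d → Fin m → Fin q → Ω → ℝ := fun u l i ω =>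
    1 / (T : ℝ) * ∑ t ∈ Finset.Icc (1 : ℤ) T,
      (B t ω u i * S.X t ω l i - ∫ ω, B t ω u i * S.X t ω l i ∂P) with hZ
  have hZsq : ∀ u l, Integrable (fun ω => (∑ i, Z u l i ω) ^ 2) P := fun u l =>
    (memLp_finsetSum _ fun i _ => (hentry u l i).1).integrable_sq
  refine ⟨integrable_finsetSum _ fun u _ => integrable_finsetSum _ fun l _ => hZsq u l, ?_⟩
  change ∫ ω, ∑ u, ∑ l, (∑ i, Z u l i ω) ^ 2 ∂P ≤ _
  rw [integral_finsetSum _ fun u _ => integrable_finsetSum _ fun l _ => hZsq u l]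
  calc ∑ u, ∫ ω, ∑ l, (∑ i, Z u l i ω) ^ 2 ∂P
      = ∑ u, ∑ l, ∫ ω, (∑ i, Z u l i ω) ^ 2 ∂P := by
        refine Finset.sum_congr rfl fun u _ => ?_
        rw [integral_finsetSum _ fun l _ => hZsq u l]
    -- The q columns may be arbitrarily dependent, so Cauchy-Schwarz over them costs a factor q.
    _ ≤ ∑ u, ∑ _l : Fin m, q * ∑ i, c u i ^ 2 * (lagConst 0 K D / T) := by
        refine Finset.sum_le_sum fun u _ => Finset.sum_le_sum fun l _ => ?_
        have hi : ∀ i, Integrable (fun ω => Z u l i ω ^ 2) P := fun i =>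
          (hentry u l i).1.integrable_sq
        calc ∫ ω, (∑ i, Z u l i ω) ^ 2 ∂P ≤ ∫ ω, q * ∑ i, Z u l i ω ^ 2 ∂P := by
              refine integral_mono (hZsq u l)
                ((integrable_finsetSum _ fun i _ => hi i).const_mul _) fun ω => ?_
              simpa using sq_sum_le_card_mul_sum_sq (s := Finset.univ) (f := fun i => Z u l i ω)
          _ = q * ∑ i, ∫ ω, Z u l i ω ^ 2 ∂P := by
              rw [integral_const_mul, integral_finsetSum _ fun i _ => hi i]
          _ ≤ _ := by
              gcongr with i
              exact (hentry u l i).2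
    _ = _ := by
        simp only [← Finset.sum_mul, ← Finset.mul_sum, Finset.sum_const, Finset.card_univ,
          Fintype.card_fin, nsmul_eq_mul]
        ring

theorem integral_frobSq_crossWX_le {γ K D : ℝ} (hγ : 2 < γ)
    (hW : ∀ u i, S.ObservedSeries (fun t ω => S.W t ω u i / S.weightW u i) (2 * γ) K)
    (hX : ∀ l i, S.ObservedSeries (fun t ω => S.X t ω l i) (2 * γ) K)
    (hsum : Summable fun d : ℕ => S.mixing (d + 1) ^ (1 - 2 / γ))
    (hD : ∑' d : ℕ, S.mixing (d + 1) ^ (1 - 2 / γ) ≤ D) (hT : 0 < T) :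
    Integrable (fun ω => frobSq (S.crossWX ω)) P ∧ ∫ ω, frobSq (S.crossWX ω) ∂P ≤
      q * (m * ∑ u, ∑ i, S.weightW u i ^ 2) * (lagConst 0 K D / T) := by
  have e : ∀ ω, frobSq (S.crossWX ω) = ∑ u, ∑ l, (∑ i, 1 / (T : ℝ) *
      ∑ t ∈ Finset.Icc (1 : ℤ) T,
      (S.W t ω u i * S.X t ω l i - ∫ ω, S.W t ω u i * S.X t ω l i ∂P)) ^ 2 := by
    intro ω
    refine Finset.sum_congr rfl fun u _ => Finset.sum_congr rfl fun l _ => ?_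
    congr 1
    rw [crossWX, Matrix.smul_apply, Matrix.sum_apply, smul_eq_mul, ← Finset.mul_sum,
      Finset.sum_comm]
    congr 1
    refine Finset.sum_congr rfl fun t ht => ?_
    rw [Matrix.mul_apply]
    refine Finset.sum_congr rfl fun i _ => ?_
    rw [S.integral_W_mul_X (Finset.mem_Icc.1 ht), sub_zero, Matrix.transpose_apply]
  simp only [e]
  exact S.integral_frobSq_cross_le hγ S.W S.weightW S.weightW_pos hW hX hsum hD hT

theorem integral_frobSq_gramX_sub_le {γ K D : ℝ} (hγ : 2 < γ)
    (hX : ∀ l i, S.ObservedSeries (fun t ω => S.X t ω l i) (2 * γ) K)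
    (hsum : Summable fun d : ℕ => S.mixing (d + 1) ^ (1 - 2 / γ))
    (hD : ∑' d : ℕ, S.mixing (d + 1) ^ (1 - 2 / γ) ≤ D) (hT : 0 < T) :
    Integrable (fun ω => frobSq (S.gramX ω - S.meanGramX)) P ∧
    ∫ ω, frobSq (S.gramX ω - S.meanGramX) ∂P ≤
      q * (m * (m * q)) * (lagConst 0 K D / T) := by
  have e : ∀ ω, frobSq (S.gramX ω - S.meanGramX) = ∑ u, ∑ l, (∑ i, 1 / (T : ℝ) *
      ∑ t ∈ Finset.Icc (1 : ℤ) T,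
      (S.X t ω u i * S.X t ω l i - ∫ ω, S.X t ω u i * S.X t ω l i ∂P)) ^ 2 := by
    intro ω
    refine Finset.sum_congr rfl fun u _ => Finset.sum_congr rfl fun l _ => ?_
    congr 1
    rw [gramX, meanGramX, Matrix.sub_apply, Matrix.smul_apply, Matrix.smul_apply,
      Matrix.sum_apply, Matrix.sum_apply, smul_eq_mul, smul_eq_mul, ← mul_sub,
      ← Finset.mul_sum, Finset.sum_comm, ← Finset.sum_sub_distrib]
    congr 1
    refine Finset.sum_congr rfl fun t ht => ?_
    have ht' := Finset.mem_Icc.1 ht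
    simp only [secondMomentX, Matrix.of_apply, Matrix.mul_apply, Matrix.transpose_apply]
    have hi : ∀ i, Integrable (fun ω => S.X t ω u i * S.X t ω l i) P := fun i =>
      (S.memLp_X t ht' u i).integrable_mul (S.memLp_X t ht' l i)
    rw [integral_finsetSum _ fun i _ => hi i, Finset.sum_sub_distrib]
  simp only [e]
  have := S.integral_frobSq_cross_le hγ S.X (fun _ _ => 1) (fun _ _ => one_pos)
    (by simpa using hX) hX hsum hD hT
  refine ⟨this.1, this.2.trans (le_of_eq ?_)⟩
  simp

theorem integral_frobSq_sampleCovW_sub_le {γ K D : ℝ} (hγ : 2 < γ)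
    (hW : ∀ u i, S.ObservedSeries (fun t ω => S.W t ω u i / S.weightW u i) (2 * γ) K)
    (hsum : Summable fun d : ℕ => S.mixing (d + 1) ^ (1 - 2 / γ))
    (hD : ∑' d : ℕ, S.mixing (d + 1) ^ (1 - 2 / γ) ≤ D) (h : ℕ) (hT : h < T) :
    Integrable (fun ω => frobSq (S.sampleCovW h ω - S.covW h)) P ∧
    ∫ ω, frobSq (S.sampleCovW h ω - S.covW h) ∂P ≤
      (∑ u, ∑ i, S.weightW u i ^ 2) ^ 2 * (lagConst h K D / ((T : ℝ) - h)) := by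
  have e : ∀ ω x y, (S.sampleCovW h ω - S.covW h) x y =
      1 / ((T : ℝ) - h) * ∑ t ∈ Finset.Icc (1 : ℤ) ((T : ℤ) - h),
      (S.W t ω x.2 x.1 * S.W (t + h) ω y.2 y.1 -
        ∫ ω, S.W t ω x.2 x.1 * S.W (t + h) ω y.2 y.1 ∂P) := by
    intro ω x y
    rw [Matrix.sub_apply, sampleCovW, covW, sampleLagCov_apply, avgLagCov_apply, ← mul_sub,
      ← Finset.sum_sub_distrib]
    congr 1
    refine Finset.sum_congr rfl fun t ht => ?_
    rw [Finset.mem_Icc] at ht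
    have h1 : t ∈ Set.Icc (1 : ℤ) T := ⟨by omega, by omega⟩
    have h2 : t + h ∈ Set.Icc (1 : ℤ) T := ⟨by omega, by omega⟩
    have h3 := covariance_eq_sub (S.memLp_W h1 x.2 x.1) (S.memLp_W h2 y.2 y.1)
    rw [S.integral_W h1, zero_mul, sub_zero] at h3
    exact congrArg₂ _ rfl h3
  have hentry := fun x y : Fin q × Fin p =>
    (hW x.2 x.1).integral_sq_lag_scaled_le hγ (S.weightW_pos x.2 x.1) (S.weightW_pos y.2 y.1)
      (hW y.2 y.1) hsum hD h hT
  simp only [frobSq, e]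
  refine ⟨integrable_finsetSum _ fun x _ => integrable_finsetSum _ fun y _ =>
    (hentry x y).1.integrable_sq, ?_⟩
  rw [integral_finsetSum _ fun x _ => integrable_finsetSum _ fun y _ =>
    (hentry x y).1.integrable_sq]
  have hw : ∑ u, ∑ i, S.weightW u i ^ 2 = ∑ x : Fin q × Fin p, S.weightW x.2 x.1 ^ 2 := by
    rw [Fintype.sum_prod_type, Finset.sum_comm]
  calc _ ≤ ∑ x : Fin q × Fin p, ∑ y : Fin q × Fin p, S.weightW x.2 x.1 ^ 2 *
        S.weightW y.2 y.1 ^ 2 * (lagConst h K D / ((T : ℝ) - h)) := by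
        refine Finset.sum_le_sum fun x _ => ?_
        rw [integral_finsetSum _ fun y _ => (hentry x y).1.integrable_sq]
        exact Finset.sum_le_sum fun y _ => (hentry x y).2
    _ = _ := by
        rw [hw, sq (∑ x : Fin q × Fin p, _), Finset.sum_mul_sum]
        simp only [Finset.sum_mul]

/-- The error statistic has bounded mean. -/
theorem integral_errorStat_le {h₀ : ℕ} {γ K D L : ℝ} (hγ : 2 < γ)
    (hp : 0 < p) (hq : 0 < q) (hT : 0 < T) (hTh : 2 * h₀ ≤ T)
    (hW : ∀ u i, S.ObservedSeries (fun t ω => S.W t ω u i / S.weightW u i) (2 * γ) K)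
    (hX : ∀ l i, S.ObservedSeries (fun t ω => S.X t ω l i) (2 * γ) K) (hK : 0 ≤ K)
    (hsum : Summable fun d : ℕ => S.mixing (d + 1) ^ (1 - 2 / γ))
    (hD : ∑' d : ℕ, S.mixing (d + 1) ^ (1 - 2 / γ) ≤ D)
    (hL : ∑ u, ∑ i, S.weightW u i ^ 2 ≤ L * (p * q)) :
    Integrable (S.errorStat h₀) P ∧ ∫ ω, S.errorStat h₀ ω ∂P ≤
      2 * h₀ * L ^ 2 * lagConst h₀ K D + m * L * lagConst 0 K D + m ^ 2 * lagConst 0 K D +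
        m * (1 + K) + L * (1 + K) := by
  have hp' : (0 : ℝ) < p := by exact_mod_cast hp
  have hq' : (0 : ℝ) < q := by exact_mod_cast hq
  have hT' : (0 : ℝ) < T := by exact_mod_cast hT
  have hD0 : 0 ≤ D := (tsum_nonneg fun d => Real.rpow_nonneg (S.mixing_nonneg _) _).trans hD
  have hlag : ∀ h, 0 ≤ lagConst h K D := fun h => by unfold lagConst; positivity
  set Λ := ∑ u, ∑ i, S.weightW u i ^ 2 with hΛ
  have hΛ0 : 0 ≤ Λ := by positivity
  have hhT : ∀ h ∈ Finset.Icc 1 h₀, h < T := fun h hh => by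
    have := Finset.mem_Icc.1 hh
    omega
  have hcov := fun h (hh : h ∈ Finset.Icc 1 h₀) =>
    S.integral_frobSq_sampleCovW_sub_le hγ hW hsum hD h (hhT h hh)
  obtain ⟨c1, c2⟩ := S.integral_frobSq_crossWX_le hγ hW hX hsum hD hT
  obtain ⟨g1, g2⟩ := S.integral_frobSq_gramX_sub_le hγ hX hsum hD hT
  have hγ2 : (2 : ℝ) ≤ 2 * γ := by linarith
  obtain ⟨x1, x2⟩ := integral_average_frobSq_le hT S.X (fun _ _ => 1 + K)
    S.memLp_X fun t ht l i => ((hX l i).moment t ht).integral_sq_le hγ2 ((hX l i).measurable' ht)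
  obtain ⟨w1, w2⟩ := integral_average_frobSq_le hT S.W (fun u i => S.weightW u i ^ 2 * (1 + K))
    (fun t ht u i => S.memLp_W ht u i) fun t ht u i => by
      have h := ((hW u i).moment t ht).integral_sq_le hγ2 ((hW u i).measurable' ht)
      have hw := S.weightW_pos u i
      simp only [div_pow, integral_div] at h
      rw [div_le_iff₀ (by positivity)] at h
      linarith
  have hcovi : Integrable (fun ω => ∑ h ∈ Finset.Icc 1 h₀, frobSq (S.sampleCovW h ω - S.covW h))
      P := integrable_finsetSum _ fun h hh => (hcov h hh).1
  have hcovle : ∫ ω, ∑ h ∈ Finset.Icc 1 h₀, frobSq (S.sampleCovW h ω - S.covW h) ∂P ≤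
      h₀ * (Λ ^ 2 * (lagConst h₀ K D * (2 / T))) := by
    rw [integral_finsetSum _ fun h hh => (hcov h hh).1]
    calc _ ≤ ∑ h ∈ Finset.Icc 1 h₀, Λ ^ 2 * (lagConst h₀ K D * (2 / T)) := by
          refine Finset.sum_le_sum fun h hh => (hcov h hh).2.trans ?_
          have hh' := (Finset.mem_Icc.1 hh).2
          have hTr : (T : ℝ) / 2 ≤ (T : ℝ) - h := by
            have : 2 * (h : ℝ) ≤ T := by exact_mod_cast (by omega : 2 * h ≤ T)
            linarith
          have h3 : 1 / ((T : ℝ) - h) ≤ 2 / T := by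
            calc 1 / ((T : ℝ) - h) ≤ 1 / ((T : ℝ) / 2) :=
                  one_div_le_one_div_of_le (by positivity) hTr
              _ = _ := by field_simp
          rw [div_eq_mul_one_div]
          have h4 := lagConst_mono (D := D) hh' hK
          have h5 := hlag h₀
          have h6 : 0 ≤ 1 / ((T : ℝ) - h) := one_div_nonneg.2 (by linarith)
          gcongr
      _ = _ := by
          rw [Finset.sum_const, Nat.card_Icc, Nat.add_sub_cancel, nsmul_eq_mul]
  have i1 := hcovi.const_mul ((T : ℝ) / ((p : ℝ) * q) ^ 2)
  have i2 := c1.const_mul ((T : ℝ) / ((p : ℝ) * (q : ℝ) ^ 2))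
  have i3 := g1.const_mul ((T : ℝ) / (q : ℝ) ^ 2)
  have i4 : Integrable (fun ω => 1 / (q : ℝ) * S.energyX ω) P := x1.const_mul _
  have i5 : Integrable (fun ω => 1 / ((p : ℝ) * q) * S.energyW ω) P := w1.const_mul _
  obtain ⟨z1, z2⟩ := integral_add_five i1 i2 i3 i4 i5
  refine ⟨z1, ?_⟩
  unfold errorStat
  rw [z2]
  simp only [integral_const_mul]
  have hl0 := hlag 0
  have hlh := hlag h₀
  have b1 : (T : ℝ) / ((p : ℝ) * q) ^ 2 *
      ∫ ω, ∑ h ∈ Finset.Icc 1 h₀, frobSq (S.sampleCovW h ω - S.covW h) ∂P ≤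
      2 * h₀ * L ^ 2 * lagConst h₀ K D := by
    calc _ ≤ (T : ℝ) / ((p : ℝ) * q) ^ 2 *
          (h₀ * ((L * (p * q)) ^ 2 * (lagConst h₀ K D * (2 / T)))) := by
          refine mul_le_mul_of_nonneg_left (hcovle.trans ?_) (by positivity)
          gcongr
      _ = _ := by field_simp
  have b2 : (T : ℝ) / ((p : ℝ) * (q : ℝ) ^ 2) * ∫ ω, frobSq (S.crossWX ω) ∂P ≤
      m * L * lagConst 0 K D := by
    calc _ ≤ (T : ℝ) / ((p : ℝ) * (q : ℝ) ^ 2) *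
          (q * (m * (L * (p * q))) * (lagConst 0 K D / T)) := by
          refine mul_le_mul_of_nonneg_left (c2.trans ?_) (by positivity)
          gcongr
      _ = _ := by field_simp
  have b3 : (T : ℝ) / (q : ℝ) ^ 2 * ∫ ω, frobSq (S.gramX ω - S.meanGramX) ∂P ≤
      m ^ 2 * lagConst 0 K D := by
    calc _ ≤ (T : ℝ) / (q : ℝ) ^ 2 * (q * (m * (m * q)) * (lagConst 0 K D / T)) :=
          mul_le_mul_of_nonneg_left g2 (by positivity)
      _ = _ := by field_simp
  have b4 : 1 / (q : ℝ) * ∫ ω, S.energyX ω ∂P ≤ m * (1 + K) := by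
    calc _ ≤ 1 / (q : ℝ) * ∑ _u : Fin m, ∑ _i : Fin q, (1 + K) :=
          mul_le_mul_of_nonneg_left x2 (by positivity)
      _ = _ := by
          simp only [Finset.sum_const, Finset.card_univ, Fintype.card_fin, nsmul_eq_mul]
          field_simp
  have b5 : 1 / ((p : ℝ) * q) * ∫ ω, S.energyW ω ∂P ≤ L * (1 + K) := by
    calc _ ≤ 1 / ((p : ℝ) * q) * ((L * (p * q)) * (1 + K)) := by
          refine mul_le_mul_of_nonneg_left (w2.trans ?_) (by positivity)
          simp only [← Finset.sum_mul]
          gcongr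
      _ = _ := by field_simp
  linarith

end Model

/-! ### From asymptotic orders and bounded means to explicit bounds. -/

theorem isTheta_bounds {f g : ℕ → ℝ} (h : f =Θ[atTop] g) (hf : ∀ n, 0 ≤ f n) (hg : ∀ n, 0 ≤ g n) :
    ∃ c > 0, ∃ C > 0, ∀ᶠ n in atTop, c * g n ≤ f n ∧ f n ≤ C * g n := by
  obtain ⟨C, hC, h1⟩ := h.1.exists_pos
  obtain ⟨c, hc, h2⟩ := h.2.exists_pos
  refine ⟨1 / c, by positivity, C, hC, ?_⟩
  filter_upwards [h1.bound, h2.bound] with n h3 h4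
  rw [Real.norm_of_nonneg (hf n), Real.norm_of_nonneg (hg n)] at h3 h4
  refine ⟨?_, h3⟩
  rw [div_mul_eq_mul_div, one_mul, div_le_iff₀ hc]
  linarith

theorem eigVal_nonneg_of_posDef {a : ℕ} {M : Matrix (Fin a) (Fin a) ℝ} (hM : M.PosDef) (j : ℕ) :
    0 ≤ eigVal M j := by
  rcases lt_or_ge j a with h | h
  · have h1 := eigVal_eq hM.isHermitian ⟨j, h⟩
    simp only at h1
    rw [h1]
    have h2 := hM.eigenvalues_pos (Fintype.equivOfCardEq (Fintype.card_fin _)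
      (Fin.cast (Fintype.card_fin a).symm ⟨j, h⟩))
    simp only [Matrix.IsHermitian.eigenvalues, Equiv.symm_apply_apply] at h2
    exact h2.le
  · rw [eigVal_of_le M h]

/-- A sequence controlled by a nonnegative statistic of bounded mean is `O_p`. -/
theorem isBigOp_of_bounded_mean {Ω : ℕ → Type*} [∀ n, MeasurableSpace (Ω n)]
    {P : ∀ n, Measure (Ω n)} [∀ n, IsProbabilityMeasure (P n)] {X Z : ∀ n, Ω n → ℝ} {a : ℕ → ℝ}
    (ha : ∀ n, 0 ≤ a n) (hZ0 : ∀ n ω, 0 ≤ Z n ω) {C : ℝ}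
    (hZ : ∀ᶠ n in atTop, Integrable (Z n) (P n) ∧ ∫ ω, Z n ω ∂P n ≤ C)
    (hX : ∀ z, 0 < z → ∃ B, ∀ᶠ n in atTop, ∀ ω, Z n ω ≤ z → |X n ω| ≤ B * a n) :
    IsBigOp P X a := by
  intro ε hε
  -- The Markov threshold: the statistic exceeds z with probability at most ε. Adding 1 keeps z
  -- positive.
  set z := (|C| + 1) / ε with hz
  have hz0 : 0 < z := by positivity
  obtain ⟨B, hB⟩ := hX z hz0
  refine ⟨|B| + 1, by positivity, ?_⟩
  filter_upwards [hZ, hB] with n hn hBn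
  have hsub : {ω | (|B| + 1) * a n < |X n ω|} ⊆ {ω | z ≤ Z n ω} := by
    intro ω hω
    by_contra hlt
    have h1 := hBn ω (not_le.1 hlt).le
    have h2 : B * a n ≤ (|B| + 1) * a n :=
      mul_le_mul_of_nonneg_right (by linarith [le_abs_self B]) (ha n)
    have h3 : (|B| + 1) * a n < |X n ω| := hω
    linarith
  refine (measure_mono hsub).trans ?_
  have hmk := mul_meas_ge_le_integral_of_nonneg (ae_of_all _ (hZ0 n)) hn.1 z
  have hle : (P n).real {ω | z ≤ Z n ω} ≤ ε := by
    have h1 : z * (P n).real {ω | z ≤ Z n ω} ≤ z * ε := by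
      calc _ ≤ C := hmk.trans hn.2
        _ ≤ |C| + 1 := by linarith [le_abs_self C]
        _ = z * ε := by rw [hz]; field_simp
    exact le_of_mul_le_mul_left h1 hz0
  rw [← ofReal_measureReal]
  exact ENNReal.ofReal_le_ofReal hle

/-! ### Uniform bounds along the sequence of models. -/

section Sequence

variable {Ω : ℕ → Type*} [∀ n, MeasurableSpace (Ω n)] {P : ∀ n, Measure (Ω n)}
  {m k r : ℕ} {p q T : ℕ → ℕ}

theorem rate_nonneg (δ₁ δ₂ : ℝ) (n : ℕ) : 0 ≤ rate p q T δ₁ δ₂ n := by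
  unfold rate
  positivity

theorem rate_mul_sq {δ₁ δ₂ : ℝ} {n : ℕ} (hp : 0 < p n) (hq : 0 < q n) (hT : 0 < T n) :
    (rate p q T δ₁ δ₂ n * ((p n : ℝ) ^ (1 - δ₁) * (q n : ℝ) ^ (1 - δ₂))) ^ 2 =
      ((p n : ℝ) * q n) ^ 2 / T n := by
  have hp' : (0 : ℝ) < p n := by exact_mod_cast hp
  have hq' : (0 : ℝ) < q n := by exact_mod_cast hq
  have hT' : (0 : ℝ) < T n := by exact_mod_cast hT
  have e1 : (p n : ℝ) ^ δ₁ * (p n : ℝ) ^ (1 - δ₁) = p n := by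
    rw [← Real.rpow_add hp', add_sub_cancel, Real.rpow_one]
  have e2 : (q n : ℝ) ^ δ₂ * (q n : ℝ) ^ (1 - δ₂) = q n := by
    rw [← Real.rpow_add hq', add_sub_cancel, Real.rpow_one]
  have e3 : ((T n : ℝ) ^ (-(1 / 2) : ℝ)) ^ 2 = 1 / T n := by
    rw [← Real.rpow_natCast, ← Real.rpow_mul hT'.le]
    norm_num
    rw [Real.rpow_neg_one]
  unfold rate
  calc _ = (((p n : ℝ) ^ δ₁ * (p n : ℝ) ^ (1 - δ₁)) *
        ((q n : ℝ) ^ δ₂ * (q n : ℝ) ^ (1 - δ₂))) ^ 2 * ((T n : ℝ) ^ (-(1 / 2) : ℝ)) ^ 2 := by ring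
    _ = _ := by rw [e1, e2, e3]; ring

variable {S : ∀ n, Model (p n) (q n) m k r (T n) (P n)} {δ₁ δ₂ : ℝ}

/-- Since the δ's are nonnegative, p^(1-δ₁) ≤ p and q^(1-δ₂) ≤ q once p, q ≥ 1. -/
theorem LoadingCondition.sum_weightW_sq_le (h : LoadingCondition S δ₁ δ₂)
    (hp : Tendsto p atTop atTop) (hq : Tendsto q atTop atTop) :
    ∃ L, 0 ≤ L ∧ ∀ᶠ n in atTop, ∑ u, ∑ i, (S n).weightW u i ^ 2 ≤ L * ((p n : ℝ) * q n) := by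
  obtain ⟨hδ₁, hδ₂, hR, -, hC, -⟩ := h
  obtain ⟨_, _, A, hA, h1⟩ := isTheta_bounds hR (fun n => sq_nonneg _) (fun n => by positivity)
  obtain ⟨_, _, B, hB, h2⟩ := isTheta_bounds hC (fun n => sq_nonneg _) (fun n => by positivity)
  refine ⟨2 + 2 * ((k ^ 2 * A) * (r ^ 2 * B)), by positivity, ?_⟩
  filter_upwards [h1, h2, hp.eventually_ge_atTop 1, hq.eventually_ge_atTop 1] with n h1 h2 hp1 hq1
  have hp' : (1 : ℝ) ≤ p n := by exact_mod_cast hp1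
  have hq' : (1 : ℝ) ≤ q n := by exact_mod_cast hq1
  have hpow : ∀ {x δ : ℝ}, 1 ≤ x → 0 ≤ δ → x ^ (1 - δ) ≤ x := fun hx hδ => by
    simpa using Real.rpow_le_rpow_of_exponent_le hx (by linarith : 1 - _ ≤ (1 : ℝ))
  have h3 : specNorm (S n).R ^ 2 ≤ A * p n :=
    h1.2.trans (mul_le_mul_of_nonneg_left (hpow hp' hδ₁.1) hA.le)
  have h4 : specNorm (S n).C ^ 2 ≤ B * q n :=
    h2.2.trans (mul_le_mul_of_nonneg_left (hpow hq' hδ₂.1) hB.le)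
  calc _ ≤ 2 * ((p n : ℝ) * q n) +
        2 * ((k ^ 2 * specNorm (S n).R ^ 2) * (r ^ 2 * specNorm (S n).C ^ 2)) :=
        (S n).sum_weightW_sq_le
    _ ≤ 2 * ((p n : ℝ) * q n) + 2 * ((k ^ 2 * (A * p n)) * (r ^ 2 * (B * q n))) := by
        gcongr
    _ = _ := by ring

theorem KnownFactorCondition.meanGramX_lower_bound (h : KnownFactorCondition S)
    (hq : Tendsto q atTop atTop) :
    ∃ c > 0, ∀ᶠ n in atTop, ∀ x : Fin m → ℝ,
      2 * c * q n * ∑ i, x i ^ 2 ≤ ∑ i, x i * (S n).meanGramX.mulVec x i := by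
  obtain ⟨-, L, hL, hlim, hθ⟩ := h
  obtain ⟨c, hc, _, _, h1⟩ := isTheta_bounds hθ (fun n => eigVal_nonneg_of_posDef (hL n) _)
    (fun n => by positivity)
  have hq' : Tendsto (fun n => (q n : ℝ)) atTop atTop := tendsto_natCast_atTop_atTop.comp hq
  -- The limit matrix gives cq, and the approximation error is eventually at most 1 ≤ cq/2; what is
  -- left is cq/2 = 2(c/4)q.
  refine ⟨c / 4, by positivity, ?_⟩
  filter_upwards [h1, hlim.eventually_le_const one_pos, hq'.eventually_ge_atTop (2 / c)]
    with n h1 h2 h3 x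
  have hx : 0 ≤ ∑ i, x i ^ 2 := Finset.sum_nonneg fun _ _ => sq_nonneg _
  have h4 := eigVal_last_mul_le (hL n).isHermitian x
  have h5 := (abs_le.1 (abs_sum_mul_mulVec_le ((S n).meanGramX - L n) x h2)).1
  have h6 : ∑ i, x i * ((S n).meanGramX - L n).mulVec x i =
      ∑ i, x i * (S n).meanGramX.mulVec x i - ∑ i, x i * (L n).mulVec x i := by
    rw [Matrix.sub_mulVec, ← Finset.sum_sub_distrib]
    exact Finset.sum_congr rfl fun i _ => by rw [Pi.sub_apply]; ring
  rw [h6] at h5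
  rw [div_le_iff₀ hc] at h3
  have h7 : c * q n * ∑ i, x i ^ 2 ≤ eigVal (L n) (m - 1) * ∑ i, x i ^ 2 :=
    mul_le_mul_of_nonneg_right h1.1 hx
  have h8 : 2 * ∑ i, x i ^ 2 ≤ q n * c * ∑ i, x i ^ 2 := mul_le_mul_of_nonneg_right h3 hx
  linarith

variable [∀ n, IsProbabilityMeasure (P n)]

/-- The one lag at which Σ_f(h) does not degenerate supplies all the signal; the other lags
contribute nonnegative terms. -/
theorem le_sum_frobSq_covW {h₀ : ℕ} (h3 : FactorCondition S h₀) (h6 : LoadingCondition S δ₁ δ₂) :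
    ∃ c > 0, ∀ᶠ n in atTop, (c * ((p n : ℝ) ^ (1 - δ₁) * (q n : ℝ) ^ (1 - δ₂))) ^ 2 ≤
      ∑ h ∈ Finset.Icc 1 h₀, frobSq ((S n).covW h) := by
  obtain ⟨h, hh1, hh0, -, hF, -⟩ := h3
  obtain ⟨-, -, -, hR, -, hC⟩ := h6
  obtain ⟨a, ha, _, _, h1⟩ := isTheta_bounds hR (fun n => sq_nonneg _) (fun n => by positivity)
  obtain ⟨b, hb, _, _, h2⟩ := isTheta_bounds hC (fun n => sq_nonneg _) (fun n => by positivity)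
  obtain ⟨c, hc, _, _, h3⟩ := isTheta_bounds hF (fun n => specNorm_nonneg _)
    (fun n => zero_le_one)
  refine ⟨a * b * c, by positivity, ?_⟩
  filter_upwards [h1, h2, h3] with n h1 h2 h3
  rw [mul_one] at h3
  calc _ = ((a * (p n : ℝ) ^ (1 - δ₁)) * (b * (q n : ℝ) ^ (1 - δ₂))) ^ 2 * c ^ 2 := by ring
    _ ≤ (minNorm (S n).R ^ 2 * minNorm (S n).C ^ 2) ^ 2 * specNorm ((S n).covF h) ^ 2 := by
        have := h1.1
        have := h2.1
        have := h3.1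
        gcongr
    _ ≤ frobSq ((S n).covW h) := (S n).le_frobSq_covW hh1
    _ ≤ _ := Finset.single_le_sum (f := fun h => frobSq ((S n).covW h))
        (fun _ _ => frobSq_nonneg _) (Finset.mem_Icc.2 ⟨hh1, hh0⟩)

theorem integral_errorStat_bounded {h₀ : ℕ} {γ : ℝ} (hγ : 2 < γ)
    (hp : Tendsto p atTop atTop) (hq : Tendsto q atTop atTop) (hT : Tendsto T atTop atTop)
    (h1 : MixingCondition S γ) (h2 : MomentCondition S γ) (h6 : LoadingCondition S δ₁ δ₂) :
    ∃ C, ∀ᶠ n in atTop, Integrable ((S n).errorStat h₀) (P n) ∧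
      ∫ ω, (S n).errorStat h₀ ω ∂P n ≤ C := by
  obtain ⟨D, hD⟩ := h1
  obtain ⟨K, hK⟩ := h2
  obtain ⟨L, hL0, hL⟩ := h6.sum_weightW_sq_le hp hq
  set K₁ : ℝ := ((r * k + 1 : ℕ) : ℝ) ^ (2 * γ - 1) * ((r * k + 1 : ℕ) * K)
  set K' : ℝ := max 0 (max K K₁)
  refine ⟨2 * h₀ * L ^ 2 * Model.lagConst h₀ K' D + m * L * Model.lagConst 0 K' D + m ^ 2 * Model.lagConst 0 K' D +
    m * (1 + K') + L * (1 + K'), ?_⟩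
  filter_upwards [hL, hp.eventually_ge_atTop 1, hq.eventually_ge_atTop 1,
    hT.eventually_ge_atTop 1, hT.eventually_ge_atTop (2 * h₀)] with n hL hp1 hq1 hT1 hTh
  have hX := fun l i => (S n).observedSeries_X (fun t ht => (hK n t ht).2.1) l i
  have hW := fun u i => (S n).observedSeries_W (by linarith : 1 ≤ 2 * γ)
    (fun t ht => (hK n t ht).1) (fun t ht => (hK n t ht).2.2) u i
  exact (S n).integral_errorStat_le (K := K') hγ hp1 hq1 hT1 hTh
    (fun u i => ⟨(hW u i).measurable, fun t ht => ((hW u i).moment t ht).mono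
      ((le_max_right _ _).trans (le_max_right _ _))⟩)
    (fun l i => ⟨(hX l i).measurable, fun t ht => ((hX l i).moment t ht).mono
      ((le_max_left _ _).trans (le_max_right _ _))⟩) (le_max_left _ _) (hD n).1 (hD n).2 hL

/-- This is where the rate appears: by `rate_mul_sq`, p²q²/T is the squared rate times the squared
signal order p^(1-δ₁) q^(1-δ₂). -/
theorem sum_frobSq_covWhat_sub_le_rate {h₀ : ℕ}
    (hp : Tendsto p atTop atTop) (hq : Tendsto q atTop atTop) (hT : Tendsto T atTop atTop)
    (h3 : FactorCondition S h₀) (h4 : KnownFactorCondition S) (h6 : LoadingCondition S δ₁ δ₂)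
    {z : ℝ} (hz : 0 < z) :
    ∃ B, 0 ≤ B ∧ ∀ᶠ n in atTop, ∀ ω, (S n).errorStat h₀ ω ≤ z →
      ∑ h ∈ Finset.Icc 1 h₀, frobSq ((S n).covWhat h ω - (S n).covW h) ≤
        (B * rate p q T δ₁ δ₂ n) ^ 2 * ∑ h ∈ Finset.Icc 1 h₀, frobSq ((S n).covW h) := by
  obtain ⟨c, hc, hG⟩ := h4.meanGramX_lower_bound hq
  obtain ⟨b, hb, hlow⟩ := le_sum_frobSq_covW h3 h6
  set A : ℝ := 4 * z + h₀ * (4 * (8 * (z ^ 3 / c ^ 2) + 4 * (z ^ 4 / c ^ 4))) with hA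
  have hA0 : 0 ≤ A := by positivity
  have hT' : Tendsto (fun n => (T n : ℝ)) atTop atTop := tendsto_natCast_atTop_atTop.comp hT
  refine ⟨Real.sqrt A / b, by positivity, ?_⟩
  filter_upwards [hG, hlow, hp.eventually_ge_atTop 1, hq.eventually_ge_atTop 1,
    hT.eventually_ge_atTop 1, hT.eventually_ge_atTop (2 * h₀),
    hT'.eventually_ge_atTop (z / c ^ 2)] with n hG hlow hp1 hq1 hT1 hTh hTz ω hω
  have hT0 : (0 : ℝ) < T n := by exact_mod_cast hT1
  refine ((S n).sum_frobSq_covWhat_sub_le hω hp1 hq1 hT1 hTh hc hG ?_).trans ?_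
  · rw [div_le_iff₀ (by positivity)] at hTz
    rw [div_le_iff₀ hT0]
    linarith
  · rw [← rate_mul_sq (δ₁ := δ₁) (δ₂ := δ₂) hp1 hq1 hT1, ← hA]
    calc _ = (Real.sqrt A / b * rate p q T δ₁ δ₂ n) ^ 2 *
          (b * ((p n : ℝ) ^ (1 - δ₁) * (q n : ℝ) ^ (1 - δ₂))) ^ 2 := by
          have : A = Real.sqrt A ^ 2 := (Real.sq_sqrt hA0).symm
          conv_lhs => rw [this]
          field_simp
      _ ≤ _ := by gcongr

/-- Leading eigenvectors of block Gram matrices converge at the relative rate of the blocks. -/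
theorem isBigOp_leading_blockGram {h₀ d : ℕ} {a b : ℕ → ℕ}
    {G : ∀ n, ℕ → Matrix (Fin (b n) × Fin (a n)) (Fin (b n) × Fin (a n)) ℝ}
    {G' : ∀ n, Ω n → ℕ → Matrix (Fin (b n) × Fin (a n)) (Fin (b n) × Fin (a n)) ℝ}
    {Z : ∀ n, Ω n → ℝ} (hZ0 : ∀ n ω, 0 ≤ Z n ω) {C : ℝ}
    (hZ : ∀ᶠ n in atTop, Integrable (Z n) (P n) ∧ ∫ ω, Z n ω ∂P n ≤ C)
    {x : ℕ → ℝ} (hx0 : ∀ n, 0 ≤ x n) (hx : Tendsto x atTop (𝓝 0))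
    (hclose : ∀ z, 0 < z → ∃ B, 0 ≤ B ∧ ∀ᶠ n in atTop, ∀ ω, Z n ω ≤ z →
      ∑ h ∈ Finset.Icc 1 h₀, frobSq (G' n ω h - G n h) ≤
        (B * x n) ^ 2 * ∑ h ∈ Finset.Icc 1 h₀, frobSq (G n h))
    (hrank : ∀ n, (blockGram h₀ (G n)).rank ≤ d)
    (heig : DistinctPositiveEigenvalues (fun n => blockGram h₀ (G n)) d)
    {Q : ∀ n, Matrix (Fin (a n)) (Fin d) ℝ} {Q' : ∀ n, Ω n → Matrix (Fin (a n)) (Fin d) ℝ}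
    (hQ : ∀ᶠ n in atTop, IsLeadingEigenvectors (blockGram h₀ (G n)) (Q n))
    (hQ' : ∀ᶠ n in atTop, ∀ ω, IsLeadingEigenvectors (blockGram h₀ (G' n ω)) (Q' n ω))
    (hsign : ∀ᶠ n in atTop, ∀ ω, ∀ j : Fin d, 0 ≤ ∑ u, Q' n ω u j * Q n u j) :
    IsBigOp P (fun n ω => specNorm (Q' n ω - Q n)) x := by
  refine isBigOp_of_bounded_mean hx0 hZ0 hZ fun z hz => ?_
  obtain ⟨B, hB0, hB⟩ := hclose z hz
  obtain ⟨c, hc, hM⟩ := heig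
  refine ⟨Real.sqrt (8 * d) * (d / c * (B ^ 2 + 2 * B)), ?_⟩
  filter_upwards [hB, hM, hQ, hQ', hsign, hx.eventually_le_const one_pos]
    with n hB hM hQ hQ' hsign hx1 ω hω
  have hxn := hx0 n
  rw [abs_of_nonneg (specNorm_nonneg _)]
  refine (specNorm_leading_blockGram_le (hrank n) hc (mul_nonneg hB0 hxn) hM.1 hM.2.1 hM.2.2 hQ
    (hQ' ω) (hsign ω) (hB ω hω)).trans ?_
  rw [mul_assoc, mul_assoc (d / c : ℝ)]
  -- Eventually x n ≤ 1, so the quadratic term is absorbed into the linear one.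
  have : (B * x n) ^ 2 + 2 * (B * x n) ≤ (B ^ 2 + 2 * B) * x n := by
    nlinarith [mul_nonneg (sq_nonneg B) (mul_nonneg hxn (sub_nonneg.2 hx1))]
  gcongr

end Sequence

end MatrixFactor

end

/-! ### The convergence rate of the estimated loading spaces. -/

theorem theorem2 {Ω : ℕ → Type*} [∀ n, MeasurableSpace (Ω n)] (P : ∀ n, Measure (Ω n))
    [∀ n, IsProbabilityMeasure (P n)] (m k r h₀ : ℕ) (p q T : ℕ → ℕ)
    (hp : Tendsto p atTop atTop) (hq : Tendsto q atTop atTop) (hT : Tendsto T atTop atTop)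
    (S : ∀ n, Model (p n) (q n) m k r (T n) (P n))
    (γ : ℝ) (hγ : 2 < γ) (δ₁ δ₂ : ℝ)
    (h1 : MixingCondition S γ)
    (h2 : MomentCondition S γ)
    (h3 : FactorCondition S h₀)
    (h4 : KnownFactorCondition S)
    (h5 : NoiseCondition S)
    (h6 : LoadingCondition S δ₁ δ₂)
    (h7 : DistinctPositiveEigenvalues (fun n => (S n).M₁ h₀) k ∧
      DistinctPositiveEigenvalues (fun n => (S n).M₂ h₀) r)
    (hrate : Tendsto (rate p q T δ₁ δ₂) atTop (𝓝 0))
    (Q₁ : ∀ n, Matrix (Fin (p n)) (Fin k) ℝ) (Q₂ : ∀ n, Matrix (Fin (q n)) (Fin r) ℝ)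
    (hQ₁ : ∀ᶠ n in atTop, IsLeadingEigenvectors ((S n).M₁ h₀) (Q₁ n))
    (hQ₂ : ∀ᶠ n in atTop, IsLeadingEigenvectors ((S n).M₂ h₀) (Q₂ n))
    (Qhat₁ : ∀ n, Ω n → Matrix (Fin (p n)) (Fin k) ℝ)
    (Qhat₂ : ∀ n, Ω n → Matrix (Fin (q n)) (Fin r) ℝ)
    (hQhat₁ : ∀ᶠ n in atTop, ∀ ω, IsLeadingEigenvectors ((S n).Mhat₁ h₀ ω) (Qhat₁ n ω))
    (hQhat₂ : ∀ᶠ n in atTop, ∀ ω, IsLeadingEigenvectors ((S n).Mhat₂ h₀ ω) (Qhat₂ n ω))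
    (hsign₁ : ∀ᶠ n in atTop, ∀ ω, ∀ j : Fin k, 0 ≤ ∑ u, Qhat₁ n ω u j * Q₁ n u j)
    (hsign₂ : ∀ᶠ n in atTop, ∀ ω, ∀ j : Fin r, 0 ≤ ∑ u, Qhat₂ n ω u j * Q₂ n u j) :
    IsBigOp P (fun n ω => specNorm (Qhat₁ n ω - Q₁ n)) (rate p q T δ₁ δ₂) ∧
    IsBigOp P (fun n ω => specNorm (Qhat₂ n ω - Q₂ n)) (rate p q T δ₁ δ₂) := by
  obtain ⟨C, hC⟩ := integral_errorStat_bounded (h₀ := h₀) hγ hp hq hT h1 h2 h6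
  have hclose := fun z (hz : 0 < z) =>
    sum_frobSq_covWhat_sub_le_rate (z := z) hp hq hT h3 h4 h6 hz
  have hstat := fun n ω => (S n).errorStat_nonneg h₀ ω
  have hrank₁ := fun n => (S n).rank_M₁_le h₀
  have hrank₂ := fun n => (S n).rank_M₂_le h₀
  simp only [Model.M₁_eq, Model.M₂_eq, Model.Mhat₁_eq, Model.Mhat₂_eq] at *
  refine ⟨isBigOp_leading_blockGram hstat hC (rate_nonneg δ₁ δ₂) hrate hclose hrank₁ h7.1 hQ₁
    hQhat₁ hsign₁, isBigOp_leading_blockGram hstat hC (rate_nonneg δ₁ δ₂) hrate ?_ hrank₂ h7.2 hQ₂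
    hQhat₂ hsign₂⟩
  -- For M₂ the same autocovariances appear with swapped index pairs, and the swap preserves both
  -- sides of the relative error bound.
  intro z hz
  obtain ⟨B, hB0, hB⟩ := hclose z hz
  refine ⟨B, hB0, ?_⟩
  filter_upwards [hB] with n hB ω hω
  have e : ∀ h, ((S n).covWhat h ω).submatrix Prod.swap Prod.swap -
      ((S n).covW h).submatrix Prod.swap Prod.swap =
      ((S n).covWhat h ω - (S n).covW h).submatrix Prod.swap Prod.swap := fun h => rfl
  simp only [e, frobSq_submatrix_swap]
  exact hB ω hω
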